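/- Let $M$ be the figure-eight knot complement, with $\pi_1(M)=\langle x,y\mid w\rangle$, $w=axa^{-1}y^{-1}$, $a=xy^{-1}x^{-1}y$; put $b=xy^{-1}$, let $x$ be the meridian, $l=b^{-1}a^{-1}ba$ the longitude, and $T^2$ the boundary torus, with $\pi_1(T^2)=\langle x,l\rangle$. A point of hyperbolic Dehn filling space $U$ is a pair of tetrahedral shapes $z_1,z_2\in\mathbb C$ with positive imaginary parts such that (principal logarithms) $$2\log z_1+\log\tfrac1{1-z_1}+\log z_2+2\log\bigl(1-\tfrac1{z_2}\bigr)=2\pi i,\qquad \log\tfrac1{1-z_1}+2\log\bigl(1-\tfrac1{z_1}\bigr)+\log z_2+2\log\tfrac1{1-z_2}=2\pi i .$$ Its complex lengths are $u=\log\bigl(z_1(1-z_2)\bigr)$ and $v=2\log\bigl(-(1-z_2)^2/z_2\bigr)$; the point is determined by $u$, so that $U$ is viewed as a subset of $\mathbb C$. With $m=z_1(1-z_2)$, the holonomy $\rho_u:\pi_1(M)\to \mathrm{PSL}(2,\mathbb C)=\mathrm{PGL}(2,\mathbb C)$ is given by $x\mapsto\begin{pmatrix}1&-1\\0&m\end{pmatrix}$,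 $y\mapsto\begin{pmatrix}m&0\\-z_2&1\end{pmatrix}$, and $\mathrm{PSL}(2,\mathbb C)$ is mapped to $O(3,1)$ through its action on Hermitian $2\times2$ matrices. The group $\pi_1(M)$ acts on $\mathfrak{sl}(4,\mathbb R)$ by $\mathrm{Ad}\,\rho_u$ and preserves the $9$-dimensional orthogonal complement of $\mathfrak{so}(3,1)$ with respect to the Killing form; this $\pi_1(M)$-module is denoted $\mathfrak v_u$. Cohomology is group cohomology of the fundamental group; $H^i(x;\cdot)$, $H^i(l;\cdot)$ refer to the cyclic groups $\langle x\rangle,\langle l\rangle\subset\pi_1(M)$, and $\mathrm{res}_x,\mathrm{res}_l$ are the restriction maps from $H^1(M;\mathfrak v_u)$. The Fox derivative $\partial w/\partial y$ acts on $\mathfrak v_u$ as a linear endomorphism. Let $a_u$ be a basis of a one-dimensional $H^0(T^2;\mathfrak v_u)=\mathfrak v_u^{\langle x,l\rangle}$ and let $[z]$ generate a one-dimensional $H^1(M;\mathfrak v_u)$. If $z(x)\in c_1a_u+\mathrm{im}(1-x)$ and $z(l)\in c_2a_u+\mathrm{im}(1-l)$ with $c_1,c_2\in\mathbb R\setminus\{0\}$,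 then $s_u=c_1/c_2$ is called the slope of $\rho_u$. For coprime integers $p,q$ with $pu+qv=2\pi i$, $\rho_u$ factors through $\pi_1(M_{p,q})=\pi_1(M)/\langle\langle x^pl^q\rangle\rangle$, where $M_{p,q}$ is the $(p,q)$-Dehn filling, and $M_{p,q}$ is called infinitesimally projectively rigid if $H^1(\pi_1(M_{p,q});\mathfrak{sl}(4,\mathbb R)_{\mathrm{Ad}\rho_u})=0$. **Theorem.** Let $u\in U$ be such that the kernel of $\partial w/\partial y$ on $\mathfrak v_u$ has dimension $1$ and $\dim H^0(x;\mathfrak v_u)=1$. Then: 1. $\dim H^1(M;\mathfrak v_u)=1$ and $\mathrm{res}_x:H^1(M;\mathfrak v_u)\to H^1(x;\mathfrak v_u)$ is an isomorphism. 2. On a neighbourhood of $u$ there are a smooth choice of bases $a_{u'}$ of $H^0(T^2;\mathfrak v_{u'})$ and a smooth choice of cocycles $z_{u'}\in Z^1(M;\mathfrak v_{u'})$ such that $z_{u'}(x)=a_{u'}$ and $z_{u'}(l)=t_{u'}a_{u'}$ for some $t_{u'}\in\mathbb R$. 3. Let $a_u$ be any basis of $H^0(T^2;\mathfrak v_u)$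 and $z_u\in Z^1(M;\mathfrak v_u)$ any cocycle with $z_u(x)=a_u$ and $z_u(l)=ta_u$. If $t\neq0$, then $\mathrm{res}_l$ is injective (and an isomorphism if $\dim H^0(l;\mathfrak v_u)=1$), the slope $s_u$ exists and is unique, and $t=s_u^{-1}$. 4. In the situation of 3, if $p,q$ are coprime integers with $pu+qv=2\pi i$ and $s_u\neq-q/p$ (a condition that is void if $p=0$), then $M_{p,q}$ is infinitesimally projectively rigid, and $H^1(M_{p,q};\mathfrak v_u)=0$. -/

import Mathlib

open scoped ContDiff

noncomputable section

namespace FigEight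

open Matrix

/-! ### The fundamental group of the figure-eight knot complement -/

/-- The generator `x` of the free group on two letters. -/
def wx : FreeGroup (Fin 2) := FreeGroup.of 0

/-- The generator `y` of the free group on two letters. -/
def wy : FreeGroup (Fin 2) := FreeGroup.of 1

/-- The word `a = x y⁻¹ x⁻¹ y`. -/
def wa : FreeGroup (Fin 2) := wx * wy⁻¹ * wx⁻¹ * wy

/-- The relator `w = a x a⁻¹ y⁻¹`. -/
def relator : FreeGroup (Fin 2) := wa * wx * wa⁻¹ * wy⁻¹

/-- `π₁(M) = ⟨x, y | a x = y a⟩`, where `M` is the figure-eight knot complement. -/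
abbrev Pi1 : Type := PresentedGroup ({relator} : Set (FreeGroup (Fin 2)))

/-- The meridian. -/
def x : Pi1 := PresentedGroup.of 0

def y : Pi1 := PresentedGroup.of 1

def a : Pi1 := x * y⁻¹ * x⁻¹ * y

def b : Pi1 := x * y⁻¹

/-- The longitude. -/
def l : Pi1 := b⁻¹ * a⁻¹ * b * a

/-- The fundamental group of the circle `x`. -/
def circleX : Subgroup Pi1 := Subgroup.zpowers x

/-- The fundamental group of the circle `l`. -/
def circleL : Subgroup Pi1 := Subgroup.zpowers l

/-- The fundamental group of the boundary torus. -/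
def torus : Subgroup Pi1 := Subgroup.closure {x, l}

/-- The fundamental group of the Dehn filling `M_{p,q}`, in which `x ^ p * l ^ q` bounds a disc. -/
abbrev FillGroup (p q : ℤ) : Type := Pi1 ⧸ Subgroup.normalClosure ({x ^ p * l ^ q} : Set Pi1)

/-! ### Fox calculus -/

/-- Fox derivative of a word, with `(i, true)` the letter `i` and `(i, false)` its inverse. -/
def foxWord {α : Type} [DecidableEq α] (j : α) :
    List (α × Bool) → MonoidAlgebra ℤ (FreeGroup α)
  | [] => 0
  | (i, true) :: L =>
      (if i = j then 1 else 0) + MonoidAlgebra.of ℤ _ (FreeGroup.of i) * foxWord j L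
  | (i, false) :: L =>
      (if i = j then -MonoidAlgebra.of ℤ _ (FreeGroup.of i)⁻¹ else 0) +
        MonoidAlgebra.of ℤ _ (FreeGroup.of i)⁻¹ * foxWord j L

/-- The Fox derivative `∂g/∂j` in the group ring of the free group. -/
def fox {α : Type} [DecidableEq α] (j : α) (g : FreeGroup α) : MonoidAlgebra ℤ (FreeGroup α) :=
  foxWord j g.toWord

/-- The action of the Fox derivative `∂g/∂j` on a `π₁(M)`-module. -/
def foxAction (A : Rep ℝ Pi1) (j : Fin 2) (g : FreeGroup (Fin 2)) : Module.End ℝ A :=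
  MonoidAlgebra.lift ℤ (Module.End ℝ A) (FreeGroup (Fin 2))
    (A.ρ.comp (PresentedGroup.mk ({relator} : Set (FreeGroup (Fin 2))))) (fox j g)

/-! ### Lorentz geometry and the module `𝔳` -/

/-- The Lorentz form `x₁² + x₂² + x₃² - x₄²`. -/
def J : Matrix (Fin 4) (Fin 4) ℝ := diagonal ![1, 1, 1, -1]

/-- The group of linear isometries of the Lorentz form. -/
def O31 : Subgroup (GL (Fin 4) ℝ) where
  carrier := {g | (g : Matrix (Fin 4) (Fin 4) ℝ)ᵀ * J * (g : Matrix (Fin 4) (Fin 4) ℝ) = J}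
  one_mem' := by simp
  mul_mem' {g h} hg hh := by
    simp only [Set.mem_ofPred_eq, Units.val_mul, transpose_mul] at *
    calc _ = (h : Matrix (Fin 4) (Fin 4) ℝ)ᵀ *
          ((g : Matrix (Fin 4) (Fin 4) ℝ)ᵀ * J * (g : Matrix (Fin 4) (Fin 4) ℝ)) *
          (h : Matrix (Fin 4) (Fin 4) ℝ) := by simp only [Matrix.mul_assoc]
      _ = J := by rw [hg, hh]
  inv_mem' {g} hg := by
    simp only [Set.mem_ofPred_eq] at *
    have h1 : (g : Matrix (Fin 4) (Fin 4) ℝ) * ((g⁻¹ : GL (Fin 4) ℝ) : Matrix (Fin 4) (Fin 4) ℝ)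
        = 1 := by rw [← Units.val_mul]; simp
    have h2 : ((g⁻¹ : GL (Fin 4) ℝ) : Matrix (Fin 4) (Fin 4) ℝ)ᵀ *
        (g : Matrix (Fin 4) (Fin 4) ℝ)ᵀ = 1 := by rw [← transpose_mul, h1, transpose_one]
    conv_lhs => rw [← hg]
    calc _ = (((g⁻¹ : GL (Fin 4) ℝ) : Matrix (Fin 4) (Fin 4) ℝ)ᵀ *
          (g : Matrix (Fin 4) (Fin 4) ℝ)ᵀ) * J * ((g : Matrix (Fin 4) (Fin 4) ℝ) *
          ((g⁻¹ : GL (Fin 4) ℝ) : Matrix (Fin 4) (Fin 4) ℝ)) := by simp only [Matrix.mul_assoc]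
      _ = J := by rw [h1, h2]; simp

/-- The Lie algebra `𝔰𝔩(4, ℝ)`. -/
def sl4 : Submodule ℝ (Matrix (Fin 4) (Fin 4) ℝ) :=
  LinearMap.ker (traceLinearMap (Fin 4) ℝ ℝ)

/-- The Lie algebra `𝔰𝔬(3, 1)`. -/
def so31 : Submodule ℝ (Matrix (Fin 4) (Fin 4) ℝ) where
  carrier := {A | A.trace = 0 ∧ Aᵀ * J = -(J * A)}
  zero_mem' := by simp
  add_mem' {A B} hA hB := by
    refine ⟨by rw [trace_add, hA.1, hB.1, add_zero], ?_⟩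
    rw [transpose_add, add_mul, hA.2, hB.2, mul_add, neg_add]
  smul_mem' c A hA := by
    refine ⟨by rw [trace_smul, hA.1, smul_zero], ?_⟩
    rw [transpose_smul, smul_mul, hA.2, mul_smul_comm, smul_neg]

/-- The Killing form of `𝔰𝔩(4, ℝ)`. -/
def killing (A B : Matrix (Fin 4) (Fin 4) ℝ) : ℝ := 8 * (A * B).trace

/-- `𝔳`, the orthogonal complement of `𝔰𝔬(3, 1)` in `𝔰𝔩(4, ℝ)` for the Killing form. -/
def vMod : Submodule ℝ (Matrix (Fin 4) (Fin 4) ℝ) where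
  carrier := {A | A ∈ sl4 ∧ ∀ B ∈ so31, killing A B = 0}
  zero_mem' := ⟨sl4.zero_mem, fun B _ => by simp [killing]⟩
  add_mem' {A A'} hA hA' := ⟨sl4.add_mem hA.1 hA'.1, fun B hB => by
    have h1 := hA.2 B hB
    have h2 := hA'.2 B hB
    simp only [killing, add_mul, trace_add] at *
    linarith⟩
  smul_mem' c A hA := ⟨sl4.smul_mem c hA.1, fun B hB => by
    have h1 := hA.2 B hB
    simp only [killing, smul_mul, trace_smul, smul_eq_mul] at *
    linear_combination c * h1⟩

/-- The adjoint action by conjugation on all `4 × 4` matrices. -/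
def ad {G : Type} [Group G] (ρ : G →* O31) :
    Representation ℝ G (Matrix (Fin 4) (Fin 4) ℝ) where
  toFun g := LinearMap.mulLeftRight ℝ
    (((ρ g : GL (Fin 4) ℝ) : Matrix (Fin 4) (Fin 4) ℝ),
      (((ρ g)⁻¹ : O31) : GL (Fin 4) ℝ).val)
  map_one' := by ext1 A; simp
  map_mul' g h := by
    ext1 A
    simp [Matrix.mul_assoc]

theorem ad_apply {G : Type} [Group G] (ρ : G →* O31) (g : G) (A : Matrix (Fin 4) (Fin 4) ℝ) :
    ad ρ g A = ((ρ g : GL (Fin 4) ℝ) : Matrix (Fin 4) (Fin 4) ℝ) * A *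
      (((ρ g)⁻¹ : O31) : GL (Fin 4) ℝ).val := by
  simp [ad]

theorem val_mul_inv (g : O31) :
    ((g : GL (Fin 4) ℝ) : Matrix (Fin 4) (Fin 4) ℝ) * ((g⁻¹ : O31) : GL (Fin 4) ℝ).val = 1 := by
  rw [← Units.val_mul]; simp

theorem val_inv_mul (g : O31) :
    ((g⁻¹ : O31) : GL (Fin 4) ℝ).val * ((g : GL (Fin 4) ℝ) : Matrix (Fin 4) (Fin 4) ℝ) = 1 := by
  rw [← Units.val_mul]; simp

theorem sl4_le_comap {G : Type} [Group G] (ρ : G →* O31) (g : G) :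
    sl4 ≤ sl4.comap (ad ρ g) := by
  intro A hA
  simp only [sl4, Submodule.mem_comap, LinearMap.mem_ker, traceLinearMap_apply, ad_apply] at *
  rw [trace_mul_comm, ← Matrix.mul_assoc, val_inv_mul, Matrix.one_mul, hA]

/-- Conjugation by a Lorentz isometry preserves `𝔰𝔬(3, 1)`. -/
theorem conj_mem_so31 (g : O31) {B : Matrix (Fin 4) (Fin 4) ℝ} (hB : B ∈ so31) :
    ((g⁻¹ : O31) : GL (Fin 4) ℝ).val * B * ((g : GL (Fin 4) ℝ) : Matrix (Fin 4) (Fin 4) ℝ) ∈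
      so31 := by
  obtain ⟨h1, h2⟩ := hB
  set P := ((g : GL (Fin 4) ℝ) : Matrix (Fin 4) (Fin 4) ℝ) with hP
  set Q := ((g⁻¹ : O31) : GL (Fin 4) ℝ).val with hQ
  have hQP : Q * P = 1 := val_inv_mul g
  have hPQ : P * Q = 1 := val_mul_inv g
  have hJ : Pᵀ * J * P = J := g.2
  have hJ2 : Pᵀ * J = J * Q := by
    calc Pᵀ * J = Pᵀ * J * (P * Q) := by rw [hPQ, Matrix.mul_one]
      _ = (Pᵀ * J * P) * Q := by simp only [Matrix.mul_assoc]
      _ = J * Q := by rw [hJ]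
  have hJ3 : Qᵀ * J = J * P := by
    have : Qᵀ * Pᵀ = 1 := by rw [← transpose_mul, hPQ, transpose_one]
    calc Qᵀ * J = Qᵀ * (Pᵀ * J * P) := by rw [hJ]
      _ = (Qᵀ * Pᵀ) * J * P := by simp only [Matrix.mul_assoc]
      _ = J * P := by rw [this, Matrix.one_mul]
  refine ⟨?_, ?_⟩
  · rw [trace_mul_comm, ← Matrix.mul_assoc, hPQ, Matrix.one_mul, h1]
  · calc (Q * B * P)ᵀ * J = Pᵀ * (Bᵀ * (Qᵀ * J)) := by
          simp only [transpose_mul, Matrix.mul_assoc]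
      _ = Pᵀ * ((Bᵀ * J) * P) := by rw [hJ3, Matrix.mul_assoc]
      _ = -((Pᵀ * J) * B * P) := by
          rw [h2]; simp only [Matrix.mul_assoc, Matrix.neg_mul, Matrix.mul_neg]
      _ = -(J * (Q * B * P)) := by rw [hJ2]; simp only [Matrix.mul_assoc]

theorem vMod_le_comap {G : Type} [Group G] (ρ : G →* O31) (g : G) :
    vMod ≤ vMod.comap (ad ρ g) := by
  intro A hA
  refine ⟨sl4_le_comap ρ g hA.1, fun B hB => ?_⟩
  have h := hA.2 _ (conj_mem_so31 (ρ g) hB)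
  simp only [killing, ad_apply] at *
  rw [← h, Matrix.mul_assoc, Matrix.mul_assoc, trace_mul_comm]
  simp only [Matrix.mul_assoc]

/-- `𝔰𝔩(4, ℝ)` as a module through the adjoint action. -/
def slRep {G : Type} [Group G] (ρ : G →* O31) : Rep ℝ G :=
  Rep.of ((ad ρ).subrepresentation sl4 (sl4_le_comap ρ))

/-- `𝔳` as a module through the adjoint action. -/
def vRep {G : Type} [Group G] (ρ : G →* O31) : Rep ℝ G :=
  Rep.of ((ad ρ).subrepresentation vMod (vMod_le_comap ρ))

/-- A closed hyperbolic manifold with fundamental group `G` and holonomy `ρ` is infinitesimally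
projectively rigid if `H¹(G; 𝔰𝔩(4, ℝ)_{Ad ρ}) = 0`. -/
def InfProjRigid {G : Type} [Group G] (ρ : G →* O31) : Prop :=
  Subsingleton (groupCohomology.H1 (slRep ρ))

/-! ### From `PSL(2, ℂ)` to the Lorentz group -/

/-- The Hermitian matrix with Lorentz coordinates `X`. The boundary point `p ∈ ℂ`, that is, the
line of the Hermitian matrix of rank one `(p, 1)(p, 1)*`, has Lorentz coordinates
`[4 Re p : 4 Im p : 4 - |p|² : 4 + |p|²]`. -/
def herm : (Fin 4 → ℝ) →ₗ[ℝ] Matrix (Fin 2) (Fin 2) ℂ where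
  toFun X := !![((X 3 - X 2) / 2 : ℂ), (X 0 + X 1 * Complex.I) / 4;
    (X 0 - X 1 * Complex.I) / 4, (X 2 + X 3) / 8]
  map_add' X Y := by
    ext i j; fin_cases i <;> fin_cases j <;> simp <;> ring
  map_smul' c X := by
    ext i j; fin_cases i <;> fin_cases j <;> simp <;> ring

/-- The Lorentz coordinates of a Hermitian matrix, inverse to `herm`. -/
def coords : Matrix (Fin 2) (Fin 2) ℂ →ₗ[ℝ] (Fin 4 → ℝ) where
  toFun H := ![4 * (H 0 1).re, 4 * (H 0 1).im, 4 * (H 1 1).re - (H 0 0).re,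
    4 * (H 1 1).re + (H 0 0).re]
  map_add' H K := by
    ext i; fin_cases i <;> simp <;> ring
  map_smul' c H := by
    ext i; fin_cases i <;> simp <;> ring

theorem coords_herm (X : Fin 4 → ℝ) : coords (herm X) = X := by
  ext i; fin_cases i <;> simp [coords, herm] <;> ring

theorem herm_coords {H : Matrix (Fin 2) (Fin 2) ℂ} (hH : Hᴴ = H) : herm (coords H) = H := by
  have h00 := congrFun (congrFun hH 0) 0
  have h11 := congrFun (congrFun hH 1) 1
  have h10 := congrFun (congrFun hH 1) 0
  simp only [conjTranspose_apply, Complex.star_def, Complex.ext_iff, Complex.conj_re,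
    Complex.conj_im] at h00 h11 h10
  ext i j
  fin_cases i <;> fin_cases j <;> apply Complex.ext <;> simp [coords, herm] <;>
    linarith [h00.2, h11.2, h10.1, h10.2]

theorem herm_isHermitian (X : Fin 4 → ℝ) : (herm X)ᴴ = herm X := by
  ext i j
  fin_cases i <;> fin_cases j <;> simp [herm, Complex.ext_iff]

/-- The real-linear map `H ↦ g H g*` on Hermitian matrices, in Lorentz coordinates. -/
def kleinLin (g : Matrix (Fin 2) (Fin 2) ℂ) : (Fin 4 → ℝ) →ₗ[ℝ] (Fin 4 → ℝ) :=
  coords ∘ₗ (LinearMap.mulLeftRight ℝ (g, gᴴ)) ∘ₗ herm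

theorem kleinLin_apply (g : Matrix (Fin 2) (Fin 2) ℂ) (X : Fin 4 → ℝ) :
    kleinLin g X = coords (g * herm X * gᴴ) := by
  simp [kleinLin]

theorem herm_kleinLin (g : Matrix (Fin 2) (Fin 2) ℂ) (X : Fin 4 → ℝ) :
    herm (kleinLin g X) = g * herm X * gᴴ := by
  rw [kleinLin_apply, herm_coords]
  simp [conjTranspose_mul, herm_isHermitian, Matrix.mul_assoc]

theorem kleinLin_one : kleinLin 1 = LinearMap.id := by
  refine LinearMap.ext fun X => ?_
  simp [kleinLin_apply, coords_herm]

theorem kleinLin_mul (g h : Matrix (Fin 2) (Fin 2) ℂ) :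
    kleinLin (g * h) = kleinLin g ∘ₗ kleinLin h := by
  refine LinearMap.ext fun X => ?_
  rw [LinearMap.comp_apply, kleinLin_apply g, herm_kleinLin, kleinLin_apply]
  simp [conjTranspose_mul, Matrix.mul_assoc]

/-- The matrix of the isometry of the Klein model induced by `g`. -/
def kleinMat : GL (Fin 2) ℂ →* Matrix (Fin 4) (Fin 4) ℝ where
  toFun g := ‖g.val.det‖⁻¹ • LinearMap.toMatrix' (kleinLin g.val)
  map_one' := by simp [kleinLin_one]
  map_mul' g h := by
    simp only [Units.val_mul, det_mul, norm_mul, kleinLin_mul, LinearMap.toMatrix'_comp, mul_inv]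
    simp only [smul_mul, mul_smul_comm, smul_smul]
    rw [mul_comm]

/-- The Lorentz form is `-16` times the determinant of the Hermitian matrix. -/
theorem det_herm (X : Fin 4 → ℝ) : (X ⬝ᵥ (J *ᵥ X) : ℝ) = -16 * (herm X).det := by
  simp [J, herm, det_fin_two, dotProduct, Fin.sum_univ_four, mulVec_diagonal]
  ring_nf
  simp

theorem kleinMat_quad (g : GL (Fin 2) ℂ) (X : Fin 4 → ℝ) :
    (kleinMat g *ᵥ X) ⬝ᵥ (J *ᵥ (kleinMat g *ᵥ X)) = X ⬝ᵥ (J *ᵥ X) := by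
  have hd : ‖g.val.det‖ ≠ 0 := norm_ne_zero_iff.2 (by simpa using g.det.ne_zero)
  have h : kleinMat g *ᵥ X = ‖g.val.det‖⁻¹ • kleinLin g.val X := by
    simp [kleinMat, smul_mulVec, LinearMap.toMatrix'_mulVec]
  rw [h]
  simp only [mulVec_smul, smul_dotProduct, dotProduct_smul, smul_eq_mul]
  have h2 : ((kleinLin g.val X ⬝ᵥ (J *ᵥ kleinLin g.val X) : ℝ) : ℂ) =
      ((‖g.val.det‖ ^ 2 * (X ⬝ᵥ (J *ᵥ X)) : ℝ) : ℂ) := by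
    rw [det_herm, herm_kleinLin, det_mul, det_mul, det_conjTranspose]
    push_cast
    rw [det_herm, ← Complex.mul_conj', Complex.star_def]
    ring
  have h3 := Complex.ofReal_injective h2
  rw [h3]
  field_simp

theorem kleinMat_isometry (g : GL (Fin 2) ℂ) : (kleinMat g)ᵀ * J * kleinMat g = J := by
  set P := kleinMat g with hP
  have hsym : ∀ K : Matrix (Fin 4) (Fin 4) ℝ, Kᵀ = K → (∀ X, X ⬝ᵥ (K *ᵥ X) = 0) → K = 0 := by
    intro K hK hq
    have e : ∀ i j, K i j = (Pi.single i 1 : Fin 4 → ℝ) ⬝ᵥ (K *ᵥ Pi.single j 1) := by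
      intro i j; simp
    ext i j
    have h1 := hq (Pi.single i 1 + Pi.single j 1)
    have h2 := hq (Pi.single i 1)
    have h3 := hq (Pi.single j 1)
    simp only [mulVec_add, add_dotProduct, dotProduct_add, ← e] at h1 h2 h3
    have h4 : K j i = K i j := congrFun (congrFun hK i) j
    change K i j = 0
    linarith
  have hJ : Jᵀ = J := by simp [J]
  rw [← sub_eq_zero]
  apply hsym
  · simp [transpose_sub, transpose_mul, hJ, Matrix.mul_assoc]
  · intro X
    have := kleinMat_quad g X
    rw [sub_mulVec, dotProduct_sub, sub_eq_zero, ← this, dotProduct_comm, ← mulVec_mulVec,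
      ← mulVec_mulVec, mulVec_transpose, ← dotProduct_mulVec, dotProduct_comm]

/-- The homomorphism `PGL(2, ℂ) = PSL(2, ℂ) → O(3, 1)`, on representatives. -/
def klein : GL (Fin 2) ℂ →* O31 :=
  (kleinMat.toHomUnits).codRestrict O31 (fun g => kleinMat_isometry g)

/-! ### Hyperbolic Dehn filling space -/

/-- A point of hyperbolic Dehn filling space: shapes `z₁, z₂` of the two positively oriented ideal
tetrahedra that glue to a (possibly incomplete) hyperbolic structure on `M`. -/
structure DehnPoint where
  z₁ : ℂ
  z₂ : ℂ
  im_pos₁ : 0 < z₁.im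
  im_pos₂ : 0 < z₂.im
  gluing₁ : 2 * Complex.log z₁ + Complex.log (1 / (1 - z₁)) + Complex.log z₂ +
    2 * Complex.log (1 - 1 / z₂) = 2 * Real.pi * Complex.I
  gluing₂ : Complex.log (1 / (1 - z₁)) + 2 * Complex.log (1 - 1 / z₁) + Complex.log z₂ +
    2 * Complex.log (1 / (1 - z₂)) = 2 * Real.pi * Complex.I

namespace DehnPoint

variable (S : DehnPoint)

/-- The derivative of the holonomy of the meridian. -/
def m : ℂ := S.z₁ * (1 - S.z₂)

/-- The complex length `u` of the meridian. For shapes in the upper half plane the argument of the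
logarithm avoids the negative real axis, so this is the branch with `u = 0` at the complete
structure. -/
def u : ℂ := Complex.log (S.z₁ * (1 - S.z₂))

/-- The complex length `v` of the longitude, with the branch `v = 0` at the complete structure;
again the argument of the logarithm avoids the negative real axis. -/
def v : ℂ := 2 * Complex.log (-(1 - S.z₂) ^ 2 / S.z₂)

theorem z₂_ne_zero : S.z₂ ≠ 0 := fun h => by
  have := S.im_pos₂
  rw [h] at this
  simp at this

theorem one_sub_z₂_ne_zero : 1 - S.z₂ ≠ 0 := fun h => by
  have := S.im_pos₂
  rw [← sub_eq_zero.1 h] at this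
  simp at this

theorem z₁_ne_zero : S.z₁ ≠ 0 := fun h => by
  have := S.im_pos₁
  rw [h] at this
  simp at this

theorem one_sub_z₁_ne_zero : 1 - S.z₁ ≠ 0 := fun h => by
  have := S.im_pos₁
  rw [← sub_eq_zero.1 h] at this
  simp at this

theorem m_ne_zero : S.m ≠ 0 := mul_ne_zero S.z₁_ne_zero S.one_sub_z₂_ne_zero

theorem curve : S.z₂ ^ 2 + (S.m - S.m ^ 2 - 1) * S.z₂ + S.m ^ 2 = 0 := by
  have h := congrArg Complex.exp S.gluing₁
  have h0 := S.z₂_ne_zero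
  have h1 := S.one_sub_z₂_ne_zero
  have h2 := S.z₁_ne_zero
  have h3 := S.one_sub_z₁_ne_zero
  have h4 : 1 - 1 / S.z₂ ≠ 0 := by
    have : 1 - 1 / S.z₂ = -(1 - S.z₂) / S.z₂ := by field_simp; ring
    rw [this]
    exact div_ne_zero (neg_ne_zero.2 h1) h0
  rw [Complex.exp_two_pi_mul_I, Complex.exp_add, Complex.exp_add, Complex.exp_add, two_mul,
    two_mul, Complex.exp_add, Complex.exp_add, Complex.exp_log h2,
    Complex.exp_log (one_div_ne_zero h3), Complex.exp_log h0, Complex.exp_log h4] at h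
  field_simp at h
  have h5 : S.z₁ ^ 2 * (S.z₂ - 1) ^ 2 = (1 - S.z₁) * S.z₂ := by linear_combination h
  simp only [m]
  linear_combination (1 - S.z₂) * h5

/-- The holonomy of `x`, up to the factor `1 / √(z₁(1 - z₂))` that makes the determinant `1`. -/
def matX : GL (Fin 2) ℂ where
  val := !![1, -1; 0, S.m]
  inv := !![1, 1 / S.m; 0, 1 / S.m]
  val_inv := by
    have := S.m_ne_zero
    ext i j; fin_cases i <;> fin_cases j <;> simp [Matrix.mul_apply, Fin.sum_univ_two, this]
  inv_val := by
    have := S.m_ne_zero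
    ext i j; fin_cases i <;> fin_cases j <;> simp [Matrix.mul_apply, Fin.sum_univ_two, this]

/-- The holonomy of `y`, up to the factor `1 / √(z₁(1 - z₂))` that makes the determinant `1`. -/
def matY : GL (Fin 2) ℂ where
  val := !![S.m, 0; -S.z₂, 1]
  inv := !![1 / S.m, 0; S.z₂ / S.m, 1]
  val_inv := by
    have := S.m_ne_zero
    ext i j; fin_cases i <;> fin_cases j <;> simp [Matrix.mul_apply, Fin.sum_univ_two, this]
    field_simp
    ring
  inv_val := by
    have := S.m_ne_zero
    ext i j; fin_cases i <;> fin_cases j <;> simp [Matrix.mul_apply, Fin.sum_univ_two, this]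

theorem matX_val : S.matX.val = !![1, -1; 0, S.m] := rfl

theorem matY_val : S.matY.val = !![S.m, 0; -S.z₂, 1] := rfl

theorem matX_inv_val : (S.matX⁻¹).val = !![1, 1 / S.m; 0, 1 / S.m] := rfl

theorem matY_inv_val : (S.matY⁻¹).val = !![1 / S.m, 0; S.z₂ / S.m, 1] := rfl

theorem mat_relation :
    S.matX * S.matY⁻¹ * S.matX⁻¹ * S.matY * S.matX =
      S.matY * (S.matX * S.matY⁻¹ * S.matX⁻¹ * S.matY) := by
  have hm := S.m_ne_zero
  have hc := S.curve
  apply Units.ext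
  simp only [Units.val_mul, matX_val, matY_val, matX_inv_val, matY_inv_val]
  ext i j
  fin_cases i <;> fin_cases j <;> simp [Matrix.mul_apply, Fin.sum_univ_two] <;> field_simp
  · linear_combination (1 - S.m) * hc
  · linear_combination -hc
  · right
    linear_combination hc
  · linear_combination -(1 - S.m) * hc

theorem mat_longitude :
    (S.matY * S.matX⁻¹ * S.matY⁻¹ * S.matX * S.matX * S.matY⁻¹ * S.matX⁻¹ * S.matY).val *
      !![1, 1; 0, 1 - S.m] = !![1, 1; 0, 1 - S.m] *
        !![S.z₂ / (1 - S.z₂) ^ 2, 0; 0, (1 - S.z₂) ^ 2 / S.z₂] := by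
  have hm := S.m_ne_zero
  have hc := S.curve
  have h1 := S.one_sub_z₂_ne_zero
  have h0 := S.z₂_ne_zero
  simp only [Units.val_mul, matX_val, matY_val, matX_inv_val, matY_inv_val]
  ext i j
  fin_cases i <;> fin_cases j <;> simp [Matrix.mul_apply, Fin.sum_univ_two] <;> field_simp
  · linear_combination (S.m + S.z₂ + (-2) * S.z₂ * S.m + (-2) * S.z₂ * S.m ^ 2 + S.z₂ * S.m ^ 3 +
      (-2) * S.z₂ ^ 2 + S.z₂ ^ 2 * S.m ^ 2 + (-1) * S.z₂ ^ 2 * S.m ^ 3 + S.z₂ ^ 3 + S.z₂ ^ 3 * S.m) * hc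
  · linear_combination ((-1) * S.m + (-1) * S.z₂ + 2 * S.z₂ * S.m + 2 * S.z₂ * S.m ^ 2 + (-1) * S.z₂ * S.m ^ 3 +
      S.z₂ ^ 2 + S.z₂ ^ 2 * S.m) * hc
  · linear_combination (S.z₂ + (-1) * S.z₂ * S.m + (-1) * S.z₂ * S.m ^ 2 + S.z₂ * S.m ^ 3 + (-1) * S.z₂ ^ 2 +
      (-1) * S.z₂ ^ 2 * S.m) * hc
  · linear_combination ((-1) * S.m ^ 2 + S.m ^ 3 + (-1) * S.z₂ + 2 * S.z₂ * S.m + S.z₂ * S.m ^ 2 +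
      (-2) * S.z₂ * S.m ^ 3 + 2 * S.z₂ ^ 2 + (-1) * S.z₂ ^ 2 * S.m + (-2) * S.z₂ ^ 2 * S.m ^ 2 + S.z₂ ^ 2 * S.m ^ 3 +
      (-1) * S.z₂ ^ 3 + (-1) * S.z₂ ^ 3 * S.m) * hc

/-- The holonomy `π₁(M) → PGL(2, ℂ) = PSL(2, ℂ)`, lifted to `GL(2, ℂ)`. -/
def hol : Pi1 →* GL (Fin 2) ℂ :=
  PresentedGroup.toGroup (f := ![S.matX, S.matY]) (by
    intro r hr
    rw [Set.mem_singleton_iff.1 hr]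
    have h := S.mat_relation
    simp only [relator, wa, wx, wy, map_mul, map_inv, FreeGroup.lift_apply_of, cons_val_zero,
      cons_val_one]
    rw [h]
    group)

/-- The holonomy `ρ_u : π₁(M) → O(3, 1)` in the Klein model. -/
def rho : Pi1 →* O31 := klein.comp S.hol

theorem hol_x : S.hol x = S.matX := by
  simp [hol, x, PresentedGroup.toGroup.of]

theorem hol_y : S.hol y = S.matY := by
  simp [hol, y, PresentedGroup.toGroup.of]

theorem exp_u : Complex.exp S.u = S.m := Complex.exp_log S.m_ne_zero

theorem exp_v : Complex.exp S.v = ((1 - S.z₂) ^ 2 / S.z₂) ^ 2 := by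
  have : -(1 - S.z₂) ^ 2 / S.z₂ ≠ 0 :=
    div_ne_zero (neg_ne_zero.2 (pow_ne_zero 2 S.one_sub_z₂_ne_zero)) S.z₂_ne_zero
  rw [v, two_mul, Complex.exp_add, Complex.exp_log this]
  ring

theorem m_ne_one {p q : ℤ} (h : (p : ℂ) * S.u + q * S.v = 2 * Real.pi * Complex.I) : S.m ≠ 1 := by
  intro hm
  have hc := S.curve
  have hu : S.u = 0 := by
    have : S.u = Complex.log S.m := rfl
    rw [this, hm, Complex.log_one]
  have hv : S.v = 0 := by
    have : -(1 - S.z₂) ^ 2 / S.z₂ = 1 := by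
      rw [hm] at hc
      rw [div_eq_one_iff_eq S.z₂_ne_zero]
      linear_combination -hc
    rw [v, this, Complex.log_one, mul_zero]
  rw [hu, hv] at h
  simp [Real.pi_ne_zero] at h

end DehnPoint

/-- Diagonal matrices. -/
def diagHom : ℂˣ × ℂˣ →* GL (Fin 2) ℂ where
  toFun c := ⟨!![c.1, 0; 0, c.2], !![(c.1⁻¹ : ℂˣ), 0; 0, (c.2⁻¹ : ℂˣ)],
    by ext i j; fin_cases i <;> fin_cases j <;> simp [Matrix.mul_apply, Fin.sum_univ_two],
    by ext i j; fin_cases i <;> fin_cases j <;> simp [Matrix.mul_apply, Fin.sum_univ_two]⟩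
  map_one' := by
    apply Units.ext
    ext i j; fin_cases i <;> fin_cases j <;> simp
  map_mul' c d := by
    apply Units.ext
    ext i j; fin_cases i <;> fin_cases j <;> simp [Matrix.mul_apply, Fin.sum_univ_two]

theorem klein_scalar (c : ℂˣ) : klein (diagHom (c, c)) = 1 := by
  have hv : (diagHom (c, c)).val = (c : ℂ) • (1 : Matrix (Fin 2) (Fin 2) ℂ) := by
    ext i j; fin_cases i <;> fin_cases j <;> simp [diagHom]
  have hc : ‖(c : ℂ)‖ ≠ 0 := norm_ne_zero_iff.2 c.ne_zero
  have hk : kleinLin ((c : ℂ) • (1 : Matrix (Fin 2) (Fin 2) ℂ)) =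
      (‖(c : ℂ)‖ ^ 2 : ℝ) • LinearMap.id := by
    refine LinearMap.ext fun X => ?_
    have : ((c : ℂ) • (1 : Matrix (Fin 2) (Fin 2) ℂ)) * herm X *
        ((c : ℂ) • (1 : Matrix (Fin 2) (Fin 2) ℂ))ᴴ = (‖(c : ℂ)‖ ^ 2 : ℝ) • herm X := by
      ext i j
      simp only [conjTranspose_smul, conjTranspose_one, smul_mul, mul_smul_comm, Matrix.one_mul,
        Matrix.mul_one, Matrix.smul_apply, smul_eq_mul, Complex.real_smul, Complex.star_def]
      push_cast
      rw [← Complex.mul_conj']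
      ring
    rw [kleinLin_apply, this, map_smul, coords_herm]
    rfl
  apply Subtype.ext
  apply Units.ext
  change kleinMat (diagHom (c, c)) = 1
  change ‖(diagHom (c, c)).val.det‖⁻¹ • LinearMap.toMatrix' (kleinLin (diagHom (c, c)).val) = 1
  rw [hv, hk]
  simp [smul_smul]

namespace DehnPoint

variable (S : DehnPoint)

/-- If `p u + q v = 2πi` then the holonomy of `x ^ p * l ^ q` is trivial. -/
theorem rho_fill {p q : ℤ} (h : (p : ℂ) * S.u + q * S.v = 2 * Real.pi * Complex.I) :
    S.rho (x ^ p * l ^ q) = 1 := by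
  have hm0 := S.m_ne_zero
  have hm1 : 1 - S.m ≠ 0 := sub_ne_zero.2 (S.m_ne_one h).symm
  have hd : (1 - S.z₂) ^ 2 / S.z₂ ≠ 0 :=
    div_ne_zero (pow_ne_zero 2 S.one_sub_z₂_ne_zero) S.z₂_ne_zero
  let P : GL (Fin 2) ℂ := GeneralLinearGroup.mkOfDetNeZero !![1, 1; 0, 1 - S.m] (by
    simpa [det_fin_two] using hm1)
  let um : ℂˣ := Units.mk0 S.m hm0
  let ud : ℂˣ := Units.mk0 _ hd
  have hX : S.hol x = P * diagHom (1, um) * P⁻¹ := by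
    rw [eq_mul_inv_iff_mul_eq, hol_x]
    apply Units.ext
    change !![1, -1; 0, S.m] * !![1, 1; 0, 1 - S.m] =
      !![1, 1; 0, 1 - S.m] * !![((1 : ℂˣ) : ℂ), 0; 0, S.m]
    ext i j
    fin_cases i <;> fin_cases j <;> simp [Matrix.mul_apply, Fin.sum_univ_two]
    ring
  have hL : S.hol l = P * diagHom (ud⁻¹, ud) * P⁻¹ := by
    rw [eq_mul_inv_iff_mul_eq]
    have hl : S.hol l = S.matY * S.matX⁻¹ * S.matY⁻¹ * S.matX * S.matX * S.matY⁻¹ *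
        S.matX⁻¹ * S.matY := by
      simp only [l, a, b, map_mul, map_inv, hol_x, hol_y]
      group
    rw [hl]
    apply Units.ext
    have := S.mat_longitude
    rw [Units.val_mul]
    have hu : ((ud⁻¹ : ℂˣ) : ℂ) = S.z₂ / (1 - S.z₂) ^ 2 := by
      simp [ud, inv_div]
    change _ * !![1, 1; 0, 1 - S.m] = !![1, 1; 0, 1 - S.m] *
      !![((ud⁻¹ : ℂˣ) : ℂ), 0; 0, (1 - S.z₂) ^ 2 / S.z₂]
    rw [hu]
    exact this
  have hexp : um ^ p * (ud ^ 2) ^ q = 1 := by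
    apply Units.ext
    have h2 := congrArg Complex.exp h
    rw [Complex.exp_two_pi_mul_I, Complex.exp_add, Complex.exp_int_mul, Complex.exp_int_mul,
      exp_u, exp_v] at h2
    simpa [um, ud] using h2
  have hprod : S.hol (x ^ p * l ^ q) =
      P * diagHom (ud ^ (-q), ud ^ (-q)) * P⁻¹ := by
    have e : ((1, um) : ℂˣ × ℂˣ) ^ p * (ud⁻¹, ud) ^ q = (ud ^ (-q), ud ^ (-q)) := by
      ext1
      · simp
      · have : um ^ p * ud ^ q = ud ^ (-q) := by
          rw [← mul_left_inj (ud ^ q), ← _root_.zpow_add, neg_add_cancel, zpow_zero, mul_assoc,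
            ← mul_zpow, ← sq, hexp]
        simpa using this
    rw [map_mul, map_zpow, map_zpow, hX, hL, conj_zpow, conj_zpow, ← e, map_mul, map_zpow,
      map_zpow]
    group
  change klein (S.hol (x ^ p * l ^ q)) = 1
  rw [hprod, map_mul, map_mul, klein_scalar, mul_one, ← map_mul, mul_inv_cancel, map_one]

/-- The holonomy of `M_{p,q}` when `(p, q)` are the Dehn filling coefficients. -/
def rhoFill (p q : ℤ) (h : (p : ℂ) * S.u + q * S.v = 2 * Real.pi * Complex.I) :
    FillGroup p q →* O31 :=
  QuotientGroup.lift _ S.rho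
    (Subgroup.normalClosure_le_normal (N := S.rho.ker)
      (Set.singleton_subset_iff.2 (S.rho_fill h)))

/-- The `π₁(M)`-module `𝔳_u`. -/
def vu : Rep ℝ Pi1 := vRep S.rho

end DehnPoint

/-! ### Cohomology -/

/-- A module restricted to a subgroup. -/
abbrev resRep {G : Type} [Group G] (A : Rep ℝ G) (H : Subgroup G) : Rep ℝ H :=
  Rep.res H.subtype A

/-- The restriction map `H¹(G; A) → H¹(H; A)`. -/
def resH1 {G : Type} [Group G] (A : Rep ℝ G) (H : Subgroup G) :
    groupCohomology.H1 A ⟶ groupCohomology.H1 (resRep A H) :=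
  groupCohomology.map H.subtype (CategoryTheory.CategoryStruct.id (resRep A H)) 1

namespace DehnPoint

variable (S : DehnPoint)

/-- `H⁰(T²; 𝔳_u)`, as the subspace of invariants. -/
def torusInv : Submodule ℝ S.vu :=
  (resRep S.vu torus).ρ.invariants

/-- `α` is a basis of `H⁰(T²; 𝔳_u)` and `z` is a cocycle on `π₁(M)` with `z(x) = α` and
`z(l) = t α`. -/
structure IsNormalized (α : S.vu) (z : groupCohomology.cocycles₁ S.vu) (t : ℝ) : Prop where
  ne_zero : α ≠ 0
  basis : Submodule.span ℝ {α} = S.torusInv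
  apply_x : z x = α
  apply_l : z l = t • α

/-- `s` is the slope of `ρ_u`: for a basis `α` of `H⁰(T²; 𝔳_u)` and a generator `[z]` of
`H¹(M; 𝔳_u)`, the restrictions of `[z]` to `x` and `l` are the classes of `c₁ α` and `c₂ α` with
non-zero `c₁`, `c₂`, and `s = c₁ / c₂`. Here `H¹(x; 𝔳_u)` is identified with the coinvariants
`𝔳_u / im(1 - x)` by evaluation at `x`, and similarly for `l`. -/
def IsSlope (s : ℝ) : Prop :=
  ∃ (α : S.vu) (z : groupCohomology.cocycles₁ S.vu) (c₁ c₂ : ℝ),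
    α ≠ 0 ∧ Submodule.span ℝ {α} = S.torusInv ∧
    groupCohomology.H1π S.vu z ≠ 0 ∧
    Submodule.span ℝ {groupCohomology.H1π S.vu z} = ⊤ ∧
    z x - c₁ • α ∈ LinearMap.range (1 - S.vu.ρ x) ∧
    z l - c₂ • α ∈ LinearMap.range (1 - S.vu.ρ l) ∧
    c₁ ≠ 0 ∧ c₂ ≠ 0 ∧ s = c₁ / c₂

/-- The action of the Fox derivative `∂w/∂y` of the relator on `𝔳_u`. -/
def dwdy : Module.End ℝ S.vu := foxAction S.vu 1 relator

end DehnPoint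

end FigEight

end

noncomputable section

namespace FigEight

open Matrix

/-! ### Crossed homomorphisms -/

section Crossed

variable {k G A : Type*} [CommRing k] [Group G] [AddCommGroup A] [Module k A]

/-! One vector and one functional carry the argument. The half-turn about the axis of ρ(x) is an
involutive Lorentz isometry of trace zero, hence a vector α of 𝔳; it is fixed by x and l. The trace
pairing f = tr(α ·) is invariant under x and l, and f(α) = 4. The condition dim H⁰(x) = 1 excludes a
parabolic meridian, which would have two independent invariants; then α spans ker(ρ(x) - 1), and
im(ρ(x) - 1) = ker f.

A cocycle on π₁(M) is a pair (z(x), z(y)) with (∂w/∂x) z(x) + (∂w/∂y) z(y) = 0. In the free group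
the commutator of l and x is a conjugate of w by a word A times a conjugate of w⁻¹ by a word B
(`wl_commutator`). Since f ∘ z is additive on peripheral words, φ = f ∘ ρ(A) - f ∘ ρ(B) kills the
images of both Fox derivatives (`peripheral_duality`), and φ ≠ 0 because yxy⁻¹ moves the line of α
(`conj_perInv_ne`). If ker ∂w/∂y is a line, the image of ∂w/∂y is therefore all of ker φ, so every
value z(x) is realised. That line is spanned by ρ(y)α - α, so a cocycle that vanishes on x is
principal. Hence H¹(M) → H¹(x) is an isomorphism of lines. Commutation with x forces z(l) = tα, and
f reads off the slope 1/t.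

For a filling, 𝔰𝔩(4) = 𝔰𝔬(3,1) ⊕ 𝔳. On 𝔳, applying f to the value on x^p l^q leaves p + qt, which is
non-zero under the slope condition (`coboundary_of_filling`). The other summand is 𝔰𝔩(2, ℂ): a
deformation is a tangent vector to the curve of pairs (m, z₂), computed with matrices over the dual
numbers (`tangent_of_normalForm`), and p du + q dv = 0 forces it to vanish because dv/du is never
real for shapes in the upper half plane (`period_ne_zero`).

For smooth dependence, z₂ is the root of the curve equation selected by Im(z₁ + z₂ - 1) > 0, and
adding a rank-one operator to ∂w/∂y gives an invertible operator whose inverse solves the cocycle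
equation smoothly (`exists_smooth_solution`). -/

/-- Crossed homomorphisms (1-cocycles) with values in a representation. -/
def IsCrossed (σ : Representation k G A) (z : G → A) : Prop :=
  ∀ g h, z (g * h) = σ g (z h) + z g

namespace IsCrossed

variable {σ : Representation k G A} {z z' : G → A}

theorem map_one (hz : IsCrossed σ z) : z 1 = 0 := by
  have h := hz 1 1
  simpa using h

theorem map_inv (hz : IsCrossed σ z) (g : G) : z g⁻¹ = -σ g⁻¹ (z g) := by
  have h := hz g⁻¹ g
  rw [inv_mul_cancel, hz.map_one] at h
  exact eq_neg_of_add_eq_zero_right h.symm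

theorem sub (hz : IsCrossed σ z) (hz' : IsCrossed σ z') : IsCrossed σ (fun g => z g - z' g) := by
  intro g h
  simp only [hz g h, hz' g h, map_sub]
  abel

theorem smul (hz : IsCrossed σ z) (c : k) : IsCrossed σ (fun g => c • z g) := by
  intro g h
  simp only [hz g h, map_smul, smul_add]

/-- Principal crossed homomorphisms. -/
theorem coboundary (σ : Representation k G A) (b : A) : IsCrossed σ (fun g => σ g b - b) := by
  intro g h
  simp [map_mul, Module.End.mul_apply]

/-- A crossed homomorphism vanishing on a generating set vanishes. -/
theorem eq_zero_of_closure (hz : IsCrossed σ z) {s : Set G} (hs : ∀ g ∈ s, z g = 0) {g : G}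
    (hg : g ∈ Subgroup.closure s) : z g = 0 := by
  induction hg using Subgroup.closure_induction with
  | mem g hg => exact hs g hg
  | one => exact hz.map_one
  | mul g h _ _ h1 h2 => rw [hz, h1, h2, map_zero, add_zero]
  | inv g _ h => rw [hz.map_inv, h, map_zero, neg_zero]

/-- An additive functional invariant under a subgroup turns a crossed homomorphism into a
homomorphism on that subgroup. -/
theorem apply_zpow_mul_zpow {K : Type*} [AddCommGroup K] (hz : IsCrossed σ z) (f : A →+ K)
    {g h : G} (hg : ∀ b, f (σ g b) = f b) (hh : ∀ b, f (σ h b) = f b) (p q : ℤ) :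
    f (z (g ^ p * h ^ q)) = p • f (z g) + q • f (z h) := by
  let T : Subgroup G :=
    { carrier := {g | ∀ b, f (σ g b) = f b}
      one_mem' := fun b => by simp
      mul_mem' := fun {g h} hg hh b => by
        simp only [Set.mem_ofPred_eq] at hg hh
        rw [map_mul, Module.End.mul_apply, hg, hh]
      inv_mem' := fun {g} hg b => by
        simp only [Set.mem_ofPred_eq] at hg
        rw [← hg, ← Module.End.mul_apply, ← map_mul, mul_inv_cancel, _root_.map_one,
          Module.End.one_apply] }
  let φ : T →* Multiplicative K :=
    { toFun := fun t => Multiplicative.ofAdd (f (z t))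
      map_one' := by simp [hz.map_one]
      map_mul' := fun s t => by
        rw [← ofAdd_add, Subgroup.coe_mul, hz, map_add, s.2, add_comm] }
  have := congrArg Multiplicative.toAdd (map_mul φ ((⟨g, hg⟩ : T) ^ p) ((⟨h, hh⟩ : T) ^ q))
  rw [map_zpow, map_zpow] at this
  exact this

/-- A crossed homomorphism on a cyclic group is principal if its value on the generator is. -/
theorem eq_coboundary_of_closure {H : Subgroup G} {f : H → A}
    (hf : IsCrossed (σ.comp H.subtype) f) (b : A) (g : H) (h : f g = σ (g : G) b - b) (k : H)
    (hk : k ∈ Subgroup.closure {g}) : f k = σ (k : G) b - b := by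
  have key := hf.sub (IsCrossed.coboundary (σ.comp H.subtype) b)
  have := key.eq_zero_of_closure (s := {g}) (by
    intro k' hk'
    rw [Set.mem_singleton_iff.1 hk']
    exact sub_eq_zero.2 h) hk
  exact sub_eq_zero.1 this

end IsCrossed

end Crossed

/-! ### Crossed homomorphisms and group cohomology -/

section Cohomology

open groupCohomology

variable {G : Type} [Group G] {A : Rep ℝ G}

theorem cocycle_isCrossed (z : cocycles₁ A) : IsCrossed A.ρ z :=
  (mem_cocycles₁_iff z.1).1 z.2

/-- The cocycle of a crossed homomorphism. -/
def IsCrossed.toCocycle {z : G → A} (hz : IsCrossed A.ρ z) : cocycles₁ A :=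
  ⟨z, (mem_cocycles₁_iff z).2 hz⟩

@[simp]
theorem IsCrossed.toCocycle_apply {z : G → A} (hz : IsCrossed A.ρ z) (g : G) :
    hz.toCocycle g = z g := rfl

theorem H1π_eq_zero_iff_exists (z : cocycles₁ A) :
    H1π A z = 0 ↔ ∃ b : A, ∀ g, z g = A.ρ g b - b := by
  rw [H1π_eq_zero_iff]
  constructor
  · rintro ⟨b, hb⟩
    exact ⟨b, fun g => (congrFun hb g).symm⟩
  · rintro ⟨b, hb⟩
    exact ⟨b, funext fun g => (hb g).symm⟩

theorem exists_H1π_eq (c : H1 A) : ∃ z : cocycles₁ A, H1π A z = c :=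
  H1_induction_on c fun z => ⟨z, rfl⟩

theorem subsingleton_H1_of_forall
    (h : ∀ z : G → A, IsCrossed A.ρ z → ∃ b : A, ∀ g, z g = A.ρ g b - b) :
    Subsingleton (H1 A) := by
  refine subsingleton_of_forall_eq 0 fun c => ?_
  obtain ⟨z, rfl⟩ := exists_H1π_eq c
  exact (H1π_eq_zero_iff_exists z).2 (h z (cocycle_isCrossed z))

theorem isCrossed_restrict (H : Subgroup G) {z : G → A} (hz : IsCrossed A.ρ z) :
    IsCrossed (resRep A H).ρ (fun h : H => z h) :=
  fun g h => hz g h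

theorem resH1_H1π (H : Subgroup G) (z : cocycles₁ A) :
    resH1 A H (H1π A z) =
      H1π (resRep A H) (isCrossed_restrict H (cocycle_isCrossed z)).toCocycle :=
  H1π_comp_map_apply (A := A) (B := resRep A H) H.subtype
    (CategoryTheory.CategoryStruct.id (resRep A H)) z

theorem resH1_H1π_eq_zero_iff (H : Subgroup G) (z : cocycles₁ A) :
    resH1 A H (H1π A z) = 0 ↔ ∃ b : A, ∀ g ∈ H, z g = A.ρ g b - b := by
  rw [resH1_H1π, H1π_eq_zero_iff_exists]
  constructor
  · rintro ⟨b, hb⟩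
    exact ⟨b, fun g hg => hb ⟨g, hg⟩⟩
  · rintro ⟨b, hb⟩
    exact ⟨b, fun g => hb g.1 g.2⟩

theorem mem_closure_generator (g : G) (k : Subgroup.zpowers g) :
    k ∈ Subgroup.closure {(⟨g, Subgroup.mem_zpowers g⟩ : Subgroup.zpowers g)} := by
  rw [← Subgroup.zpowers_eq_closure, Subgroup.mem_zpowers_iff]
  obtain ⟨n, hn⟩ := Subgroup.mem_zpowers_iff.1 k.2
  exact ⟨n, Subtype.ext (by rw [Subgroup.coe_zpow, hn])⟩

/-- A class in the cohomology of a cyclic subgroup is the restriction of `[z]` as soon as the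
values on the generator differ by an element of the image of `1 - g`. -/
theorem resH1_H1π_eq_of_apply (g : G) (z : cocycles₁ A)
    (f : cocycles₁ (resRep A (Subgroup.zpowers g))) (b : A)
    (h : z g - f ⟨g, Subgroup.mem_zpowers g⟩ = A.ρ g b - b) :
    resH1 A (Subgroup.zpowers g) (H1π A z) = H1π (resRep A (Subgroup.zpowers g)) f := by
  rw [resH1_H1π, ← sub_eq_zero, ← map_sub, H1π_eq_zero_iff_exists]
  have key : IsCrossed (A.ρ.comp (Subgroup.zpowers g).subtype)
      (fun k => z k - (f k : A)) :=
    (isCrossed_restrict (Subgroup.zpowers g) (cocycle_isCrossed z)).sub (cocycle_isCrossed f)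
  exact ⟨b, fun k => key.eq_coboundary_of_closure b ⟨g, Subgroup.mem_zpowers g⟩ h k
    (mem_closure_generator g k)⟩

/-- A vector fixed by the generator is fixed by the cyclic group, so the hypotheses on H⁰ of a
circle become statements about a single operator. -/
theorem finrank_H0_zpowers (g : G) :
    Module.finrank ℝ (H0 (resRep A (Subgroup.zpowers g))) =
      Module.finrank ℝ (LinearMap.ker (A.ρ g - 1)) := by
  rw [(H0Iso (resRep A (Subgroup.zpowers g))).toLinearEquiv.finrank_eq]
  have : (resRep A (Subgroup.zpowers g)).ρ.invariants = LinearMap.ker (A.ρ g - 1) := by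
    ext b
    rw [Representation.mem_invariants, LinearMap.mem_ker, LinearMap.sub_apply, sub_eq_zero]
    constructor
    · intro h
      exact h ⟨g, Subgroup.mem_zpowers g⟩
    · intro h k
      have hb : IsCrossed A.ρ (fun k => A.ρ k b - b) := IsCrossed.coboundary _ b
      have := hb.eq_zero_of_closure (s := {g}) (g := k.1) (by
        rintro _ rfl
        exact sub_eq_zero.2 h) (by rw [← Subgroup.zpowers_eq_closure]; exact k.2)
      exact sub_eq_zero.1 this
  exact congrArg (fun W : Submodule ℝ A => Module.finrank ℝ W) this

end Cohomology

/-! ### Crossed homomorphisms on free groups and Fox calculus -/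

section Fox

variable {A : Type*} [AddCommGroup A] [Module ℝ A]

/-- The affine bijection `v ↦ σ g v + b`. -/
def affinePerm {G : Type*} [Group G] (σ : Representation ℝ G A) (g : G) (b : A) :
    Equiv.Perm A where
  toFun v := σ g v + b
  invFun v := σ g⁻¹ (v - b)
  left_inv v := by simp
  right_inv v := by simp

/-- The affine action of a free group that extends a linear action, with prescribed
translation parts of the generators. -/
def affineHom {α : Type*} (σ : Representation ℝ (FreeGroup α) A) (c : α → A) :
    FreeGroup α →* Equiv.Perm A :=
  FreeGroup.lift fun i => affinePerm σ (FreeGroup.of i) (c i)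

/-- Composing affine maps multiplies their linear parts, so the translation parts satisfy the
cocycle identity. -/
theorem affineHom_apply {α : Type*} (σ : Representation ℝ (FreeGroup α) A) (c : α → A)
    (g : FreeGroup α) (v : A) : affineHom σ c g v = σ g v + affineHom σ c g 0 := by
  induction g using FreeGroup.induction_on generalizing v with
  | C1 => simp
  | of i => simp [affineHom, affinePerm]
  | inv_of i h => simp [affineHom, affinePerm, Equiv.Perm.inv_def, sub_eq_add_neg]
  | mul g h hg hh =>
    rw [map_mul, Equiv.Perm.mul_apply, Equiv.Perm.mul_apply, hg, hh, hg (affineHom σ c h 0),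
      map_add, map_mul, Module.End.mul_apply, add_assoc]

theorem affineHom_of_zero {α : Type*} (σ : Representation ℝ (FreeGroup α) A) (c : α → A) (i : α) :
    affineHom σ c (FreeGroup.of i) 0 = c i := by
  simp [affineHom, affinePerm]

/-- Crossed homomorphisms on a free group take arbitrary values on the generators. -/
theorem isCrossed_affineHom {α : Type*} (σ : Representation ℝ (FreeGroup α) A) (c : α → A) :
    IsCrossed σ (fun g => affineHom σ c g 0) := by
  intro g h
  simp only [map_mul, Equiv.Perm.mul_apply]
  exact affineHom_apply σ c g _

/-- The operator by which an element of the integral group ring acts. -/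
def groupRingAction {G : Type*} [Group G] (σ : Representation ℝ G A) :
    MonoidAlgebra ℤ G →ₐ[ℤ] Module.End ℝ A :=
  MonoidAlgebra.lift ℤ (Module.End ℝ A) G σ

/-- The fundamental formula of Fox calculus. -/
theorem IsCrossed.eq_sum_fox {α : Type} [DecidableEq α] [Fintype α]
    {σ : Representation ℝ (FreeGroup α) A} {z : FreeGroup α → A} (hz : IsCrossed σ z)
    (g : FreeGroup α) :
    z g = ∑ j, groupRingAction σ (fox j g) (z (FreeGroup.of j)) := by
  -- Words are not assumed reduced, so that the induction can pass to tails.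
  have key : ∀ L : List (α × Bool), z (FreeGroup.mk L) =
      ∑ j, groupRingAction σ (foxWord j L) (z (FreeGroup.of j)) := by
    intro L
    induction L with
    | nil => simpa [foxWord, FreeGroup.one_eq_mk] using hz.map_one
    | cons p L ih =>
      obtain ⟨i, _ | _⟩ := p
      · have e : FreeGroup.mk ((i, false) :: L) = (FreeGroup.of i)⁻¹ * FreeGroup.mk L := by
          simp [FreeGroup.of, FreeGroup.invRev]
        rw [e, hz, hz.map_inv, ih]
        simp only [foxWord, groupRingAction, map_add, map_mul, MonoidAlgebra.lift_of,
          LinearMap.add_apply, Module.End.mul_apply, Finset.sum_add_distrib, map_sum]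
        rw [add_comm]
        congr 1
        rw [Finset.sum_eq_single i]
        · simp
        · intro j _ hj
          simp [hj.symm]
        · simp
      · have e : FreeGroup.mk ((i, true) :: L) = FreeGroup.of i * FreeGroup.mk L := by
          simp [FreeGroup.of]
        rw [e, hz, ih]
        simp only [foxWord, groupRingAction, map_add, map_mul, MonoidAlgebra.lift_of,
          LinearMap.add_apply, Module.End.mul_apply, Finset.sum_add_distrib, map_sum]
        rw [add_comm]
        congr 1
        rw [Finset.sum_eq_single i]
        · simp
        · intro j _ hj
          simp [hj.symm]
        · simp
  have := key g.toWord
  rwa [FreeGroup.mk_toWord] at this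

end Fox

end FigEight

end

noncomputable section

namespace FigEight

open Matrix

/-! ### The group of the figure-eight knot -/

/-- The projection of the free group on `x, y` onto `π₁(M)`. -/
abbrev proj : FreeGroup (Fin 2) →* Pi1 := PresentedGroup.mk ({relator} : Set (FreeGroup (Fin 2)))

theorem proj_wx : proj wx = x := rfl

theorem proj_wy : proj wy = y := rfl

theorem proj_relator : proj relator = 1 :=
  PresentedGroup.one_of_mem (Set.mem_singleton relator)

theorem closure_generators : Subgroup.closure ({x, y} : Set Pi1) = ⊤ := by
  have h : Set.range (PresentedGroup.of : Fin 2 → Pi1) = {x, y} := by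
    ext g
    simp only [Set.mem_range, Fin.exists_fin_two, Set.mem_insert_iff, Set.mem_singleton_iff]
    exact or_congr eq_comm eq_comm
  rw [← h]
  exact PresentedGroup.closure_range_of _

theorem a_mul_x : a * x = y * a := by
  have h := proj_relator
  simp only [relator, wa, map_mul, map_inv, proj_wx, proj_wy] at h
  rw [mul_inv_eq_one, mul_inv_eq_iff_eq_mul] at h
  exact h

/-- The longitude as a word. -/
def wl : FreeGroup (Fin 2) := (wx * wy⁻¹)⁻¹ * wa⁻¹ * (wx * wy⁻¹) * wa

theorem proj_wl : proj wl = l := by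
  simp only [wl, wa, map_mul, map_inv, proj_wx, proj_wy, l, a, b]

/-- The two conjugators that express the commutator of longitude and meridian through the
relator. -/
def conjA : FreeGroup (Fin 2) := wy * wx⁻¹ * wy⁻¹ * wx

def conjB : FreeGroup (Fin 2) := wx * wy * wx⁻¹ * wy⁻¹

/-- The relation of the boundary torus as a consequence of w. The relator occurs once with each
sign, which is why a difference of two functionals appears in `peripheral_duality`. -/
theorem wl_commutator : wl * wx * wl⁻¹ * wx⁻¹ =
    (conjA * relator * conjA⁻¹) * (conjB * relator⁻¹ * conjB⁻¹) := by
  simp only [wl, wa, conjA, conjB, relator]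
  group

theorem l_mul_x : l * x = x * l := by
  have h := congrArg proj wl_commutator
  simp only [map_mul, map_inv, proj_wl, proj_wx, proj_relator] at h
  rw [inv_one, mul_one, mul_inv_cancel, mul_one, mul_inv_cancel, one_mul, mul_inv_eq_one,
    mul_inv_eq_iff_eq_mul] at h
  exact h

/-! ### Cocycles on π₁(M) and their restriction to the boundary torus -/

section Peripheral

variable {A : Rep ℝ Pi1}

theorem eq_fox_add_fox {z : FreeGroup (Fin 2) → A} (hz : IsCrossed (A.ρ.comp proj) z)
    (g : FreeGroup (Fin 2)) :
    z g = foxAction A 0 g (z wx) + foxAction A 1 g (z wy) := by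
  rw [hz.eq_sum_fox g, Fin.sum_univ_two]
  rfl

/-- Crossed homomorphisms on `π₁(M)` satisfy the linear equation given by the Fox derivatives. -/
theorem IsCrossed.fox_relation {z : Pi1 → A} (hz : IsCrossed A.ρ z) :
    foxAction A 0 relator (z x) + foxAction A 1 relator (z y) = 0 := by
  have h : IsCrossed (A.ρ.comp proj) (fun g => z (proj g)) := fun g h => by
    simpa using hz (proj g) (proj h)
  have := eq_fox_add_fox h relator
  rw [proj_relator, hz.map_one] at this
  exact this.symm

/-- Solutions of the linear equation given by the Fox derivatives are values of crossed
homomorphisms. -/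
theorem exists_crossed_of_fox_relation {c₀ c₁ : A}
    (h : foxAction A 0 relator c₀ + foxAction A 1 relator c₁ = 0) :
    ∃ z : Pi1 → A, IsCrossed A.ρ z ∧ z x = c₀ ∧ z y = c₁ := by
  set σ : Representation ℝ (FreeGroup (Fin 2)) A := A.ρ.comp proj with hσ
  let F := affineHom σ ![c₀, c₁]
  have h0 : F wx 0 = c₀ := affineHom_of_zero σ ![c₀, c₁] 0
  have h1 : F wy 0 = c₁ := affineHom_of_zero σ ![c₀, c₁] 1
  -- The relator acts with trivial linear part, and its translation part is the left side of the
  -- equation; the affine action therefore descends to π₁(M).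
  have hr : F relator = 1 := by
    ext v
    have e := eq_fox_add_fox (isCrossed_affineHom σ ![c₀, c₁]) relator
    change F relator 0 = foxAction A 0 relator (F wx 0) + foxAction A 1 relator (F wy 0) at e
    rw [h0, h1, h] at e
    have e2 : F relator v = σ relator v + F relator 0 := affineHom_apply σ _ relator v
    rw [e2, e, add_zero, hσ, MonoidHom.comp_apply, proj_relator, map_one]
    rfl
  let F' : Pi1 →* Equiv.Perm A :=
    PresentedGroup.toGroup (f := fun i => affinePerm σ (FreeGroup.of i) (![c₀, c₁] i)) (by
      intro r hr'
      rw [Set.mem_singleton_iff.1 hr']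
      exact hr)
  refine ⟨fun g => F' g 0, fun g h => ?_, h0, h1⟩
  obtain ⟨g, rfl⟩ := PresentedGroup.mk_surjective _ g
  obtain ⟨h, rfl⟩ := PresentedGroup.mk_surjective _ h
  rw [← map_mul]
  exact isCrossed_affineHom σ ![c₀, c₁] g h

/-- Duality on the boundary torus: a functional invariant under the peripheral group constrains
the image of the Fox derivatives. -/
theorem peripheral_duality {K : Type*} [AddCommGroup K] [Module ℝ K] (f : A →ₗ[ℝ] K)
    (hfx : ∀ b, f (A.ρ x b) = f b) (hfl : ∀ b, f (A.ρ l b) = f b) (c₀ c₁ : A) :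
    f (A.ρ (proj conjA) (foxAction A 0 relator c₀ + foxAction A 1 relator c₁)) =
      f (A.ρ (proj conjB) (foxAction A 0 relator c₀ + foxAction A 1 relator c₁)) := by
  set σ : Representation ℝ (FreeGroup (Fin 2)) A := A.ρ.comp proj with hσ
  obtain ⟨z, hz, h0, h1⟩ : ∃ z, IsCrossed σ z ∧ z wx = c₀ ∧ z wy = c₁ :=
    ⟨_, isCrossed_affineHom σ ![c₀, c₁], affineHom_of_zero σ ![c₀, c₁] 0,
      affineHom_of_zero σ ![c₀, c₁] 1⟩
  rw [← h0, ← h1, ← eq_fox_add_fox hz]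
  have hσr : σ relator = 1 := by rw [hσ, MonoidHom.comp_apply, proj_relator, map_one]
  -- When w acts trivially, the contributions of g and g⁻¹ cancel.
  have hconj : ∀ g w, σ w = 1 → z (g * w * g⁻¹) = σ g (z w) := by
    intro g w hw
    rw [hz, hz, map_mul, hw, mul_one, hz.map_inv, map_neg, ← Module.End.mul_apply, ← map_mul,
      mul_inv_cancel, map_one]
    simp
  have hσr' : σ relator⁻¹ = 1 := by
    rw [hσ, MonoidHom.comp_apply, map_inv, proj_relator, inv_one, map_one]
  have key := congrArg z wl_commutator
  have e1 : z ((conjA * relator * conjA⁻¹) * (conjB * relator⁻¹ * conjB⁻¹)) =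
      σ conjA (z relator) - σ conjB (z relator) := by
    rw [hz, hconj _ _ hσr, hconj _ _ hσr', hz.map_inv, hσr', map_mul, map_mul, hσr, mul_one,
      ← map_mul, mul_inv_cancel, map_one]
    simp [sub_eq_neg_add]
  have e2 : z (wl * wx * wl⁻¹ * wx⁻¹) = z (wl * wx) - z (wx * wl) := by
    have hc : wl * wx * wl⁻¹ * wx⁻¹ = (wl * wx) * (wx * wl)⁻¹ := by group
    have hp : σ (wl * wx) = σ (wx * wl) := by
      simp only [hσ, MonoidHom.comp_apply, map_mul, proj_wl, proj_wx]
      rw [← map_mul, ← map_mul, l_mul_x]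
    rw [hc, hz, hz.map_inv, hp, map_neg, ← Module.End.mul_apply, ← map_mul, mul_inv_cancel,
      map_one, Module.End.one_apply, sub_eq_neg_add]
  rw [e1, e2, hz, hz] at key
  have hl : ∀ b, f (σ wl b) = f b := fun b => by
    rw [hσ, MonoidHom.comp_apply, proj_wl, hfl]
  have hx : ∀ b, f (σ wx b) = f b := hfx
  have := congrArg f key
  simp only [map_sub, map_add, hl, hx] at this
  change f (σ conjA (z relator)) = f (σ conjB (z relator))
  rw [← sub_eq_zero, ← this]
  abel

/-- A peripheral invariant `α` together with an invariant functional `f` detecting it, under the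
hypotheses that make the first cohomology one-dimensional. -/
structure Peripheral (A : Rep ℝ Pi1) (α : A) (f : A →ₗ[ℝ] ℝ) : Prop where
  fix_x : A.ρ x α = α
  fix_l : A.ρ l α = α
  move_y : A.ρ y α ≠ α
  inv_x : ∀ b, f (A.ρ x b) = f b
  inv_l : ∀ b, f (A.ρ l b) = f b
  detect : f α ≠ 0
  dual : ∃ b, f (A.ρ (proj conjA) b) ≠ f (A.ρ (proj conjB) b)
  ker_x : Module.finrank ℝ (LinearMap.ker (A.ρ x - 1)) = 1
  ker_fox : Module.finrank ℝ (LinearMap.ker (foxAction A 1 relator)) = 1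

/-- One subspace lies in the other and both have codimension one. -/
theorem range_eq_ker_of_finrank {V : Type*} [AddCommGroup V] [Module ℝ V] [FiniteDimensional ℝ V]
    {T : Module.End ℝ V} {f : V →ₗ[ℝ] ℝ} (hT : Module.finrank ℝ (LinearMap.ker T) = 1)
    (hf : f ≠ 0) (h : ∀ b, f (T b) = 0) : LinearMap.range T = LinearMap.ker f := by
  apply Submodule.eq_of_le_of_finrank_eq
  · rintro _ ⟨b, rfl⟩
    exact h b
  · have h1 := LinearMap.finrank_range_add_finrank_ker T
    have h2 := LinearMap.finrank_range_add_finrank_ker f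
    rw [LinearMap.range_eq_top.2 (LinearMap.surjective hf), finrank_top, Module.finrank_self] at h2
    omega

namespace Peripheral

variable {α : A} {f : A →ₗ[ℝ] ℝ}

theorem ne_zero (h : Peripheral A α f) : α ≠ 0 := fun h0 => h.detect (by rw [h0, map_zero])

theorem functional_ne_zero (h : Peripheral A α f) : f ≠ 0 := fun h0 => h.detect (by rw [h0]; rfl)

theorem exists_smul_of_fix_x (h : Peripheral A α f) {b : A} (hb : A.ρ x b = b) :
    ∃ μ : ℝ, b = μ • α := by
  have hα : (⟨α, by simp [h.fix_x]⟩ : LinearMap.ker (A.ρ x - 1)) ≠ 0 := fun h0 =>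
    h.ne_zero (congrArg Subtype.val h0)
  obtain ⟨μ, hμ⟩ := exists_smul_eq_of_finrank_eq_one h.ker_x hα ⟨b, by simp [hb]⟩
  exact ⟨μ, (congrArg Subtype.val hμ).symm⟩

/-- The coinvariants of x form a line on which f is a coordinate, and α represents a generator
because f(α) ≠ 0. -/
theorem exists_decomp [FiniteDimensional ℝ A] (h : Peripheral A α f) (b : A) :
    ∃ e : A, b = (f b / f α) • α + (A.ρ x e - e) := by
  have hr := range_eq_ker_of_finrank h.ker_x h.functional_ne_zero (fun b => by
    simp [h.inv_x])
  have : b - (f b / f α) • α ∈ LinearMap.range (A.ρ x - 1) := by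
    rw [hr, LinearMap.mem_ker, map_sub, map_smul, smul_eq_mul, div_mul_cancel₀ _ h.detect, sub_self]
  obtain ⟨e, he⟩ := this
  refine ⟨e, ?_⟩
  rw [LinearMap.sub_apply, Module.End.one_apply] at he
  rw [he]
  abel

/-- The functional φ kills the images of both Fox derivatives; a one-dimensional kernel makes the
image of ∂w/∂y equal to ker φ, so ∂w/∂y absorbs the image of ∂w/∂x. This gives surjectivity of the
restriction to x. -/
theorem exists_crossed [FiniteDimensional ℝ A] (h : Peripheral A α f) (c₀ : A) :
    ∃ z : Pi1 → A, IsCrossed A.ρ z ∧ z x = c₀ := by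
  let φ : A →ₗ[ℝ] ℝ := f ∘ₗ A.ρ (proj conjA) - f ∘ₗ A.ρ (proj conjB)
  have hφ : φ ≠ 0 := by
    obtain ⟨b, hb⟩ := h.dual
    intro h0
    exact hb (sub_eq_zero.1 (congrArg (fun g : A →ₗ[ℝ] ℝ => g b) h0))
  have hr := range_eq_ker_of_finrank h.ker_fox hφ (fun b => by
    have := peripheral_duality f h.inv_x h.inv_l 0 b
    rw [map_zero, zero_add] at this
    exact sub_eq_zero.2 this)
  have : -foxAction A 0 relator c₀ ∈ LinearMap.range (foxAction A 1 relator) := by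
    rw [hr, neg_mem_iff, LinearMap.mem_ker]
    have := peripheral_duality f h.inv_x h.inv_l c₀ 0
    rw [map_zero, add_zero] at this
    exact sub_eq_zero.2 this
  obtain ⟨c₁, hc⟩ := this
  obtain ⟨z, hz, h0, -⟩ := exists_crossed_of_fox_relation (A := A) (c₀ := c₀) (c₁ := c₁)
    (by rw [hc, add_neg_cancel])
  exact ⟨z, hz, h0⟩

theorem eq_zero_of_generators {z : Pi1 → A} (hz : IsCrossed A.ρ z) (hx : z x = 0) (hy : z y = 0)
    (g : Pi1) : z g = 0 := by
  refine hz.eq_zero_of_closure (s := {x, y}) ?_ (by rw [closure_generators]; trivial)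
  rintro g (rfl | rfl)
  · exact hx
  · exact hy

/-- Both z(y) and ρ(y)α - α lie in the kernel of ∂w/∂y, the latter because the coboundary of α
vanishes on x. The kernel is a line and ρ(y)α ≠ α, so z is the coboundary of a multiple of α. -/
theorem coboundary_of_apply_x_eq_zero (h : Peripheral A α f) {z : Pi1 → A}
    (hz : IsCrossed A.ρ z) (hx : z x = 0) : ∃ b : A, ∀ g, z g = A.ρ g b - b := by
  have hα := (IsCrossed.coboundary A.ρ α).fox_relation
  have hzr := hz.fox_relation
  rw [h.fix_x, sub_self, map_zero, zero_add] at hα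
  rw [hx, map_zero, zero_add] at hzr
  have hne : (⟨A.ρ y α - α, hα⟩ : LinearMap.ker (foxAction A 1 relator)) ≠ 0 := fun h0 =>
    h.move_y (sub_eq_zero.1 (congrArg Subtype.val h0))
  obtain ⟨μ, hμ⟩ := exists_smul_eq_of_finrank_eq_one h.ker_fox hne ⟨z y, hzr⟩
  have hμ' : μ • (A.ρ y α - α) = z y := congrArg Subtype.val hμ
  refine ⟨μ • α, fun g => ?_⟩
  refine sub_eq_zero.1 (eq_zero_of_generators (hz.sub (IsCrossed.coboundary A.ρ (μ • α))) ?_ ?_ g)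
  · rw [hx, map_smul, h.fix_x]
    simp
  · rw [← hμ', map_smul, smul_sub]
    simp

/-- Subtracting f(z(x))/f(α) times z₀ and a coboundary produces a cocycle that vanishes on x. -/
theorem eq_smul_add_coboundary [FiniteDimensional ℝ A] (h : Peripheral A α f) {z₀ z : Pi1 → A}
    (hz₀ : IsCrossed A.ρ z₀) (h₀ : z₀ x = α) (hz : IsCrossed A.ρ z) :
    ∃ (μ : ℝ) (b : A), ∀ g, z g = μ • z₀ g + (A.ρ g b - b) := by
  obtain ⟨e, he⟩ := h.exists_decomp (z x)
  obtain ⟨b, hb⟩ := h.coboundary_of_apply_x_eq_zero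
    ((hz.sub (hz₀.smul (f (z x) / f α))).sub (IsCrossed.coboundary A.ρ e)) (by
      rw [h₀]
      nth_rewrite 1 [he]
      abel)
  refine ⟨f (z x) / f α, b + e, fun g => ?_⟩
  have := hb g
  rw [sub_eq_iff_eq_add, sub_eq_iff_eq_add] at this
  rw [this, map_add]
  abel

/-- Expanding z(lx) = z(xl) in both orders shows that z(l) is fixed by x. -/
theorem apply_l (h : Peripheral A α f) {z : Pi1 → A} (hz : IsCrossed A.ρ z) (hx : z x = α) :
    ∃ t : ℝ, z l = t • α := by
  apply h.exists_smul_of_fix_x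
  have h1 := hz l x
  have h2 := hz x l
  rw [l_mul_x, h2, hx, h.fix_l] at h1
  rw [add_comm] at h1
  exact add_left_cancel h1

theorem functional_coboundary_l (h : Peripheral A α f) (b : A) : f (A.ρ l b - b) = 0 := by
  rw [map_sub, h.inv_l, sub_self]

theorem functional_coboundary_x (h : Peripheral A α f) (b : A) : f (A.ρ x b - b) = 0 := by
  rw [map_sub, h.inv_x, sub_self]

open groupCohomology

theorem H1π_ne_zero (h : Peripheral A α f) {z : cocycles₁ A} (hx : z x = α) : H1π A z ≠ 0 := by
  rw [Ne, H1π_eq_zero_iff_exists]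
  rintro ⟨b, hb⟩
  apply h.detect
  rw [← hx, hb, h.functional_coboundary_x]

theorem exists_smul_eq_H1 [FiniteDimensional ℝ A] (h : Peripheral A α f) {z : cocycles₁ A}
    (hx : z x = α) (c : H1 A) : ∃ μ : ℝ, μ • H1π A z = c := by
  obtain ⟨z', rfl⟩ := exists_H1π_eq c
  obtain ⟨μ, b, hb⟩ := h.eq_smul_add_coboundary (cocycle_isCrossed z) hx (cocycle_isCrossed z')
  refine ⟨μ, ?_⟩
  rw [← map_smul, ← sub_eq_zero, ← map_sub, H1π_eq_zero_iff_exists]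
  refine ⟨-b, fun g => ?_⟩
  change μ • z g - z' g = _
  rw [hb g, map_neg]
  abel

theorem finrank_H1 [FiniteDimensional ℝ A] (h : Peripheral A α f) :
    Module.finrank ℝ (H1 A) = 1 := by
  obtain ⟨z, hz, hx⟩ := h.exists_crossed α
  exact finrank_eq_one _ (h.H1π_ne_zero (z := hz.toCocycle) hx)
    (h.exists_smul_eq_H1 (z := hz.toCocycle) hx)

theorem bijective_resH1_x [FiniteDimensional ℝ A] (h : Peripheral A α f) :
    Function.Bijective (resH1 A circleX) := by
  constructor
  · rw [injective_iff_map_eq_zero]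
    intro c hc
    obtain ⟨z, rfl⟩ := exists_H1π_eq c
    obtain ⟨b, hb⟩ := (resH1_H1π_eq_zero_iff _ _).1 hc
    obtain ⟨b', hb'⟩ := h.coboundary_of_apply_x_eq_zero
      ((cocycle_isCrossed z).sub (IsCrossed.coboundary A.ρ b))
      (sub_eq_zero.2 (hb x (Subgroup.mem_zpowers x)))
    refine (H1π_eq_zero_iff_exists z).2 ⟨b' + b, fun g => ?_⟩
    have := hb' g
    rw [sub_eq_iff_eq_add] at this
    rw [this, map_add]
    abel
  · intro c
    obtain ⟨d, rfl⟩ := exists_H1π_eq c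
    obtain ⟨z, hz, hx⟩ := h.exists_crossed (d ⟨x, Subgroup.mem_zpowers x⟩)
    refine ⟨H1π A hz.toCocycle, resH1_H1π_eq_of_apply x hz.toCocycle d 0 ?_⟩
    rw [hz.toCocycle_apply, hx, map_zero, sub_zero]
    exact sub_self _

/-- If μ[z] restricts to zero, then μtα is a coboundary value at l; f vanishes on such values, so μ
t f(α) = 0. -/
theorem injective_resH1_l [FiniteDimensional ℝ A] (h : Peripheral A α f) {z : cocycles₁ A} {t : ℝ}
    (hx : z x = α) (hl : z l = t • α) (ht : t ≠ 0) : Function.Injective (resH1 A circleL) := by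
  rw [injective_iff_map_eq_zero]
  intro c hc
  obtain ⟨μ, rfl⟩ := h.exists_smul_eq_H1 hx c
  rw [← map_smul] at hc
  obtain ⟨b, hb⟩ := (resH1_H1π_eq_zero_iff _ _).1 hc
  have h1 : μ • z l = A.ρ l b - b := hb l (Subgroup.mem_zpowers l)
  have h2 := congrArg f h1
  rw [h.functional_coboundary_l, hl, map_smul, map_smul, smul_eq_mul, smul_eq_mul] at h2
  have : μ = 0 := by
    rcases mul_eq_zero.1 h2 with h3 | h3
    · exact h3
    · exact absurd h3 (mul_ne_zero ht h.detect)
  rw [this, zero_smul]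

theorem bijective_resH1_l [FiniteDimensional ℝ A] (h : Peripheral A α f) {z : cocycles₁ A} {t : ℝ}
    (hx : z x = α) (hl : z l = t • α) (ht : t ≠ 0)
    (hk : Module.finrank ℝ (LinearMap.ker (A.ρ l - 1)) = 1) :
    Function.Bijective (resH1 A circleL) := by
  refine ⟨h.injective_resH1_l hx hl ht, fun c => ?_⟩
  obtain ⟨d, rfl⟩ := exists_H1π_eq c
  set e : A := d ⟨l, Subgroup.mem_zpowers l⟩ with he
  have hr := range_eq_ker_of_finrank hk h.functional_ne_zero (fun b => by
    simp [h.inv_l])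
  -- The multiple of z for which f(μ z(l)) = f(e), so that the difference lies in im(ρ(l) - 1) = ker
  -- f.
  set μ := f e / (t * f α)
  have hμ : μ • z l - e ∈ LinearMap.range (A.ρ l - 1) := by
    rw [hr, LinearMap.mem_ker, hl, map_sub, map_smul, map_smul, smul_eq_mul, smul_eq_mul,
      div_mul_cancel₀ _ (mul_ne_zero ht h.detect), sub_self]
  obtain ⟨b, hb⟩ := hμ
  refine ⟨H1π A (μ • z), resH1_H1π_eq_of_apply l (μ • z) d b ?_⟩
  exact hb.symm

/-- If `p + q t ≠ 0`, cocycles that vanish on the filling slope are principal. -/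
theorem coboundary_of_filling [FiniteDimensional ℝ A] (h : Peripheral A α f) {z₀ z : Pi1 → A}
    {t : ℝ} (hz₀ : IsCrossed A.ρ z₀) (hx : z₀ x = α) (hl : z₀ l = t • α) (hz : IsCrossed A.ρ z)
    {p q : ℤ} (hpq : (p : ℝ) + q * t ≠ 0) (h0 : z (x ^ p * l ^ q) = 0) :
    ∃ b : A, ∀ g, z g = A.ρ g b - b := by
  obtain ⟨μ, b, hb⟩ := h.eq_smul_add_coboundary hz₀ hx hz
  -- Applied to the filling slope, f gives 0 = μ (p + qt) f(α).
  have h1 := hz.apply_zpow_mul_zpow f.toAddMonoidHom h.inv_x h.inv_l p q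
  simp only [LinearMap.toAddMonoidHom_coe, h0, hb x, hb l, hx, hl, map_zero, map_add,
    h.functional_coboundary_l, h.functional_coboundary_x, map_smul, smul_eq_mul, add_zero,
    zsmul_eq_mul] at h1
  have h2 : μ * (((p : ℝ) + q * t) * f α) = 0 := by linear_combination -h1
  have : μ = 0 := (mul_eq_zero.1 h2).resolve_right (mul_ne_zero hpq h.detect)
  refine ⟨b, fun g => ?_⟩
  rw [hb g, this, zero_smul, zero_add]

end Peripheral

end Peripheral

end FigEight

end

noncomputable section

namespace FigEight

open Matrix

/-! ### Invariants of loxodromic elements -/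

theorem J_mul_J : J * J = 1 := by
  rw [J, diagonal_mul_diagonal, ← diagonal_one]
  congr 1
  ext i
  fin_cases i <;> simp

theorem J_transpose : Jᵀ = J := by simp [J]

/-- Trace-free matrices that are self-adjoint for the Lorentz form belong to `𝔳`. -/
theorem mem_vMod_of_selfAdjoint {A : Matrix (Fin 4) (Fin 4) ℝ} (h0 : A.trace = 0)
    (hA : J * Aᵀ * J = A) : A ∈ vMod := by
  refine ⟨h0, fun B hB => ?_⟩
  have hA' : Aᵀ = J * A * J := by
    conv_rhs => rw [← hA]
    calc Aᵀ = 1 * Aᵀ * 1 := by simp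
      _ = J * (J * Aᵀ * J) * J := by rw [← J_mul_J]; simp only [Matrix.mul_assoc]
  have h1 : (A * B).trace = -(A * B).trace := by
    calc (A * B).trace = (Bᵀ * Aᵀ).trace := by rw [← trace_transpose, transpose_mul]
      _ = (Bᵀ * J * A * J).trace := by rw [hA']; simp only [Matrix.mul_assoc]
      _ = (-(J * (B * A * J))).trace := by rw [hB.2]; simp [Matrix.mul_assoc]
      _ = -(A * B).trace := by
        rw [trace_neg, trace_mul_comm, Matrix.mul_assoc, J_mul_J, Matrix.mul_one, trace_mul_comm]
  have : (A * B).trace = 0 := by linarith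
  rw [killing, this, mul_zero]

/-- The Lorentz adjoint of an isometry is its inverse, and an involution is its own inverse. -/
theorem kleinMat_selfAdjoint {g : GL (Fin 2) ℂ} (hg : g * g = 1) :
    J * (kleinMat g)ᵀ * J = kleinMat g := by
  have h1 : kleinMat g * kleinMat g = 1 := by rw [← map_mul, hg, map_one]
  calc J * (kleinMat g)ᵀ * J = J * ((kleinMat g)ᵀ * J * (kleinMat g * kleinMat g)) := by
        rw [h1, Matrix.mul_one, Matrix.mul_assoc]
    _ = J * ((kleinMat g)ᵀ * J * kleinMat g) * kleinMat g := by simp only [Matrix.mul_assoc]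
    _ = kleinMat g := by rw [kleinMat_isometry, J_mul_J, Matrix.one_mul]

/-- The half-turn in `PGL(2, ℂ)` with fixed points `∞` and `-k / 2`. -/
def halfTurn (k : ℂ) : GL (Fin 2) ℂ where
  val := !![1, k; 0, -1]
  inv := !![1, k; 0, -1]
  val_inv := by ext i j; fin_cases i <;> fin_cases j <;> simp [Matrix.mul_apply]
  inv_val := by ext i j; fin_cases i <;> fin_cases j <;> simp [Matrix.mul_apply]

theorem halfTurn_val (k : ℂ) : (halfTurn k).val = !![1, k; 0, -1] := rfl

theorem halfTurn_mul_self (k : ℂ) : halfTurn k * halfTurn k = 1 := Units.ext (halfTurn k).val_inv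

theorem kleinMat_apply (g : GL (Fin 2) ℂ) (i j : Fin 4) :
    kleinMat g i j = ‖g.val.det‖⁻¹ * coords (g.val * herm (Pi.single j 1) * g.valᴴ) i := by
  simp [kleinMat, LinearMap.toMatrix'_apply, kleinLin_apply]

/-- On the complexified Hermitian matrices the action is the tensor product of g with its complex
conjugate, whose trace is |tr g|². -/
theorem trace_kleinMat (g : GL (Fin 2) ℂ) :
    (kleinMat g).trace = ‖g.val.det‖⁻¹ * Complex.normSq g.val.trace := by
  simp only [Matrix.trace, Matrix.diag_apply, kleinMat_apply, Fin.sum_univ_four]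
  simp [herm, coords, Matrix.mul_apply, Fin.sum_univ_two, Complex.normSq_apply]
  ring

theorem trace_kleinMat_halfTurn (k : ℂ) : (kleinMat (halfTurn k)).trace = 0 := by
  rw [trace_kleinMat, halfTurn_val]
  simp [trace_fin_two]

/-- The element of `𝔳` invariant under the loxodromic elements with axis from `∞` to `-k / 2`. -/
def axisVec (k : ℂ) : vMod :=
  ⟨kleinMat (halfTurn k), mem_vMod_of_selfAdjoint (trace_kleinMat_halfTurn k)
    (kleinMat_selfAdjoint (halfTurn_mul_self k))⟩

/-- A lower left entry can be read off from the action on the null vector fixed by upper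
triangular matrices. -/
theorem kleinMat_lowerLeft (g : GL (Fin 2) ℂ) :
    kleinMat g 2 3 - kleinMat g 2 2 + kleinMat g 3 3 - kleinMat g 3 2 =
      8 * ‖g.val.det‖⁻¹ * Complex.normSq (g.val 1 0) := by
  simp only [kleinMat_apply]
  simp [herm, coords, Matrix.mul_apply, Fin.sum_univ_two, Complex.normSq_apply]
  ring

/-! ### The peripheral invariant and its trace pairing -/

namespace DehnPoint

variable (S : DehnPoint)

instance : FiniteDimensional ℝ S.vu := inferInstanceAs (FiniteDimensional ℝ vMod)

theorem ad_rho_apply (g : Pi1) (A : Matrix (Fin 4) (Fin 4) ℝ) :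
    ad S.rho g A = kleinMat (S.hol g) * A * kleinMat (S.hol g)⁻¹ := by
  rw [ad_apply, ← map_inv, ← map_inv]
  rfl

theorem vu_apply (g : Pi1) (A : S.vu) :
    (S.vu.ρ g A : vMod).1 = kleinMat (S.hol g) * (A : vMod).1 * kleinMat (S.hol g)⁻¹ :=
  S.ad_rho_apply g _

theorem vu_apply_kleinMat (g : Pi1) (A : S.vu) {c : GL (Fin 2) ℂ}
    (hA : (A : vMod).1 = kleinMat c) :
    (S.vu.ρ g A : vMod).1 = kleinMat (S.hol g * c * (S.hol g)⁻¹) := by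
  rw [vu_apply, hA, map_mul, map_mul]

/-- The parameter of the axis of `ρ(x)`. -/
def axis : ℂ := 2 / (S.m - 1)

/-- The peripheral invariant in `𝔳_u`. -/
def perInv : S.vu := axisVec S.axis

theorem perInv_val : (S.perInv : vMod).1 = kleinMat (halfTurn S.axis) := rfl

/-- Since the half-turn is a polynomial in ρ(x), it commutes with everything that commutes with
ρ(x), in particular with the longitude. -/
theorem halfTurn_eq (hm : S.m ≠ 1) :
    (halfTurn S.axis).val = (1 + S.axis) • 1 + (-S.axis) • S.matX.val := by
  have : S.m - 1 ≠ 0 := sub_ne_zero.2 hm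
  rw [halfTurn_val, matX_val, axis]
  ext i j
  fin_cases i <;> fin_cases j <;> simp
  field_simp
  ring

theorem commute_halfTurn (hm : S.m ≠ 1) {g : GL (Fin 2) ℂ} (hg : g * S.matX = S.matX * g) :
    g * halfTurn S.axis * g⁻¹ = halfTurn S.axis := by
  rw [mul_inv_eq_iff_eq_mul]
  apply Units.ext
  have h := congrArg Units.val hg
  rw [Units.val_mul, Units.val_mul] at h
  rw [Units.val_mul, Units.val_mul, S.halfTurn_eq hm, mul_add, add_mul, Matrix.mul_smul,
    Matrix.mul_smul, Matrix.smul_mul, Matrix.smul_mul, h, Matrix.mul_one, Matrix.one_mul]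

theorem perInv_fix (hm : S.m ≠ 1) {g : Pi1} (hg : g * x = x * g) :
    S.vu.ρ g S.perInv = S.perInv := by
  apply Subtype.ext
  refine (S.vu_apply_kleinMat g S.perInv S.perInv_val).trans ?_
  rw [S.commute_halfTurn hm, perInv_val]
  rw [← S.hol_x, ← map_mul, hg, map_mul]

/-- The trace pairing with an element of `𝔳`. -/
def pairing (A : S.vu) : S.vu →ₗ[ℝ] ℝ :=
  traceLinearMap (Fin 4) ℝ ℝ ∘ₗ LinearMap.mulLeft ℝ (A : vMod).1 ∘ₗ vMod.subtype

theorem pairing_apply (A B : S.vu) : S.pairing A B = ((A : vMod).1 * (B : vMod).1).trace := rfl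

/-- The trace form is invariant under conjugation, so a group element moves across it as its
inverse. -/
theorem pairing_rho (g : Pi1) (A B : S.vu) :
    S.pairing A (S.vu.ρ g B) = S.pairing (S.vu.ρ g⁻¹ A) B := by
  rw [pairing_apply, pairing_apply, vu_apply, vu_apply, map_inv S.hol, inv_inv]
  rw [← Matrix.mul_assoc, ← Matrix.mul_assoc, trace_mul_comm]
  simp only [Matrix.mul_assoc]

theorem pairing_inv {g : Pi1} {A : S.vu} (hA : S.vu.ρ g A = A) (B : S.vu) :
    S.pairing A (S.vu.ρ g B) = S.pairing A B := by
  have h : S.vu.ρ g⁻¹ A = A := by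
    conv_lhs => rw [← hA]
    rw [← Module.End.mul_apply, ← map_mul, inv_mul_cancel, map_one, Module.End.one_apply]
  rw [pairing_rho, h]

theorem pairing_perInv : S.pairing S.perInv S.perInv = 4 := by
  rw [pairing_apply, perInv_val, ← map_mul, halfTurn_mul_self, map_one, trace_one]
  simp

/-- The trace pairing separates elements of `𝔳` that are self-adjoint. -/
theorem exists_pairing_ne {A B : S.vu} (hA : J * (A : vMod).1ᵀ * J = (A : vMod).1)
    (hB : J * (B : vMod).1ᵀ * J = (B : vMod).1) (hne : A ≠ B) :
    ∃ C, S.pairing A C ≠ S.pairing B C := by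
  set D : Matrix (Fin 4) (Fin 4) ℝ := (A : vMod).1 - (B : vMod).1 with hD
  have hDJ : J * Dᵀ * J = D := by
    rw [hD, transpose_sub, Matrix.mul_sub, Matrix.sub_mul, hA, hB]
  have hD0 : D.trace = 0 := by
    have h1 : (A : vMod).1.trace = 0 := (A : vMod).2.1
    have h2 : (B : vMod).1.trace = 0 := (B : vMod).2.1
    rw [hD, trace_sub, h1, h2, sub_zero]
  -- The trace form is indefinite on 𝔳, but pairing D with its transpose gives the positive definite
  -- Frobenius norm; the transpose of a Lorentz self-adjoint matrix is again self-adjoint.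
  have hC : Dᵀ ∈ vMod := by
    apply mem_vMod_of_selfAdjoint (by rw [trace_transpose, hD0])
    rw [transpose_transpose]
    conv_rhs => rw [← hDJ]
    simp [transpose_mul, J_transpose, Matrix.mul_assoc]
  refine ⟨(⟨Dᵀ, hC⟩ : vMod), fun h => hne ?_⟩
  have h3 : (D * Dᵀ).trace = 0 := by
    rw [hD, Matrix.sub_mul, trace_sub]
    exact sub_eq_zero.2 h
  have h4 : D = 0 := by
    rw [← conjTranspose_eq_transpose_of_trivial] at h3
    exact trace_mul_conjTranspose_self_eq_zero_iff.1 h3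
  exact Subtype.ext (sub_eq_zero.1 h4)

theorem vu_selfAdjoint_conj (g : Pi1) :
    J * (S.vu.ρ g S.perInv : vMod).1ᵀ * J = (S.vu.ρ g S.perInv : vMod).1 := by
  rw [S.vu_apply_kleinMat g S.perInv S.perInv_val]
  apply kleinMat_selfAdjoint
  calc _ = S.hol g * (halfTurn S.axis * halfTurn S.axis) * (S.hol g)⁻¹ := by group
    _ = 1 := by rw [halfTurn_mul_self]; group

/-- `ρ(y x y⁻¹)` does not preserve the line of the peripheral invariant. -/
theorem conj_perInv_ne (hm : S.m ≠ 1) (μ : ℝ) :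
    S.vu.ρ (y * x * y⁻¹) S.perInv ≠ μ • S.perInv := by
  intro h
  have h1 : kleinMat (S.hol (y * x * y⁻¹) * halfTurn S.axis * (S.hol (y * x * y⁻¹))⁻¹) =
      μ • kleinMat (halfTurn S.axis) := by
    rw [← S.vu_apply_kleinMat (y * x * y⁻¹) S.perInv S.perInv_val, h]
    rfl
  set g := S.hol (y * x * y⁻¹) * halfTurn S.axis * (S.hol (y * x * y⁻¹))⁻¹ with hg
  -- The combination of entries in `kleinMat_lowerLeft` is linear in the matrix and vanishes on the
  -- upper triangular half-turn, hence on each of its multiples.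
  have h2 : Complex.normSq (g.val 1 0) = 0 := by
    have e1 := kleinMat_lowerLeft g
    have e2 := kleinMat_lowerLeft (halfTurn S.axis)
    rw [h1] at e1
    have e3 : (halfTurn S.axis).val 1 0 = 0 := rfl
    rw [e3, map_zero, mul_zero] at e2
    simp only [Matrix.smul_apply, smul_eq_mul] at e1
    have e4 : 8 * ‖g.val.det‖⁻¹ * Complex.normSq (g.val 1 0) = 0 := by
      rw [← e1]
      linear_combination μ * e2
    have e5 : ‖g.val.det‖⁻¹ ≠ 0 :=
      inv_ne_zero (norm_ne_zero_iff.2 (by simpa using g.det.ne_zero))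
    exact (mul_eq_zero.1 e4).resolve_left (mul_ne_zero (by norm_num) e5)
  have h3 : g.val 1 0 = 0 := Complex.normSq_eq_zero.1 h2
  have hg' : g = S.matY * S.matX * S.matY⁻¹ * halfTurn S.axis * S.matY * S.matX⁻¹ * S.matY⁻¹ := by
    rw [hg]
    simp only [map_mul, map_inv, hol_x, hol_y]
    group
  have hm0 := S.m_ne_zero
  have hm1 : S.m - 1 ≠ 0 := sub_ne_zero.2 hm
  have hz := S.z₂_ne_zero
  have hc := S.curve
  rw [hg'] at h3
  simp only [Units.val_mul, matX_val, matY_val, matX_inv_val, matY_inv_val, halfTurn_val,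
    axis] at h3
  simp [Matrix.mul_apply, Fin.sum_univ_two] at h3
  field_simp at h3
  -- This factor is the lower left entry up to units, modulo the curve. Also (z₂ - 1 + m)(z₂ - m²)
  -- is the curve polynomial minus m³, so its vanishing leaves m⁴ z₂ = 0.
  have key : S.z₂ * (S.z₂ - 1 + S.m) * (S.m * (S.z₂ - S.m ^ 2)) = 0 := by
    linear_combination (-1 / 2) * h3 - S.z₂ * (S.z₂ - 1 + S.m) * hc
  have : S.m ^ 4 * S.z₂ = 0 := by linear_combination S.z₂ * S.m * hc - key
  exact mul_ne_zero (pow_ne_zero 4 hm0) hz this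

theorem kleinMat_mulVec (g : GL (Fin 2) ℂ) (X : Fin 4 → ℝ) :
    kleinMat g *ᵥ X = ‖g.val.det‖⁻¹ • coords (g.val * herm X * g.valᴴ) := by
  simp [kleinMat, smul_mulVec, LinearMap.toMatrix'_mulVec, kleinLin_apply]

/-- Symmetric products of two fixed Lorentz-orthogonal vectors are invariant in `𝔳`. -/
theorem conj_symmProd {P Q : Matrix (Fin 4) (Fin 4) ℝ} (hP : Pᵀ * J * P = J) (hPQ : P * Q = 1)
    {v w : Fin 4 → ℝ} (hv : P *ᵥ v = v) (hw : P *ᵥ w = w) :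
    P * ((vecMulVec v w + vecMulVec w v) * J) * Q = (vecMulVec v w + vecMulVec w v) * J := by
  have hJ : J * Q = Pᵀ * J := by
    calc J * Q = Pᵀ * J * (P * Q) := by rw [← Matrix.mul_assoc, hP]
      _ = Pᵀ * J := by rw [hPQ, Matrix.mul_one]
  calc P * ((vecMulVec v w + vecMulVec w v) * J) * Q
      = P * (vecMulVec v w + vecMulVec w v) * (J * Q) := by simp only [Matrix.mul_assoc]
    _ = P * (vecMulVec v w + vecMulVec w v) * Pᵀ * J := by rw [hJ, Matrix.mul_assoc _ Pᵀ]
    _ = _ := by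
      rw [Matrix.mul_add, Matrix.add_mul, mul_vecMulVec, mul_vecMulVec, vecMulVec_mul,
        vecMulVec_mul, vecMul_transpose, vecMul_transpose, hv, hw]

theorem symmProd_mem_vMod {v w : Fin 4 → ℝ} (h : v ⬝ᵥ (J *ᵥ w) = 0) :
    (vecMulVec v w + vecMulVec w v) * J ∈ vMod := by
  apply mem_vMod_of_selfAdjoint
  · have h' : w ⬝ᵥ (J *ᵥ v) = 0 := by
      rw [dotProduct_mulVec, ← mulVec_transpose, J_transpose, dotProduct_comm, h]
    rw [Matrix.add_mul, trace_add, vecMulVec_mul, vecMulVec_mul, trace_vecMulVec,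
      trace_vecMulVec, ← mulVec_transpose, ← mulVec_transpose, J_transpose, h, h', add_zero]
  · rw [transpose_mul, J_transpose, ← Matrix.mul_assoc, J_mul_J, Matrix.one_mul, transpose_add,
      transpose_vecMulVec, transpose_vecMulVec, add_comm]

/-- If the meridian is parabolic then its invariants in `𝔳` have dimension greater than one. -/
theorem m_ne_one_of_finrank (h : Module.finrank ℝ (LinearMap.ker (S.vu.ρ x - 1)) = 1) :
    S.m ≠ 1 := by
  intro hm
  have hX : S.matX.val = !![1, -1; 0, 1] := by rw [matX_val, hm]
  have hXH : S.matX.valᴴ = !![1, 0; -1, 1] := by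
    rw [hX]
    ext i j
    fin_cases i <;> fin_cases j <;> simp [conjTranspose_apply]
  have hd : ‖S.matX.val.det‖⁻¹ = 1 := by rw [hX]; simp [det_fin_two]
  -- The null vector v is the Hermitian matrix diag(1, 0), the fixed point ∞; w is orthogonal to v
  -- and is fixed because the translation is real. The symmetric products v·v and v·w are two
  -- independent invariants.
  let v : Fin 4 → ℝ := ![0, 0, -1, 1]
  let w : Fin 4 → ℝ := ![0, 1, 0, 0]
  have hv : kleinMat S.matX *ᵥ v = v := by
    rw [kleinMat_mulVec, hd, one_smul, hXH, hX]
    ext i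
    fin_cases i <;> simp [coords, herm, v]
  have hw : kleinMat S.matX *ᵥ w = w := by
    rw [kleinMat_mulVec, hd, one_smul, hXH, hX]
    ext i
    fin_cases i <;> simp [coords, herm, w]
  have hQ : kleinMat S.matX * kleinMat S.matX⁻¹ = 1 := by
    rw [← map_mul, mul_inv_cancel, map_one]
  have hvv : v ⬝ᵥ (J *ᵥ v) = 0 := by
    simp [v, J, dotProduct, Fin.sum_univ_four, mulVec_diagonal]
  have hvw : v ⬝ᵥ (J *ᵥ w) = 0 := by
    simp [v, w, J, dotProduct, Fin.sum_univ_four, mulVec_diagonal]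
  let A : S.vu := (⟨_, symmProd_mem_vMod hvv⟩ : vMod)
  let B : S.vu := (⟨_, symmProd_mem_vMod hvw⟩ : vMod)
  have hA : A ∈ LinearMap.ker (S.vu.ρ x - 1) := by
    rw [LinearMap.mem_ker, LinearMap.sub_apply, sub_eq_zero]
    apply Subtype.ext
    refine (S.vu_apply x A).trans ?_
    rw [hol_x]
    exact conj_symmProd (kleinMat_isometry _) hQ hv hv
  have hB : B ∈ LinearMap.ker (S.vu.ρ x - 1) := by
    rw [LinearMap.mem_ker, LinearMap.sub_apply, sub_eq_zero]
    apply Subtype.ext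
    refine (S.vu_apply x B).trans ?_
    rw [hol_x]
    exact conj_symmProd (kleinMat_isometry _) hQ hv hw
  have hA0 : (⟨A, hA⟩ : LinearMap.ker (S.vu.ρ x - 1)) ≠ 0 := by
    intro h0
    have h1 : (vecMulVec v v + vecMulVec v v) * J = 0 :=
      congrArg Subtype.val (congrArg Subtype.val h0)
    have h2 := congrFun (congrFun h1 3) 3
    simp [v, J] at h2
  obtain ⟨c, hc⟩ := exists_smul_eq_of_finrank_eq_one h hA0 ⟨B, hB⟩
  have h1 : c • ((vecMulVec v v + vecMulVec v v) * J) = (vecMulVec v w + vecMulVec w v) * J :=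
    congrArg Subtype.val (congrArg Subtype.val hc)
  have h2 := congrFun (congrFun h1 1) 3
  simp [v, w, J] at h2

/-- If y fixed α, then so would yxy⁻¹, against `conj_perInv_ne`. -/
theorem perInv_move_y (hm : S.m ≠ 1) : S.vu.ρ y S.perInv ≠ S.perInv := by
  intro h
  apply S.conj_perInv_ne hm 1
  have h' : S.vu.ρ y⁻¹ S.perInv = S.perInv := by
    conv_lhs => rw [← h]
    rw [← Module.End.mul_apply, ← map_mul, inv_mul_cancel, map_one, Module.End.one_apply]
  rw [map_mul, map_mul, Module.End.mul_apply, Module.End.mul_apply, h', S.perInv_fix hm rfl, h,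
    one_smul]

theorem perInv_ne_zero : S.perInv ≠ 0 := by
  intro h0
  have h2 := S.pairing_perInv
  rw [h0, map_zero] at h2
  norm_num at h2

/-- The hypotheses of the theorem provide peripheral data. -/
theorem peripheral (hm : S.m ≠ 1) (hx : Module.finrank ℝ (LinearMap.ker (S.vu.ρ x - 1)) = 1)
    (hker : Module.finrank ℝ (LinearMap.ker S.dwdy) = 1) :
    Peripheral S.vu S.perInv (S.pairing S.perInv) where
  fix_x := S.perInv_fix hm rfl
  fix_l := S.perInv_fix hm l_mul_x
  move_y := S.perInv_move_y hm
  inv_x := S.pairing_inv (S.perInv_fix hm rfl)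
  inv_l := S.pairing_inv (S.perInv_fix hm l_mul_x)
  detect := by rw [pairing_perInv]; norm_num
  dual := by
    simp only [pairing_rho]
    -- Equality of the two functionals means A⁻¹α = B⁻¹α. As A⁻¹ = x⁻¹ · yxy⁻¹ and B⁻¹ = yxy⁻¹ ·
    -- x⁻¹, the vector ρ(yxy⁻¹)α would then be fixed by x, hence be a multiple of α.
    refine S.exists_pairing_ne (S.vu_selfAdjoint_conj _) (S.vu_selfAdjoint_conj _) fun h => ?_
    have hfix := S.perInv_fix hm (g := x) rfl
    have hfix' := S.perInv_fix hm (g := x⁻¹) (by group)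
    have hA : (proj conjA)⁻¹ = x⁻¹ * (y * x * y⁻¹) := by
      simp only [conjA, map_mul, map_inv, proj_wx, proj_wy]
      group
    have hB : (proj conjB)⁻¹ = y * x * y⁻¹ * x⁻¹ := by
      simp only [conjB, map_mul, map_inv, proj_wx, proj_wy]
      group
    rw [hA, hB, map_mul _ x⁻¹, map_mul _ _ x⁻¹, Module.End.mul_apply, Module.End.mul_apply,
      hfix'] at h
    have h1 : S.vu.ρ x (S.vu.ρ (y * x * y⁻¹) S.perInv) = S.vu.ρ (y * x * y⁻¹) S.perInv := by
      conv_lhs => rw [← h]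
      rw [← Module.End.mul_apply, ← map_mul, mul_inv_cancel, map_one, Module.End.one_apply]
    have hne : (⟨S.perInv, by simp [hfix]⟩ : LinearMap.ker (S.vu.ρ x - 1)) ≠ 0 := fun h0 =>
      S.perInv_ne_zero (congrArg Subtype.val h0)
    obtain ⟨μ, hμ⟩ := exists_smul_eq_of_finrank_eq_one hx hne
      ⟨S.vu.ρ (y * x * y⁻¹) S.perInv, sub_eq_zero.2 h1⟩
    exact S.conj_perInv_ne hm μ (congrArg Subtype.val hμ).symm
  ker_x := hx
  ker_fox := hker

end DehnPoint

end FigEight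

end

noncomputable section

namespace FigEight

open Matrix

/-! ### The curve of representations over a commutative ring -/

section Curve

variable {R : Type*} [CommRing R] {m n z : R}

/-- Pulling the inverse n of m out of the matrices leaves polynomial entries in m and z, so that the
relation and the longitude become polynomial identities over any commutative ring. They are used
over the dual numbers. -/
theorem inv_matX_eq (h : m * n = 1) : !![1, n; 0, n] = n • !![m, 1; 0, 1] := by
  ext i j
  fin_cases i <;> fin_cases j <;> simp [mul_comm n m, h]

theorem inv_matY_eq (h : m * n = 1) : !![n, 0; z * n, 1] = n • !![1, 0; z, m] := by
  ext i j
  fin_cases i <;> fin_cases j <;> simp [mul_comm n m, h, mul_comm z n]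

/-- The relation of the figure-eight knot group forces the parameters onto the curve. -/
theorem curve_of_relation (h : m * n = 1)
    (hr : !![1, -1; 0, m] * !![n, 0; z * n, 1] * !![1, n; 0, n] * !![m, 0; -z, 1] *
        !![1, -1; 0, m] =
      !![m, 0; -z, 1] * (!![1, -1; 0, m] * !![n, 0; z * n, 1] * !![1, n; 0, n] *
        !![m, 0; -z, 1])) :
    z ^ 2 + (m - m ^ 2 - 1) * z + m ^ 2 = 0 := by
  rw [inv_matX_eq h, inv_matY_eq h] at hr
  simp only [smul_mul, mul_smul_comm, smul_smul] at hr
  have h2 : (m * m) • (n * n) • (!![1, -1; 0, m] * !![1, 0; z, m] * !![m, 1; 0, 1] *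
      !![m, 0; -z, 1] * !![1, -1; 0, m]) = (m * m) • (n * n) • (!![m, 0; -z, 1] *
      (!![1, -1; 0, m] * !![1, 0; z, m] * !![m, 1; 0, 1] * !![m, 0; -z, 1])) := by
    rw [hr]
  have h3 : m * m * (n * n) = 1 := by linear_combination (m * n + 1) * h
  rw [smul_smul, smul_smul, h3, one_smul, one_smul] at h2
  have h4 := congrFun (congrFun h2 0) 1
  simp [Matrix.mul_apply, Fin.sum_univ_two] at h4
  linear_combination -h4

/-- On the curve the longitude is upper triangular with eigenvalues rational in `z`. -/
theorem longitude_of_curve (h : m * n = 1) (hc : z ^ 2 + (m - m ^ 2 - 1) * z + m ^ 2 = 0)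
    {L : Matrix (Fin 2) (Fin 2) R}
    (hL : L = !![m, 0; -z, 1] * !![1, n; 0, n] * !![n, 0; z * n, 1] * !![1, -1; 0, m] *
      !![1, -1; 0, m] * !![n, 0; z * n, 1] * !![1, n; 0, n] * !![m, 0; -z, 1]) :
    L 0 0 * (1 - z) ^ 2 = z ∧ L 1 0 = 0 ∧ L 1 1 * z = (1 - z) ^ 2 := by
  rw [inv_matX_eq h, inv_matY_eq h] at hL
  simp only [smul_mul, mul_smul_comm, smul_smul] at hL
  have h4 : n * n * n * n * m ^ 4 = 1 := by
    have : n * n * n * n * m ^ 4 = (m * n) ^ 4 := by ring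
    rw [this, h, one_pow]
  subst hL
  simp only [Matrix.smul_apply, smul_eq_mul]
  refine ⟨?_, ?_, ?_⟩
  · simp [Matrix.mul_apply, Fin.sum_univ_two]
    linear_combination n * n * n * n * (m * z - 2 * m * z ^ 2 + m * z ^ 3 + m ^ 2 -
      2 * m ^ 2 * z + m ^ 2 * z ^ 3 - 2 * m ^ 3 * z + m ^ 3 * z ^ 2 + m ^ 4 * z -
      m ^ 4 * z ^ 2) * hc + z * h4
  · simp [Matrix.mul_apply, Fin.sum_univ_two]
    linear_combination n * n * n * n * (z - z ^ 2 - m * z - m * z ^ 2 - m ^ 2 * z +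
      m ^ 3 * z) * hc
  · simp [Matrix.mul_apply, Fin.sum_univ_two]
    linear_combination n * n * n * n * (-z + z ^ 2 + m * z + m * z ^ 2 - m ^ 2 +
      2 * m ^ 2 * z) * hc + (1 - z) ^ 2 * h4

end Curve

/-! ### Infinitesimal deformations in `PSL(2, ℂ)` -/

/-- The adjoint action of a linear group on matrices. -/
def conjRep {G : Type*} [Group G] (ρ : G →* GL (Fin 2) ℂ) :
    Representation ℂ G (Matrix (Fin 2) (Fin 2) ℂ) where
  toFun g := LinearMap.mulLeftRight ℂ ((ρ g).val, ((ρ g)⁻¹).val)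
  map_one' := by ext1 A; simp
  map_mul' g h := by
    ext1 A
    simp [Matrix.mul_assoc]

theorem conjRep_apply {G : Type*} [Group G] (ρ : G →* GL (Fin 2) ℂ) (g : G)
    (A : Matrix (Fin 2) (Fin 2) ℂ) : conjRep ρ g A = (ρ g).val * A * ((ρ g)⁻¹).val := by
  simp [conjRep]

theorem trace_conjRep {G : Type*} [Group G] (ρ : G →* GL (Fin 2) ℂ) (g : G)
    (A : Matrix (Fin 2) (Fin 2) ℂ) : (conjRep ρ g A).trace = A.trace := by
  rw [conjRep_apply, trace_mul_comm, ← Matrix.mul_assoc, Units.inv_mul, Matrix.one_mul]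

/-- The homomorphism to matrices over the dual numbers defined by a crossed homomorphism. -/
def dualHom {G : Type*} [Group G] {ρ : G →* GL (Fin 2) ℂ} {z : G → Matrix (Fin 2) (Fin 2) ℂ}
    (hz : IsCrossed (conjRep ρ) z) : G →* Matrix (Fin 2) (Fin 2) (DualNumber ℂ) where
  toFun g := Matrix.of fun i j =>
    TrivSqZeroExt.inl ((ρ g).val i j) + TrivSqZeroExt.inr ((z g * (ρ g).val) i j)
  map_one' := by
    ext i j
    · simp [Matrix.one_apply, apply_ite TrivSqZeroExt.fst]
    · simp [hz.map_one, Matrix.one_apply, apply_ite TrivSqZeroExt.snd]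
  map_mul' g h := by
    ext i j
    · simp [Matrix.mul_apply, Fin.sum_univ_two]
    · have e : z (g * h) * (ρ (g * h)).val =
          (ρ g).val * (z h * (ρ h).val) + z g * (ρ g).val * (ρ h).val := by
        rw [hz, conjRep_apply, map_mul, Units.val_mul, Matrix.add_mul]
        congr 1
        · calc _ = (ρ g).val * z h * (((ρ g)⁻¹).val * (ρ g).val) * (ρ h).val := by
                simp only [Matrix.mul_assoc]
            _ = _ := by rw [Units.inv_mul, Matrix.mul_one, Matrix.mul_assoc]
        · rw [Matrix.mul_assoc]
      simp only [Matrix.of_apply, e]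
      simp [Matrix.mul_apply, Fin.sum_univ_two]
      ring

theorem dualHom_fst {G : Type*} [Group G] {ρ : G →* GL (Fin 2) ℂ}
    {z : G → Matrix (Fin 2) (Fin 2) ℂ} (hz : IsCrossed (conjRep ρ) z) (g : G) (i j : Fin 2) :
    (dualHom hz g i j).fst = (ρ g).val i j := by
  simp [dualHom]

theorem dualHom_snd {G : Type*} [Group G] {ρ : G →* GL (Fin 2) ℂ}
    {z : G → Matrix (Fin 2) (Fin 2) ℂ} (hz : IsCrossed (conjRep ρ) z) (g : G) (i j : Fin 2) :
    (dualHom hz g i j).snd = (z g * (ρ g).val) i j := by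
  simp [dualHom]

/-- The homomorphism `π₁(M) → ℂ` with prescribed value on the meridian. -/
theorem exists_abelianization (s : ℂ) :
    ∃ χ : Pi1 → ℂ, (∀ g h, χ (g * h) = χ g + χ h) ∧ χ x = s ∧ χ y = s := by
  let F : Pi1 →* Multiplicative ℂ :=
    PresentedGroup.toGroup (f := fun _ => Multiplicative.ofAdd s) (by
      intro r hr
      rw [Set.mem_singleton_iff.1 hr]
      simp only [relator, wa, wx, wy, map_mul, map_inv, FreeGroup.lift_apply_of]
      group)
  refine ⟨fun g => Multiplicative.toAdd (F g), fun g h => ?_, ?_, ?_⟩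
  · simp
  · simp [F, x, PresentedGroup.toGroup.of]
  · simp [F, y, PresentedGroup.toGroup.of]

/-! ### Rigidity of the filled manifold in PSL(2, ℂ) -/

namespace DehnPoint

variable (S : DehnPoint)

/-- In normal form, a crossed homomorphism is a tangent vector `(dm, dz)` of the curve, and its
periods on the boundary torus are those of the eigenvalues. -/
theorem tangent_of_normalForm {z : Pi1 → Matrix (Fin 2) (Fin 2) ℂ}
    (hz : IsCrossed (conjRep S.hol) z) {dm dz : ℂ}
    (hx : z x * S.matX.val = !![0, 0; 0, dm]) (hy : z y * S.matY.val = !![dm, 0; -dz, 0]) :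
    (2 * S.z₂ + S.m - S.m ^ 2 - 1) * dz + (S.z₂ - 2 * S.m * S.z₂ + 2 * S.m) * dm = 0 ∧
    z l 1 0 = 0 ∧ (z l 0 0 - z l 1 1) * (S.z₂ * (1 - S.z₂)) = 2 * (1 + S.z₂) * dz := by
  have hm0 := S.m_ne_zero
  let H := dualHom hz
  let M : DualNumber ℂ := TrivSqZeroExt.inl S.m + TrivSqZeroExt.inr dm
  let N : DualNumber ℂ := TrivSqZeroExt.inl (S.m⁻¹) + TrivSqZeroExt.inr (-dm * (S.m⁻¹) ^ 2)
  let Z : DualNumber ℂ := TrivSqZeroExt.inl S.z₂ + TrivSqZeroExt.inr dz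
  have hMN : M * N = 1 := by
    ext
    · simp [M, N, hm0]
    · simp [M, N]
      field_simp
      ring
  have hHx : H x = !![1, -1; 0, M] := by
    ext i j
    · rw [dualHom_fst, hol_x, matX_val]
      fin_cases i <;> fin_cases j <;> simp [M]
    · rw [dualHom_snd, hol_x, hx]
      fin_cases i <;> fin_cases j <;> simp [M]
  have hHy : H y = !![M, 0; -Z, 1] := by
    ext i j
    · rw [dualHom_fst, hol_y, matY_val]
      fin_cases i <;> fin_cases j <;> simp [M, Z]
    · rw [dualHom_snd, hol_y, hy]
      fin_cases i <;> fin_cases j <;> simp [M, Z]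
  have hHx' : H x⁻¹ = !![1, N; 0, N] := by
    have h1 : H x⁻¹ * H x = 1 := by rw [← map_mul, inv_mul_cancel, map_one]
    have h2 : H x * !![1, N; 0, N] = 1 := by
      rw [hHx]
      ext1 i j
      fin_cases i <;> fin_cases j <;> simp [Matrix.mul_apply, Fin.sum_univ_two, hMN]
    exact left_inv_eq_right_inv h1 h2
  have hHy' : H y⁻¹ = !![N, 0; Z * N, 1] := by
    have h1 : H y⁻¹ * H y = 1 := by rw [← map_mul, inv_mul_cancel, map_one]
    have h2 : H y * !![N, 0; Z * N, 1] = 1 := by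
      rw [hHy]
      ext1 i j
      fin_cases i <;> fin_cases j <;> simp [Matrix.mul_apply, Fin.sum_univ_two, hMN]
    exact left_inv_eq_right_inv h1 h2
  -- The ring identities hold over ℂ[ε]; the ε-component of the curve equation is the equation of
  -- its tangent line, and that of the longitude gives the variation of its eigenvalues.
  have hcurve : Z ^ 2 + (M - M ^ 2 - 1) * Z + M ^ 2 = 0 := by
    apply curve_of_relation hMN
    rw [← hHx, ← hHy, ← hHx', ← hHy']
    simp only [← map_mul]
    exact congrArg H a_mul_x
  have hl : H l = !![M, 0; -Z, 1] * !![1, N; 0, N] * !![N, 0; Z * N, 1] * !![1, -1; 0, M] *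
      !![1, -1; 0, M] * !![N, 0; Z * N, 1] * !![1, N; 0, N] * !![M, 0; -Z, 1] := by
    rw [← hHx, ← hHy, ← hHx', ← hHy']
    simp only [← map_mul]
    congr 1
    simp only [l, a, b]
    group
  obtain ⟨h00, h10, h11⟩ := longitude_of_curve hMN hcurve hl
  have c1 := congrArg TrivSqZeroExt.snd hcurve
  have a00 := congrArg TrivSqZeroExt.fst h00
  have b00 := congrArg TrivSqZeroExt.snd h00
  have a10 := congrArg TrivSqZeroExt.fst h10
  have b10 := congrArg TrivSqZeroExt.snd h10
  have a11 := congrArg TrivSqZeroExt.fst h11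
  have b11 := congrArg TrivSqZeroExt.snd h11
  have f1 : (1 - Z).fst = 1 - S.z₂ := by simp [Z]
  have f2 : (1 - Z).snd = -dz := by simp [Z]
  have f3 : Z.fst = S.z₂ := by simp [Z]
  have f4 : Z.snd = dz := by simp [Z]
  have f5 : M.fst = S.m := by simp [M]
  have f6 : M.snd = dm := by simp [M]
  simp only [H, pow_two, TrivSqZeroExt.fst_mul, TrivSqZeroExt.snd_mul, dualHom_fst,
    dualHom_snd, f1, f2, f3, f4, f5, f6, TrivSqZeroExt.snd_add,
    TrivSqZeroExt.fst_sub, TrivSqZeroExt.snd_sub, TrivSqZeroExt.fst_one, TrivSqZeroExt.snd_one,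
    TrivSqZeroExt.fst_zero, TrivSqZeroExt.snd_zero, Matrix.mul_apply, Fin.sum_univ_two,
    smul_eq_mul, MulOpposite.smul_eq_mul_unop, MulOpposite.unop_op]
    at c1 a00 b00 a10 b10 a11 b11
  set A := (S.hol l).val
  have hz0 := S.z₂_ne_zero
  have hz1 := S.one_sub_z₂_ne_zero
  have hA00 : A 0 0 ≠ 0 := fun h => hz0 (by rw [← a00, h, zero_mul])
  have e10 : z l 1 0 = 0 := by
    rw [a10, mul_zero, add_zero] at b10
    exact (mul_eq_zero.1 b10).resolve_right hA00
  rw [a10] at b00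
  rw [e10] at b11
  refine ⟨by linear_combination c1, e10, ?_⟩
  have e00 : z l 0 0 * (S.z₂ * (1 - S.z₂)) = (1 + S.z₂) * dz := by
    linear_combination (1 - S.z₂) * b00 + (2 * dz - (1 - S.z₂) * z l 0 0) * a00
  have e11 : z l 1 1 * (S.z₂ * (1 - S.z₂)) = -((1 + S.z₂) * dz) := by
    apply mul_left_cancel₀ hz1
    linear_combination S.z₂ * b11 - (dz + S.z₂ * z l 1 1) * a11
  linear_combination e00 - e11

/-- The gluing equation without the factor 1 - z₂. With m = z₁(1 - z₂) it turns the coefficients of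
the tangent equation into products in the shapes. -/
theorem m_sq : S.m ^ 2 = (1 - S.z₁) * S.z₂ := by
  have hc := S.curve
  have h1 : S.m = S.z₁ * (1 - S.z₂) := rfl
  apply mul_left_cancel₀ S.one_sub_z₂_ne_zero
  linear_combination hc - S.z₂ * h1

/-- The ratio of the differentials of the complex lengths is never real. -/
theorem period_ne_zero {p q : ℤ} (hpq : IsCoprime p q) :
    -(p : ℂ) * (1 - S.z₁ - S.z₂) + 2 * q * ((2 - S.z₁) * (1 + S.z₂)) ≠ 0 := by
  intro h
  have hi1 := S.im_pos₁
  have hi2 := S.im_pos₂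
  have h1 : 2 - S.z₁ ≠ 0 := fun h => by
    have := congrArg Complex.im h
    simp at this
    linarith
  have h2 : 1 + S.z₂ ≠ 0 := fun h => by
    have := congrArg Complex.im h
    simp at this
    linarith
  -- Dividing by (2 - z₁)(1 + z₂) splits the expression into two inverses whose imaginary parts have
  -- known signs.
  have h3 : (p : ℂ) * ((1 + S.z₂)⁻¹ - (2 - S.z₁)⁻¹) = 2 * q := by
    field_simp
    linear_combination -h
  have h4 := congrArg Complex.im h3
  have h5 : ((1 + S.z₂)⁻¹ - (2 - S.z₁)⁻¹).im < 0 := by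
    have e1 : 0 < Complex.normSq (1 + S.z₂) := Complex.normSq_pos.2 h2
    have e2 : 0 < Complex.normSq (2 - S.z₁) := Complex.normSq_pos.2 h1
    rw [Complex.sub_im, Complex.inv_im, Complex.inv_im]
    have e3 : -(1 + S.z₂).im / Complex.normSq (1 + S.z₂) < 0 :=
      div_neg_of_neg_of_pos (by simpa using hi2) e1
    have e4 : 0 < -(2 - S.z₁).im / Complex.normSq (2 - S.z₁) :=
      div_pos (by simpa using hi1) e2
    linarith
  have hp : p = 0 := by
    have e : (p : ℝ) * ((1 + S.z₂)⁻¹ - (2 - S.z₁)⁻¹).im = 0 := by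
      simpa [Complex.mul_im] using h4
    exact_mod_cast (mul_eq_zero.1 e).resolve_right h5.ne
  have hq : q = 0 := by
    rw [hp] at h3
    simpa using h3.symm
  rw [hp, hq] at hpq
  exact not_isCoprime_zero_zero hpq

/-- Every crossed homomorphism into trace-free matrices is cohomologous to one in normal form. -/
theorem exists_normalForm (hm : S.m ≠ 1) {z : Pi1 → Matrix (Fin 2) (Fin 2) ℂ}
    (htr : ∀ g, (z g).trace = 0) :
    ∃ (B : Matrix (Fin 2) (Fin 2) ℂ) (s : ℂ), B.trace = 0 ∧
      z x - (conjRep S.hol x B - B) = !![-s, 0; 0, s] ∧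
      ((z y - (conjRep S.hol y B - B)) * S.matY.val) 0 1 = 0 := by
  have hm0 := S.m_ne_zero
  have hm1 : 1 - S.m ≠ 0 := sub_ne_zero.2 hm.symm
  have hm1' : S.m - 1 ≠ 0 := sub_ne_zero.2 hm
  let a' := z x 1 0 / (1 - S.m)
  -- W removes the off-diagonal entries of z(x). The half-turn C commutes with ρ(x), so adding μC
  -- leaves z(x) alone and is free to remove one entry at y; that entry of the variation of C is (m
  -- - 1) · 2/(m - 1) = 2.
  let W : Matrix (Fin 2) (Fin 2) ℂ := !![0, (z x 0 1 * S.m - a') / (1 - S.m); -a', 0]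
  let C := (halfTurn S.axis).val
  let μ := ((z y - (conjRep S.hol y W - W)) * S.matY.val) 0 1 / 2
  have hC : conjRep S.hol x C = C := by
    have := congrArg Units.val (S.commute_halfTurn hm (g := S.matX) rfl)
    rw [conjRep_apply, hol_x]
    exact this
  have hCy : ((conjRep S.hol y C - C) * S.matY.val) 0 1 = 2 := by
    rw [conjRep_apply, hol_y, Matrix.sub_mul, Matrix.mul_assoc _ _ S.matY.val, Units.inv_mul,
      Matrix.mul_one]
    simp [C, halfTurn_val, matY_val, axis]
    field_simp
  have h00 : z x 0 0 + z x 1 1 = 0 := by rw [← trace_fin_two]; exact htr x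
  refine ⟨W + μ • C, a' - z x 0 0, ?_, ?_, ?_⟩
  · simp [trace_fin_two, W, C, halfTurn_val]
  · rw [map_add, map_smul, hC, add_sub_add_right_eq_sub, conjRep_apply, hol_x, matX_val,
      matX_inv_val]
    ext i j
    fin_cases i <;> fin_cases j <;> simp [W, a'] <;> field_simp
    · ring
    · ring
    · linear_combination (1 - S.m) * h00
  · have e : (z y - (conjRep S.hol y (W + μ • C) - (W + μ • C))) * S.matY.val =
        (z y - (conjRep S.hol y W - W)) * S.matY.val -
          μ • ((conjRep S.hol y C - C) * S.matY.val) := by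
      rw [map_add, map_smul, ← Matrix.smul_mul, ← Matrix.sub_mul, smul_sub]
      congr 1
      abel
    rw [e, Matrix.sub_apply, Matrix.smul_apply, hCy]
    simp [μ]

/-- Infinitesimal rigidity of the filled manifold in `PSL(2, ℂ)`. -/
theorem sl2_coboundary_of_filling {z : Pi1 → Matrix (Fin 2) (Fin 2) ℂ}
    (hz : IsCrossed (conjRep S.hol) z) (htr : ∀ g, (z g).trace = 0) (hm : S.m ≠ 1) {p q : ℤ}
    (hpq : IsCoprime p q) (h0 : z (x ^ p * l ^ q) = 0) :
    ∃ B : Matrix (Fin 2) (Fin 2) ℂ, B.trace = 0 ∧ ∀ g, z g = conjRep S.hol g B - B := by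
  obtain ⟨B, s, hB, hx, hy⟩ := S.exists_normalForm hm htr
  refine ⟨B, hB, ?_⟩
  have hm0 := S.m_ne_zero
  have hm1 : S.m - 1 ≠ 0 := sub_ne_zero.2 hm
  have hz0 := S.z₂_ne_zero
  have hz1 := S.one_sub_z₂_ne_zero
  set w : Pi1 → Matrix (Fin 2) (Fin 2) ℂ := fun g => z g - (conjRep S.hol g B - B) with hw
  have hwc : IsCrossed (conjRep S.hol) w := hz.sub (IsCrossed.coboundary _ B)
  have hwtr : ∀ g, (w g).trace = 0 := fun g => by
    rw [hw]
    simp only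
    rw [trace_sub, trace_sub, trace_conjRep, htr, sub_self, sub_zero]
  -- The representatives of x and y in GL(2, ℂ) have one eigenvalue equal to 1. Adding the scalar
  -- cocycle χ preserves this normalisation, with dm = 2sm.
  obtain ⟨χ, hχ, hχx, hχy⟩ := exists_abelianization s
  have hw' : IsCrossed (conjRep S.hol) (fun g => w g + χ g • (1 : Matrix (Fin 2) (Fin 2) ℂ)) := by
    intro g h
    have e : conjRep S.hol g (1 : Matrix (Fin 2) (Fin 2) ℂ) = 1 := by
      rw [conjRep_apply, Matrix.mul_one, Units.mul_inv]
    simp only [hwc g h, hχ, map_add, map_smul, e, add_smul]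
    abel
  -- traces of conjugate elements
  have htrace : (w y * S.matY.val).trace = (w x * S.matX.val).trace := by
    have e1 := congrArg w a_mul_x
    rw [hwc, hwc, conjRep_apply, conjRep_apply, hol_y] at e1
    have e2 : S.matY = S.hol a * S.matX * (S.hol a)⁻¹ := by
      rw [eq_mul_inv_iff_mul_eq, ← hol_x, ← hol_y, ← map_mul, ← map_mul, a_mul_x]
    have e3 : w y = (S.hol a).val * w x * ((S.hol a)⁻¹).val + w a -
        S.matY.val * w a * (S.matY⁻¹).val := by rw [e1]; abel
    have e4 : ((S.hol a).val * w x * ((S.hol a)⁻¹).val * S.matY.val).trace =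
        (w x * S.matX.val).trace := by
      rw [e2, Units.val_mul, Units.val_mul]
      calc _ = ((S.hol a).val * (w x * (((S.hol a)⁻¹).val * (S.hol a).val) * S.matX.val *
            ((S.hol a)⁻¹).val)).trace := by simp only [Matrix.mul_assoc]
        _ = _ := by
          rw [Units.inv_mul, Matrix.mul_one, trace_mul_comm, Matrix.mul_assoc _ _ (S.hol a).val,
            Units.inv_mul, Matrix.mul_one]
    rw [e3, Matrix.sub_mul, Matrix.add_mul, trace_sub, trace_add, e4,
      Matrix.mul_assoc _ _ S.matY.val, Units.inv_mul, Matrix.mul_one, trace_mul_comm S.matY.val]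
    ring
  have hwx : w x = !![-s, 0; 0, s] := hx
  have hwy : (w y * S.matY.val) 0 1 = 0 := hy
  have hwy0 := hwtr y
  rw [trace_fin_two] at hwy0
  rw [hwx, trace_fin_two, trace_fin_two] at htrace
  simp [matX_val, matY_val, Matrix.mul_apply, Fin.sum_univ_two] at htrace hwy
  have f11 : w y 1 1 = -s := by
    apply mul_left_cancel₀ hm1
    linear_combination S.m * hwy0 - htrace - S.z₂ * hwy
  have f00 : w y 0 0 = s := by linear_combination hwy0 - f11
  have hdx : (w x + χ x • 1) * S.matX.val = !![0, 0; 0, 2 * s * S.m] := by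
    rw [hχx, hwx, matX_val]
    ext i j
    fin_cases i <;> fin_cases j <;> simp [Matrix.mul_apply, Fin.sum_univ_two]
    left
    ring
  have hdy : (w y + χ y • 1) * S.matY.val =
      !![2 * s * S.m, 0; -(-(w y 1 0 * S.m)), 0] := by
    rw [hχy, matY_val]
    ext i j
    fin_cases i <;> fin_cases j <;>
      simp [Matrix.mul_apply, Fin.sum_univ_two, hwy, f11, f00]
    left
    ring
  obtain ⟨t1, t2, t3⟩ := S.tangent_of_normalForm hw' hdx hdy
  simp at t2 t3
  -- The complex analogue of the peripheral functional: the trace against the half-turn. It takes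
  -- the value -2s at x and the difference of the diagonal entries at l.
  let f : Matrix (Fin 2) (Fin 2) ℂ →+ ℂ :=
    (traceLinearMap (Fin 2) ℂ ℂ ∘ₗ LinearMap.mulLeft ℂ (halfTurn S.axis).val).toAddMonoidHom
  have hf : ∀ A, f A = ((halfTurn S.axis).val * A).trace := fun A => rfl
  have hfinv : ∀ g, g * x = x * g → ∀ A, f (conjRep S.hol g A) = f A := by
    intro g hg A
    have e := S.commute_halfTurn hm (g := (S.hol g)⁻¹) (by
      rw [← S.hol_x, ← map_inv, ← map_mul, ← map_mul]
      congr 1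
      rw [inv_mul_eq_iff_eq_mul, ← mul_assoc, hg, mul_inv_cancel_right])
    rw [inv_inv] at e
    rw [hf, hf, conjRep_apply, ← Matrix.mul_assoc, ← Matrix.mul_assoc, trace_mul_comm,
      ← Matrix.mul_assoc, ← Matrix.mul_assoc, ← Units.val_mul, ← Units.val_mul, e]
  have hsum := hz.apply_zpow_mul_zpow f (hfinv x rfl) (hfinv l l_mul_x) p q
  have hfx : f (z x) = f (w x) := by
    rw [hw]
    simp only
    rw [map_sub, map_sub, hfinv x rfl, sub_self, sub_zero]
  have hfl : f (z l) = f (w l) := by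
    rw [hw]
    simp only
    rw [map_sub, map_sub, hfinv l l_mul_x, sub_self, sub_zero]
  rw [h0, map_zero, hfx, hfl, hf, hf, hwx, halfTurn_val, trace_fin_two, trace_fin_two] at hsum
  simp [Matrix.mul_apply, Fin.sum_univ_two, t2] at hsum
  have hmm := S.m_sq
  have hmd : S.m = S.z₁ * (1 - S.z₂) := rfl
  -- E1 is p du + q dv = 0 up to the factor -z₂(1 - z₂), with du = 2s and dv the variation of v; E2
  -- is the tangent equation of the curve. Eliminating the variation of z₂ leaves s times the
  -- expression in `period_ne_zero`.
  have E1 : -2 * s * p * (S.z₂ * (1 - S.z₂)) + 2 * q * (1 + S.z₂) * -(w y 1 0 * S.m) = 0 := by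
    linear_combination -(S.z₂ * (1 - S.z₂)) * hsum - q * t3
  have E2 : (S.z₁ + S.z₂ - 1) * -(w y 1 0 * S.m) +
      2 * s * (S.z₂ * (1 - S.z₂)) * (2 - S.z₁) = 0 := by
    linear_combination t1 - -(w y 1 0 * S.m) * (hmd - hmm) -
      2 * s * (S.z₂ * hmd + 2 * (1 - S.z₂) * hmm)
  have hs : s = 0 := by
    have : 2 * s * (S.z₂ * (1 - S.z₂)) *
        (-(p : ℂ) * (1 - S.z₁ - S.z₂) + 2 * q * ((2 - S.z₁) * (1 + S.z₂))) = 0 := by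
      linear_combination (1 - S.z₁ - S.z₂) * E1 + 2 * q * (1 + S.z₂) * E2
    have := (mul_eq_zero.1 this).resolve_right (S.period_ne_zero hpq)
    simpa [hz0, hz1] using this
  have hF : S.z₁ + S.z₂ - 1 ≠ 0 := fun h => by
    have e := congrArg Complex.im h
    have e1 := S.im_pos₁
    have e2 := S.im_pos₂
    simp at e
    linarith
  have f10 : w y 1 0 = 0 := by
    rw [hs] at E2
    simpa [hF, hm0] using E2
  have hzero : ∀ g, w g = 0 := fun g => by
    refine hwc.eq_zero_of_closure (s := {x, y}) ?_ (by rw [closure_generators]; trivial)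
    rintro g (rfl | rfl)
    · rw [hwx, hs]
      ext i j
      fin_cases i <;> fin_cases j <;> simp
    · ext i j
      fin_cases i <;> fin_cases j <;> simp [f00, f11, f10, hwy, hs]
  exact fun g => sub_eq_zero.1 (hzero g)

end DehnPoint

end FigEight

end

noncomputable section

namespace FigEight

open Matrix

/-! ### The isomorphism of `𝔰𝔩(2, ℂ)` and `𝔰𝔬(3, 1)` -/

/-- The infinitesimal action `H ↦ X H + H X*` on Hermitian matrices, in Lorentz coordinates. -/
def lieLin (X : Matrix (Fin 2) (Fin 2) ℂ) : (Fin 4 → ℝ) →ₗ[ℝ] (Fin 4 → ℝ) :=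
  coords ∘ₗ (LinearMap.mulLeft ℝ X + LinearMap.mulRight ℝ Xᴴ) ∘ₗ herm

theorem lieLin_apply (X : Matrix (Fin 2) (Fin 2) ℂ) (v : Fin 4 → ℝ) :
    lieLin X v = coords (X * herm v + herm v * Xᴴ) := by
  simp [lieLin]

theorem herm_lieLin (X : Matrix (Fin 2) (Fin 2) ℂ) (v : Fin 4 → ℝ) :
    herm (lieLin X v) = X * herm v + herm v * Xᴴ := by
  rw [lieLin_apply, herm_coords]
  simp [conjTranspose_mul, herm_isHermitian, add_comm]

/-- The derivative of `klein` at the identity. -/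
def lieMat (X : Matrix (Fin 2) (Fin 2) ℂ) : Matrix (Fin 4) (Fin 4) ℝ :=
  LinearMap.toMatrix' (lieLin X)

theorem lieMat_apply (X : Matrix (Fin 2) (Fin 2) ℂ) (i j : Fin 4) :
    lieMat X i j = coords (X * herm (Pi.single j 1) + herm (Pi.single j 1) * Xᴴ) i := by
  simp [lieMat, LinearMap.toMatrix'_apply, lieLin_apply]

/-- The identity g(XH + HX*)g* = (gXg⁻¹)(gHg*) + (gHg*)(gXg⁻¹)*, so the isomorphism of Lie algebras
is equivariant. -/
theorem lieMat_conj (g : GL (Fin 2) ℂ) (X : Matrix (Fin 2) (Fin 2) ℂ) :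
    kleinMat g * lieMat X * kleinMat g⁻¹ = lieMat (g.val * X * (g⁻¹).val) := by
  have h1 : lieMat (g.val * X * (g⁻¹).val) * kleinMat g = kleinMat g * lieMat X := by
    change _ * (‖g.val.det‖⁻¹ • LinearMap.toMatrix' (kleinLin g.val)) =
      (‖g.val.det‖⁻¹ • LinearMap.toMatrix' (kleinLin g.val)) * _
    rw [lieMat, lieMat, mul_smul_comm, smul_mul, ← LinearMap.toMatrix'_comp,
      ← LinearMap.toMatrix'_comp]
    congr 2
    refine LinearMap.ext fun v => ?_
    rw [LinearMap.comp_apply, LinearMap.comp_apply, lieLin_apply, herm_kleinLin, kleinLin_apply,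
      herm_lieLin]
    congr 1
    have e : gᴴ * ((g⁻¹).val)ᴴ = 1 := by
      rw [← conjTranspose_mul, Units.inv_mul, conjTranspose_one]
    rw [conjTranspose_mul, conjTranspose_mul, Matrix.mul_add, Matrix.add_mul]
    congr 1
    · calc _ = g.val * X * ((g⁻¹).val * g.val) * herm v * g.valᴴ := by
            simp only [Matrix.mul_assoc]
        _ = _ := by rw [Units.inv_mul, Matrix.mul_one]; simp only [Matrix.mul_assoc]
    · calc _ = g.val * herm v * (g.valᴴ * ((g⁻¹).val)ᴴ) * (Xᴴ * g.valᴴ) := by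
            simp only [Matrix.mul_assoc]
        _ = _ := by rw [e, Matrix.mul_one]; simp only [Matrix.mul_assoc]
  rw [← h1, Matrix.mul_assoc, ← map_mul, mul_inv_cancel, map_one, Matrix.mul_one]

/-- The inverse of `lieMat` on `𝔰𝔬(3, 1)`. -/
def lieInv (B : Matrix (Fin 4) (Fin 4) ℝ) : Matrix (Fin 2) (Fin 2) ℂ :=
  !![⟨-B 2 3 / 2, -B 0 1 / 2⟩, ⟨B 0 2 + B 0 3, B 1 2 + B 1 3⟩;
    ⟨(B 0 3 - B 0 2) / 4, (B 1 2 - B 1 3) / 4⟩, ⟨B 2 3 / 2, B 0 1 / 2⟩]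

theorem lieInv_add (B C : Matrix (Fin 4) (Fin 4) ℝ) : lieInv (B + C) = lieInv B + lieInv C := by
  ext i j
  fin_cases i <;> fin_cases j <;> apply Complex.ext <;> simp [lieInv] <;> ring

theorem trace_lieInv (B : Matrix (Fin 4) (Fin 4) ℝ) : (lieInv B).trace = 0 := by
  rw [trace_fin_two]
  apply Complex.ext <;> simp [lieInv] <;> ring

theorem lieInv_lieMat {X : Matrix (Fin 2) (Fin 2) ℂ} (hX : X.trace = 0) :
    lieInv (lieMat X) = X := by
  rw [trace_fin_two] at hX
  have h1 := congrArg Complex.re hX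
  have h2 := congrArg Complex.im hX
  simp at h1 h2
  ext i j
  fin_cases i <;> fin_cases j <;> apply Complex.ext <;>
    simp [lieInv, lieMat_apply, coords, herm, Matrix.mul_apply, vecMul, dotProduct,
      Fin.sum_univ_two] <;>
    linarith

theorem so31_apply {B : Matrix (Fin 4) (Fin 4) ℝ} (hB : B ∈ so31) (i j : Fin 4) :
    B j i * J j j = -(J i i * B i j) := by
  have := congrFun (congrFun hB.2 i) j
  simpa [J, mul_diagonal, diagonal_mul] using this

theorem lieMat_lieInv {B : Matrix (Fin 4) (Fin 4) ℝ} (hB : B ∈ so31) : lieMat (lieInv B) = B := by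
  have h := so31_apply hB
  have h00 := h 0 0
  have h11 := h 1 1
  have h22 := h 2 2
  have h33 := h 3 3
  have h01 := h 0 1
  have h02 := h 0 2
  have h03 := h 0 3
  have h12 := h 1 2
  have h13 := h 1 3
  have h23 := h 2 3
  simp [J] at h00 h11 h22 h33 h01 h02 h03 h12 h13 h23
  ext i j
  rw [lieMat_apply]
  fin_cases i <;> fin_cases j <;>
    simp [lieInv, coords, herm, vecMul, vecHead, vecTail] <;>
    linarith

theorem trace_lieMat {X : Matrix (Fin 2) (Fin 2) ℂ} (hX : X.trace = 0) : (lieMat X).trace = 0 := by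
  rw [trace_fin_two] at hX
  have h1 := congrArg Complex.re hX
  simp at h1
  simp only [Matrix.trace, Matrix.diag_apply, lieMat_apply, Fin.sum_univ_four]
  simp [herm, coords, Matrix.mul_apply, vecMul, dotProduct, Fin.sum_univ_two]
  linarith

/-! ### Infinitesimal projective rigidity of Dehn fillings -/

/-- The involution whose eigenspaces are `𝔰𝔬(3, 1)` and the self-adjoint matrices. -/
theorem ad_adjoint {G : Type} [Group G] (ρ : G →* O31) (g : G) (A : Matrix (Fin 4) (Fin 4) ℝ) :
    J * (ad ρ g A)ᵀ * J = ad ρ g (J * Aᵀ * J) := by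
  rw [ad_apply, ad_apply]
  set P := ((ρ g : GL (Fin 4) ℝ) : Matrix (Fin 4) (Fin 4) ℝ)
  set Q := (((ρ g)⁻¹ : O31) : GL (Fin 4) ℝ).val
  have hPQ : P * Q = 1 := val_mul_inv (ρ g)
  have hJ : Pᵀ * J * P = J := (ρ g).2
  have hJQ : Qᵀ * J * Q = J := ((ρ g)⁻¹ : O31).2
  have h1 : Pᵀ * J = J * Q := by
    calc Pᵀ * J = Pᵀ * J * (P * Q) := by rw [hPQ, Matrix.mul_one]
      _ = J * Q := by rw [← Matrix.mul_assoc, hJ]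
  have h2 : J * Qᵀ = P * J := by
    have h3 : Qᵀ * J = J * P := by
      calc Qᵀ * J = Qᵀ * J * (Q * P) := by rw [val_inv_mul (ρ g), Matrix.mul_one]
        _ = J * P := by rw [← Matrix.mul_assoc, hJQ]
    calc J * Qᵀ = J * (Qᵀ * J) * J := by
          rw [Matrix.mul_assoc, Matrix.mul_assoc, J_mul_J, Matrix.mul_one]
      _ = P * J := by rw [h3, ← Matrix.mul_assoc, J_mul_J, Matrix.one_mul]
  calc J * (P * A * Q)ᵀ * J = (J * Qᵀ) * Aᵀ * (Pᵀ * J) := by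
        simp only [transpose_mul, Matrix.mul_assoc]
    _ = P * (J * Aᵀ * J) * Q := by rw [h1, h2]; simp only [Matrix.mul_assoc]

namespace DehnPoint

variable (S : DehnPoint)

/-- Equivariance of `lieMat` carries the question to 𝔰𝔩(2, ℂ), where `sl2_coboundary_of_filling`
applies. -/
theorem so31_coboundary_of_filling {z : Pi1 → Matrix (Fin 4) (Fin 4) ℝ}
    (hz : IsCrossed (ad S.rho) z) (hso : ∀ g, z g ∈ so31) (hm : S.m ≠ 1) {p q : ℤ}
    (hpq : IsCoprime p q) (h0 : z (x ^ p * l ^ q) = 0) :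
    ∃ B : Matrix (Fin 4) (Fin 4) ℝ, B.trace = 0 ∧ ∀ g, z g = ad S.rho g B - B := by
  have hconj : ∀ g {B : Matrix (Fin 4) (Fin 4) ℝ}, B ∈ so31 →
      lieInv (ad S.rho g B) = conjRep S.hol g (lieInv B) := by
    intro g B hB
    conv_lhs => rw [← lieMat_lieInv hB]
    rw [ad_rho_apply, lieMat_conj, lieInv_lieMat, conjRep_apply]
    rw [← conjRep_apply, trace_conjRep, trace_lieInv]
  have hcr : IsCrossed (conjRep S.hol) (fun g => lieInv (z g)) := by
    intro g h
    simp only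
    rw [hz, lieInv_add, hconj g (hso h)]
  have hzero : lieInv (z (x ^ p * l ^ q)) = 0 := by
    have h := lieInv_add 0 0
    rw [add_zero, left_eq_add] at h
    rw [h0, h]
  obtain ⟨B, hB, hB'⟩ := S.sl2_coboundary_of_filling hcr (fun g => trace_lieInv _) hm hpq hzero
  refine ⟨lieMat B, trace_lieMat hB, fun g => ?_⟩
  have h1 : conjRep S.hol g B = lieInv (z g) + B := by
    rw [hB' g]
    abel
  have h2 : lieMat (conjRep S.hol g B) = z g + lieMat B := by
    rw [h1, lieMat, lieMat]
    have : lieLin (lieInv (z g) + B) = lieLin (lieInv (z g)) + lieLin B := by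
      refine LinearMap.ext fun v => ?_
      simp only [lieLin_apply, LinearMap.add_apply, Matrix.add_mul, conjTranspose_add,
        Matrix.mul_add, map_add]
      abel
    rw [this, map_add]
    congr 1
    exact lieMat_lieInv (hso g)
  rw [ad_rho_apply, lieMat_conj, ← conjRep_apply, h2]
  abel

/-- Crossed homomorphisms of the filled group pull back to crossed homomorphisms that vanish on
the filling slope. -/
theorem mk_slope (p q : ℤ) :
    (QuotientGroup.mk (x ^ p * l ^ q) : FillGroup p q) = 1 :=
  (QuotientGroup.eq_one_iff _).2 (Subgroup.subset_normalClosure rfl)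

/-- A cocycle of the quotient group pulls back to one that vanishes on the slope; a primitive found
upstairs also serves downstairs. -/
theorem subsingleton_H1_vRep_rhoFill {p q : ℤ}
    (h : (p : ℂ) * S.u + q * S.v = 2 * Real.pi * Complex.I)
    (hv : ∀ z : Pi1 → S.vu, IsCrossed S.vu.ρ z → z (x ^ p * l ^ q) = 0 →
      ∃ b : S.vu, ∀ g, z g = S.vu.ρ g b - b) :
    Subsingleton (groupCohomology.H1 (vRep (S.rhoFill p q h))) := by
  refine subsingleton_H1_of_forall fun z hz => ?_
  obtain ⟨b, hb⟩ := hv (fun g => z (QuotientGroup.mk g)) (fun g k => hz (QuotientGroup.mk g) (QuotientGroup.mk k))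
    (by rw [mk_slope]; exact hz.map_one)
  refine ⟨b, fun g => ?_⟩
  induction g using QuotientGroup.induction_on with
  | H g => exact hb g

/-- The involution A ↦ J Aᵀ J commutes with the action and splits a cocycle into a part in 𝔰𝔬(3,1)
and a self-adjoint part in 𝔳. The first is principal by rigidity in PSL(2, ℂ), the second by
assumption. -/
theorem infProjRigid_rhoFill {p q : ℤ} (hpq : IsCoprime p q)
    (h : (p : ℂ) * S.u + q * S.v = 2 * Real.pi * Complex.I)
    (hv : ∀ z : Pi1 → S.vu, IsCrossed S.vu.ρ z → z (x ^ p * l ^ q) = 0 →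
      ∃ b : S.vu, ∀ g, z g = S.vu.ρ g b - b) :
    InfProjRigid (S.rhoFill p q h) := by
  refine subsingleton_H1_of_forall fun z hz => ?_
  let z' : Pi1 → Matrix (Fin 4) (Fin 4) ℝ := fun g => (z (QuotientGroup.mk g) : sl4).1
  have hz' : IsCrossed (ad S.rho) z' := fun g k =>
    congrArg Subtype.val (hz (QuotientGroup.mk g) (QuotientGroup.mk k))
  have htr : ∀ g, (z' g).trace = 0 := fun g => (z (QuotientGroup.mk g) : sl4).2
  have hone : z' (x ^ p * l ^ q) = 0 := by
    have : z (QuotientGroup.mk (x ^ p * l ^ q)) = 0 := by rw [mk_slope]; exact hz.map_one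
    exact congrArg Subtype.val this
  have hadj : IsCrossed (ad S.rho) (fun g => J * (z' g)ᵀ * J) := fun g k => by
    simp only
    rw [hz', transpose_add, Matrix.mul_add, Matrix.add_mul, ad_adjoint]
  have hadjtr : ∀ g, (J * (z' g)ᵀ * J).trace = 0 := fun g => by
    rw [trace_mul_comm, ← Matrix.mul_assoc, J_mul_J, Matrix.one_mul, trace_transpose, htr]
  have hJJ : ∀ A : Matrix (Fin 4) (Fin 4) ℝ, J * (J * Aᵀ * J)ᵀ * J = A := fun A => by
    rw [transpose_mul, transpose_mul, transpose_transpose, J_transpose]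
    calc J * (J * (A * J)) * J = (J * J) * A * (J * J) := by simp only [Matrix.mul_assoc]
      _ = A := by rw [J_mul_J, Matrix.one_mul, Matrix.mul_one]
  -- the two components
  have hs : IsCrossed (ad S.rho) (fun g => (2⁻¹ : ℝ) • (z' g - J * (z' g)ᵀ * J)) :=
    (hz'.sub hadj).smul _
  obtain ⟨B, hB, hB'⟩ := S.so31_coboundary_of_filling hs (fun g => by
    refine so31.smul_mem _ ⟨by rw [trace_sub, htr, hadjtr, sub_zero], ?_⟩
    have e := hJJ (z' g)
    rw [transpose_sub, Matrix.sub_mul, Matrix.mul_sub]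
    have e1 : (J * (z' g)ᵀ * J)ᵀ * J = J * z' g := by
      calc _ = (J * J) * (J * (z' g)ᵀ * J)ᵀ * J := by rw [J_mul_J, Matrix.one_mul]
        _ = J * (J * (J * (z' g)ᵀ * J)ᵀ * J) := by simp only [Matrix.mul_assoc]
        _ = J * z' g := by rw [e]
    have e2 : J * (J * (z' g)ᵀ * J) = (z' g)ᵀ * J := by
      rw [Matrix.mul_assoc, ← Matrix.mul_assoc J J, J_mul_J, Matrix.one_mul]
    rw [e1, e2]
    abel) (S.m_ne_one h) hpq (by simp [hone])
  let zv : Pi1 → S.vu := fun g => (⟨(2⁻¹ : ℝ) • (z' g + J * (z' g)ᵀ * J), by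
    refine vMod.smul_mem _ (mem_vMod_of_selfAdjoint
      (by rw [trace_add, htr, hadjtr, add_zero]) ?_)
    rw [transpose_add, Matrix.mul_add, Matrix.add_mul, hJJ, add_comm]⟩ : vMod)
  obtain ⟨C, hC⟩ := hv zv (fun g k => by
    apply Subtype.ext
    change (2⁻¹ : ℝ) • (z' (g * k) + J * (z' (g * k))ᵀ * J) =
      ad S.rho g ((2⁻¹ : ℝ) • (z' k + J * (z' k)ᵀ * J)) + (2⁻¹ : ℝ) • (z' g + J * (z' g)ᵀ * J)
    rw [hz', transpose_add, Matrix.mul_add, Matrix.add_mul, ad_adjoint, map_smul, map_add,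
      ← smul_add]
    congr 1
    abel) (by
    apply Subtype.ext
    change (2⁻¹ : ℝ) • (z' (x ^ p * l ^ q) + J * (z' (x ^ p * l ^ q))ᵀ * J) = 0
    simp [hone])
  have hC' : ∀ g, (2⁻¹ : ℝ) • (z' g + J * (z' g)ᵀ * J) =
      ad S.rho g (C : vMod).1 - (C : vMod).1 := fun g => congrArg Subtype.val (hC g)
  refine ⟨(⟨B + (C : vMod).1, sl4.add_mem hB (C : vMod).2.1⟩ : sl4), fun g => ?_⟩
  induction g using QuotientGroup.induction_on with
  | H g =>
    apply Subtype.ext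
    change z' g = ad S.rho g (B + (C : vMod).1) - (B + (C : vMod).1)
    have e : z' g = (2⁻¹ : ℝ) • (z' g - J * (z' g)ᵀ * J) +
        (2⁻¹ : ℝ) • (z' g + J * (z' g)ᵀ * J) := by module
    rw [e, hB' g, hC' g, map_add]
    abel

end DehnPoint

end FigEight

end

noncomputable section

namespace FigEight

open Matrix Topology

/-! ### Smooth families of singular operators -/

section Bordered

variable {E : Type*} [NormedAddCommGroup E] [NormedSpace ℝ E] [FiniteDimensional ℝ E]

/-- A smooth family of operators with one-dimensional kernel at a point has kernels of dimension at
most one nearby, and a smooth right inverse on the range where the kernel is non-trivial. -/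
theorem exists_smooth_solution {T : ℂ → E →L[ℝ] E} {V : Set ℂ} (hV : IsOpen V)
    (hT : ContDiffOn ℝ ∞ T V) {u₀ : ℂ} (hu₀ : u₀ ∈ V)
    (hk : Module.finrank ℝ (LinearMap.ker (T u₀).toLinearMap) = 1) :
    ∃ W ⊆ V, IsOpen W ∧ u₀ ∈ W ∧ ∃ R : ℂ → E →L[ℝ] E, ContDiffOn ℝ ∞ R W ∧
      ∀ u ∈ W, Module.finrank ℝ (LinearMap.ker (T u).toLinearMap) ≤ 1 ∧
        ((∃ e, e ≠ 0 ∧ T u e = 0) → ∀ c, T u (R u (T u c)) = T u c) := by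
  have : CompleteSpace E := FiniteDimensional.complete ℝ E
  obtain ⟨⟨κ, hκ⟩, hκ0, hspan⟩ := finrank_eq_one_iff'.1 hk
  have hκ0' : κ ≠ 0 := fun h => hκ0 (Subtype.ext h)
  have not_top : ∀ u, (∃ e, e ≠ 0 ∧ T u e = 0) → ∃ η, ∀ e, T u e ≠ η := by
    rintro u ⟨e, he, hTe⟩
    by_contra! hcon
    have hsurj : Function.Surjective (T u).toLinearMap := hcon
    have hinj := LinearMap.injective_iff_surjective.2 hsurj
    exact he (hinj (by simpa using hTe))
  obtain ⟨ψ, hψ⟩ := SeparatingDual.exists_ne_zero (R := ℝ) hκ0'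
  obtain ⟨η, hη⟩ := not_top u₀ ⟨κ, hκ0', hκ⟩
  -- Since ψ(κ) ≠ 0 and η is outside the image of T at the base point, this rank-one correction
  -- makes the operator invertible there, hence on an open set.
  let B : ℂ → E →L[ℝ] E := fun u => T u + ψ.smulRight η
  have hBapp : ∀ u e, B u e = T u e + ψ e • η := fun u e => by simp [B]
  have hB : ContDiffOn ℝ ∞ B V := hT.add contDiffOn_const
  have hunit : IsUnit (B u₀) := by
    have hinj : Function.Injective (B u₀).toLinearMap := by
      rw [injective_iff_map_eq_zero]
      intro e he
      have he' : T u₀ e + ψ e • η = 0 := by rw [← hBapp]; exact he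
      have h1 : ψ e = 0 := by
        by_contra h1
        apply hη (-((ψ e)⁻¹ • e))
        rw [map_neg, map_smul, eq_neg_of_add_eq_zero_left he', smul_neg, neg_neg, smul_smul,
          inv_mul_cancel₀ h1, one_smul]
      rw [h1, zero_smul, add_zero] at he'
      obtain ⟨c, hc⟩ := hspan ⟨e, he'⟩
      have hc' : c • κ = e := congrArg Subtype.val hc
      rw [← hc', map_smul, smul_eq_mul] at h1
      rw [← hc', (mul_eq_zero.1 h1).resolve_right hψ, zero_smul]
    exact ContinuousLinearMap.isUnit_iff_bijective.2
      ⟨hinj, LinearMap.injective_iff_surjective.1 hinj⟩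
  refine ⟨V ∩ B ⁻¹' {b | IsUnit b}, Set.inter_subset_left,
    hB.continuousOn.isOpen_inter_preimage hV Units.isOpen, ⟨hu₀, hunit⟩,
    fun u => Ring.inverse (B u), ?_, ?_⟩
  · rintro u ⟨hu, ⟨b, hb⟩⟩
    have h1 : ContDiffAt ℝ ∞ Ring.inverse (B u) := by
      rw [← hb]
      exact contDiffAt_ringInverse ℝ b
    exact h1.comp_contDiffWithinAt u ((hB u hu).mono Set.inter_subset_left)
  · rintro u ⟨hu, hb⟩
    have hbij := ContinuousLinearMap.isUnit_iff_bijective.1 hb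
    constructor
    -- On ker T ∩ ker ψ the invertible operator B vanishes, so ψ embeds ker T in ℝ.
    · have hinj : Function.Injective
          (ψ.toLinearMap ∘ₗ (LinearMap.ker (T u).toLinearMap).subtype) := by
        rw [injective_iff_map_eq_zero]
        rintro ⟨e, he⟩ h0
        have he' : T u e = 0 := he
        have h0' : ψ e = 0 := h0
        apply Subtype.ext
        apply hbij.1
        simp [hBapp, he', h0']
      simpa using LinearMap.finrank_le_finrank_of_injective hinj
    · intro hex c
      set β := Ring.inverse (B u) (T u c) with hβ
      have h1 : B u β = T u c := by
        have := Ring.mul_inverse_cancel _ hb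
        exact congrArg (fun f : E →L[ℝ] E => f (T u c)) this
      rw [hBapp] at h1
      -- Otherwise T(c - β) = ψ(β)η puts η in the image of T. The image of B, which is everything,
      -- would lie there too, contradicting the non-trivial kernel.
      have h2 : ψ β = 0 := by
        by_contra h2
        obtain ⟨ξ, hξ⟩ := not_top u hex
        obtain ⟨e, he⟩ := hbij.2 ξ
        rw [hBapp] at he
        apply hξ (e + (ψ e * (ψ β)⁻¹) • (c - β))
        have h3 : T u (c - β) = ψ β • η := by rw [map_sub, ← h1]; abel
        rw [map_add, map_smul, h3, smul_smul, mul_assoc, inv_mul_cancel₀ h2, mul_one, he]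
      rw [h2, zero_smul, add_zero] at h1
      exact h1

end Bordered

/-! ### The holonomy as a smooth family -/

/-- The representation of the free group with parameters `m = exp u` and `z`. -/
def freeHol (u z : ℂ) : FreeGroup (Fin 2) →* GL (Fin 2) ℂ :=
  FreeGroup.lift ![GeneralLinearGroup.mkOfDetNeZero !![1, -1; 0, Complex.exp u] (by
      simp [det_fin_two]),
    GeneralLinearGroup.mkOfDetNeZero !![Complex.exp u, 0; -z, 1] (by simp [det_fin_two])]

/-- On the free group m and z₂ need not satisfy the curve equation, so the family is defined for all
parameters and specialises to the holonomy at each point of Dehn filling space. -/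
theorem DehnPoint.freeHol_eq (S : DehnPoint) : freeHol S.u S.z₂ = S.hol.comp proj := by
  refine FreeGroup.ext_hom _ _ fun i => ?_
  fin_cases i
  · apply Units.ext
    change _ = (S.hol x).val
    rw [S.hol_x, S.matX_val]
    simp [freeHol, S.exp_u, GeneralLinearGroup.mkOfDetNeZero]
  · apply Units.ext
    change _ = (S.hol y).val
    rw [S.hol_y, S.matY_val]
    simp [freeHol, S.exp_u, GeneralLinearGroup.mkOfDetNeZero]

section Smooth

variable {V : Set ℂ}

theorem contDiffOn_coords {G : ℂ → Matrix (Fin 2) (Fin 2) ℂ}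
    (hG : ∀ i j, ContDiffOn ℝ ∞ (fun u => G u i j) V) (H : Matrix (Fin 2) (Fin 2) ℂ) (i : Fin 4) :
    ContDiffOn ℝ ∞ (fun u => coords (G u * H * (G u)ᴴ) i) V := by
  have hconj : ∀ i j, ContDiffOn ℝ ∞ (fun u => (starRingEnd ℂ) (G u i j)) V := fun i j =>
    Complex.conjCLE.contDiff.comp_contDiffOn (hG i j)
  have hM : ∀ a b, ContDiffOn ℝ ∞ (fun u => (G u * H * (G u)ᴴ) a b) V := by
    intro a b
    simp only [Matrix.mul_apply, conjTranspose_apply]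
    exact ContDiffOn.sum fun k _ => (ContDiffOn.sum fun k' _ =>
      (hG a k').mul contDiffOn_const).mul (hconj b k)
  have hre : ∀ a b, ContDiffOn ℝ ∞ (fun u => ((G u * H * (G u)ᴴ) a b).re) V := fun a b =>
    Complex.reCLM.contDiff.comp_contDiffOn (hM a b)
  have him : ∀ a b, ContDiffOn ℝ ∞ (fun u => ((G u * H * (G u)ᴴ) a b).im) V := fun a b =>
    Complex.imCLM.contDiff.comp_contDiffOn (hM a b)
  fin_cases i
  · exact contDiffOn_const.mul (hre 0 1)
  · exact contDiffOn_const.mul (him 0 1)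
  · exact (contDiffOn_const.mul (hre 1 1)).sub (hre 0 0)
  · exact (contDiffOn_const.mul (hre 1 1)).add (hre 0 0)

theorem contDiffOn_kleinMat {G : ℂ → GL (Fin 2) ℂ}
    (hG : ∀ i j, ContDiffOn ℝ ∞ (fun u => (G u).val i j) V)
    (hd : ContDiffOn ℝ ∞ (fun u => ‖(G u).val.det‖) V) (i j : Fin 4) :
    ContDiffOn ℝ ∞ (fun u => kleinMat (G u) i j) V := by
  simp only [kleinMat_apply]
  refine ContDiffOn.mul (hd.inv fun u _ => ?_) (contDiffOn_coords hG _ i)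
  exact norm_ne_zero_iff.2 (by simpa using (G u).det.ne_zero)

theorem contDiff_exp_real : ContDiff ℝ ∞ Complex.exp :=
  (Complex.contDiff_exp (𝕜 := ℂ)).restrict_scalars ℝ

/-- The inverse of an isometry is its Lorentz adjoint, which makes its entries smooth without a
division. -/
theorem kleinMat_inv (g : GL (Fin 2) ℂ) : kleinMat g⁻¹ = J * (kleinMat g)ᵀ * J := by
  have h : kleinMat g * kleinMat g⁻¹ = 1 := by rw [← map_mul, mul_inv_cancel, map_one]
  have h2 : J * (kleinMat g)ᵀ * J * kleinMat g = 1 := by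
    rw [Matrix.mul_assoc, Matrix.mul_assoc, ← Matrix.mul_assoc _ J, kleinMat_isometry, J_mul_J]
  exact (left_inv_eq_right_inv h2 h).symm

theorem contDiffOn_freeHol {ζ : ℂ → ℂ} (hζ : ContDiffOn ℝ ∞ ζ V) (g : FreeGroup (Fin 2))
    (i j : Fin 4) : ContDiffOn ℝ ∞ (fun u => kleinMat (freeHol u (ζ u) g) i j) V := by
  have hexp : ContDiffOn ℝ ∞ Complex.exp V := contDiff_exp_real.contDiffOn
  -- The norm is not smooth at 0, but ‖exp u‖ = exp(Re u) is.
  have hnorm : ContDiffOn ℝ ∞ (fun u => ‖Complex.exp u‖) V := by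
    simp only [Complex.norm_exp]
    exact (Real.contDiff_exp.comp Complex.reCLM.contDiff).contDiffOn
  have hof : ∀ (k : Fin 2) (i j : Fin 4),
      ContDiffOn ℝ ∞ (fun u => kleinMat (freeHol u (ζ u) (FreeGroup.of k)) i j) V := by
    intro k
    apply contDiffOn_kleinMat
    · intro a b
      fin_cases k <;> fin_cases a <;> fin_cases b <;>
        simp [freeHol, GeneralLinearGroup.mkOfDetNeZero] <;>
        first | exact contDiffOn_const | exact hexp | exact hζ.neg
    · fin_cases k <;> simpa [freeHol, GeneralLinearGroup.mkOfDetNeZero, det_fin_two] using hnorm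
  induction g using FreeGroup.induction_on generalizing i j with
  | C1 =>
    simp only [map_one]
    exact contDiffOn_const
  | of k => exact hof k i j
  | inv_of k _ =>
    simp only [map_inv, kleinMat_inv, J, Matrix.mul_diagonal, Matrix.diagonal_mul,
      transpose_apply]
    exact (contDiffOn_const.mul (hof k j i)).mul contDiffOn_const
  | mul g h hg hh =>
    simp only [map_mul, Matrix.mul_apply]
    exact ContDiffOn.sum fun k _ => (hg i k).mul (hh k j)

/-- The family of representations of the free group in the Lorentz group. -/
def freeRho (u z : ℂ) : FreeGroup (Fin 2) →* O31 := klein.comp (freeHol u z)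

/-- The action of the group ring of the free group on `𝔳` through a homomorphism to the Lorentz
group. -/
def lorentzAction (ρ : FreeGroup (Fin 2) →* O31) :
    MonoidAlgebra ℤ (FreeGroup (Fin 2)) →ₐ[ℤ] Module.End ℝ vMod :=
  groupRingAction ((ad ρ).subrepresentation vMod (vMod_le_comap ρ))

/-- The operators by which the group ring of the free group acts on `𝔳`. -/
def freeAction (u z : ℂ) : MonoidAlgebra ℤ (FreeGroup (Fin 2)) →ₐ[ℤ] Module.End ℝ vMod :=
  lorentzAction (freeRho u z)

theorem contDiffOn_freeAction_apply {ζ : ℂ → ℂ} (hζ : ContDiffOn ℝ ∞ ζ V)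
    (r : MonoidAlgebra ℤ (FreeGroup (Fin 2))) (A : vMod) (i j : Fin 4) :
    ContDiffOn ℝ ∞ (fun u => (freeAction u (ζ u) r A).1 i j) V := by
  induction r using MonoidAlgebra.induction_on generalizing i j with
  | of g =>
    have e : ∀ u, (freeAction u (ζ u) (MonoidAlgebra.of ℤ _ g) A).1 =
        kleinMat (freeHol u (ζ u) g) * A.1 * kleinMat (freeHol u (ζ u) g⁻¹) := by
      intro u
      rw [freeAction, lorentzAction, groupRingAction, MonoidAlgebra.lift_of]
      refine (ad_apply (freeRho u (ζ u)) g A.1).trans ?_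
      rw [← map_inv]
      rfl
    simp only [e, Matrix.mul_apply]
    exact ContDiffOn.sum fun k _ => (ContDiffOn.sum fun k' _ =>
      (contDiffOn_freeHol hζ g i k').mul contDiffOn_const).mul (contDiffOn_freeHol hζ g⁻¹ k j)
  | add r s hr hs =>
    simp only [map_add, LinearMap.add_apply, Submodule.coe_add, Matrix.add_apply]
    exact (hr i j).add (hs i j)
  | smul n r hr =>
    have e : ∀ u, (freeAction u (ζ u) (n • r) A).1 i j = (n : ℝ) *
        (freeAction u (ζ u) r A).1 i j := by
      intro u
      rw [map_zsmul, ← Int.cast_smul_eq_zsmul ℝ]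
      rfl
    simp only [e]
    exact contDiffOn_const.mul (hr i j)

/-- Coordinates on `𝔳`. -/
def vCoord : vMod ≃ₗ[ℝ] (Fin (Module.finrank ℝ vMod) → ℝ) := (Module.finBasis ℝ vMod).equivFun

/-- A linear left inverse P of the inclusion of 𝔳 expresses coordinates as fixed linear combinations
of matrix entries. -/
theorem contDiffOn_vCoord {f : ℂ → vMod} (hf : ∀ i j, ContDiffOn ℝ ∞ (fun u => (f u).1 i j) V) :
    ContDiffOn ℝ ∞ (fun u => vCoord (f u)) V := by
  obtain ⟨P, hP⟩ := LinearMap.exists_leftInverse_of_injective vMod.subtype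
    (LinearMap.ker_eq_bot.2 vMod.injective_subtype)
  have hP' : ∀ A : vMod, P A.1 = A := fun A => congrArg (fun g : vMod →ₗ[ℝ] vMod => g A) hP
  rw [contDiffOn_pi]
  intro k
  have e : ∀ u, vCoord (f u) k = ∑ i, ∑ j, (f u).1 i j *
      vCoord (P (Matrix.single i j 1)) k := by
    intro u
    conv_lhs => rw [← hP' (f u), matrix_eq_sum_single (f u).1]
    simp only [map_sum, Finset.sum_apply]
    refine Finset.sum_congr rfl fun i _ => Finset.sum_congr rfl fun j _ => ?_
    have : Matrix.single i j ((f u).1 i j) = (f u).1 i j • Matrix.single i j (1 : ℝ) := by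
      rw [smul_single, smul_eq_mul, mul_one]
    rw [this, map_smul, map_smul, Pi.smul_apply, smul_eq_mul]
  simp only [e]
  exact ContDiffOn.sum fun i _ => ContDiffOn.sum fun j _ => (hf i j).mul contDiffOn_const

theorem contDiffOn_vCoord_symm {f : ℂ → Fin (Module.finrank ℝ vMod) → ℝ}
    (hf : ContDiffOn ℝ ∞ f V) (i j : Fin 4) :
    ContDiffOn ℝ ∞ (fun u => (vCoord.symm (f u)).1 i j) V := by
  let F : (Fin (Module.finrank ℝ vMod) → ℝ) →ₗ[ℝ] ℝ :=
    Matrix.entryLinearMap ℝ ℝ i j ∘ₗ vMod.subtype ∘ₗ vCoord.symm.toLinearMap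
  exact (LinearMap.toContinuousLinearMap F).contDiff.comp_contDiffOn hf

theorem contDiffOn_conj_vCoord {T : ℂ → Module.End ℝ vMod}
    (hT : ∀ A i j, ContDiffOn ℝ ∞ (fun u => (T u A).1 i j) V) :
    ContDiffOn ℝ ∞ (fun u => LinearMap.toContinuousLinearMap (vCoord.conj (T u))) V :=
  contDiffOn_clm_apply.2 fun e => contDiffOn_vCoord fun i j => hT (vCoord.symm e) i j

theorem contDiffOn_apply_vMod {T : ℂ → Module.End ℝ vMod}
    (hT : ∀ A i j, ContDiffOn ℝ ∞ (fun u => (T u A).1 i j) V) {f : ℂ → vMod}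
    (hf : ∀ i j, ContDiffOn ℝ ∞ (fun u => (f u).1 i j) V) (i j : Fin 4) :
    ContDiffOn ℝ ∞ (fun u => (T u (f u)).1 i j) V := by
  have h := contDiffOn_vCoord_symm ((contDiffOn_conj_vCoord hT).clm_apply (contDiffOn_vCoord hf))
    i j
  have e : ∀ u, vCoord.symm (LinearMap.toContinuousLinearMap (vCoord.conj (T u))
      (vCoord (f u))) = T u (f u) := by
    intro u
    rw [LinearMap.coe_toContinuousLinearMap', LinearEquiv.conj_apply_apply,
      LinearEquiv.symm_apply_apply, LinearEquiv.symm_apply_apply]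
  simpa only [e] using h

theorem exists_smooth_solution_vMod {T : ℂ → Module.End ℝ vMod} (hV : IsOpen V)
    (hT : ∀ A i j, ContDiffOn ℝ ∞ (fun u => (T u A).1 i j) V) {u₀ : ℂ} (hu₀ : u₀ ∈ V)
    (hk : Module.finrank ℝ (LinearMap.ker (T u₀)) = 1) :
    ∃ W ⊆ V, IsOpen W ∧ u₀ ∈ W ∧ ∃ R : ℂ → Module.End ℝ vMod,
      (∀ f : ℂ → vMod, (∀ i j, ContDiffOn ℝ ∞ (fun u => (f u).1 i j) W) →
        ∀ i j, ContDiffOn ℝ ∞ (fun u => (R u (f u)).1 i j) W) ∧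
      ∀ u ∈ W, Module.finrank ℝ (LinearMap.ker (T u)) ≤ 1 ∧
        ((∃ e, e ≠ 0 ∧ T u e = 0) → ∀ c, T u (R u (T u c)) = T u c) := by
  let E := Fin (Module.finrank ℝ vMod) → ℝ
  let T' : ℂ → E →L[ℝ] E := fun u => LinearMap.toContinuousLinearMap (vCoord.conj (T u))
  have happ : ∀ u e, T' u e = vCoord (T u (vCoord.symm e)) := fun u e => rfl
  have hT' : ContDiffOn ℝ ∞ T' V := contDiffOn_conj_vCoord hT
  have hker : ∀ u, Module.finrank ℝ (LinearMap.ker (T' u).toLinearMap) =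
      Module.finrank ℝ (LinearMap.ker (T u)) := by
    intro u
    have : LinearMap.ker (T' u).toLinearMap =
        (LinearMap.ker (T u)).map vCoord.toLinearMap := by
      ext e
      rw [LinearMap.mem_ker, Submodule.mem_map]
      constructor
      · intro h
        refine ⟨vCoord.symm e, ?_, by simp⟩
        exact vCoord.injective (h.trans (map_zero _).symm)
      · rintro ⟨A, hA, rfl⟩
        have hA' : T u A = 0 := hA
        change T' u (vCoord A) = 0
        rw [happ, LinearEquiv.symm_apply_apply, hA', map_zero]
    rw [this, LinearEquiv.finrank_map_eq]
  obtain ⟨W, hWV, hW, huW, R, hR, h⟩ := exists_smooth_solution hV hT' hu₀ (by rw [hker, hk])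
  refine ⟨W, hWV, hW, huW, fun u => vCoord.symm.conj (R u).toLinearMap, ?_, ?_⟩
  · intro f hf i j
    exact contDiffOn_vCoord_symm (hR.clm_apply (contDiffOn_vCoord hf)) i j
  · intro u hu
    obtain ⟨h1, h2⟩ := h u hu
    refine ⟨by rw [← hker]; exact h1, ?_⟩
    rintro ⟨e, he, hTe⟩ c
    have h3 := h2 ⟨vCoord e, by simpa using he, by
      rw [happ, LinearEquiv.symm_apply_apply, hTe, map_zero]⟩ (vCoord c)
    simp only [happ, LinearEquiv.symm_apply_apply] at h3
    exact vCoord.injective h3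

end Smooth

/-! ### The shape as a function of the complex length -/

namespace DehnPoint

variable (S : DehnPoint)

/-- The difference of the two roots of the curve equation. -/
def rootDiff : ℂ := S.z₁ + S.z₂ - 1

/-- This sign distinguishes the geometric root of the curve equation from the other one. -/
theorem rootDiff_im_pos : 0 < S.rootDiff.im := by
  have h1 := S.im_pos₁
  have h2 := S.im_pos₂
  simp only [rootDiff, Complex.sub_im, Complex.add_im, Complex.one_im]
  linarith

theorem rootDiff_ne_zero : S.rootDiff ≠ 0 := fun h => by
  have := S.rootDiff_im_pos
  rw [h] at this
  simp at this

theorem z₂_eq : S.z₂ = (S.m ^ 2 - S.m + 1 + S.rootDiff) / 2 := by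
  have h1 := S.m_sq
  have h2 : S.m = S.z₁ * (1 - S.z₂) := rfl
  rw [rootDiff]
  linear_combination (-1 / 2) * h1 + (1 / 2) * h2

theorem rootDiff_sq : S.rootDiff ^ 2 = (S.m ^ 2 - S.m + 1) ^ 2 - 4 * S.m ^ 2 := by
  have hc := S.curve
  have h : S.rootDiff = 2 * S.z₂ - (S.m ^ 2 - S.m + 1) := by
    linear_combination -2 * S.z₂_eq
  rw [h]
  linear_combination 4 * hc

/-- Locally the shape `z₂` is a smooth function of `u`. -/
theorem exists_smooth_shape (hm : S.m ≠ 1) :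
    ∃ V : Set ℂ, IsOpen V ∧ S.u ∈ V ∧ (∀ u ∈ V, Complex.exp u ≠ 1) ∧
      ∃ ζ : ℂ → ℂ, ContDiffOn ℝ ∞ ζ V ∧ ∀ S' : DehnPoint, S'.u ∈ V → S'.z₂ = ζ S'.u := by
  let disc : ℂ → ℂ := fun u =>
    (Complex.exp u ^ 2 - Complex.exp u + 1) ^ 2 - 4 * Complex.exp u ^ 2
  -- The quotient equals 1 at the base point, so the principal logarithm defines a smooth square
  -- root nearby, equal there to the chosen root difference.
  let q : ℂ → ℂ := fun u => disc u / S.rootDiff ^ 2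
  let r : ℂ → ℂ := fun u => S.rootDiff * Complex.exp (Complex.log (q u) / 2)
  have hd0 : S.rootDiff ^ 2 ≠ 0 := pow_ne_zero 2 S.rootDiff_ne_zero
  have hexp : ContDiff ℂ ∞ Complex.exp := Complex.contDiff_exp
  have hdisc : ContDiff ℂ ∞ disc :=
    ((((hexp.pow 2).sub hexp).add contDiff_const).pow 2).sub (contDiff_const.mul (hexp.pow 2))
  have hq : ContDiff ℂ ∞ q := hdisc.div_const _
  have hr : ∀ u, q u ∈ Complex.slitPlane → ContDiffAt ℂ ∞ r u := fun u hu =>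
    contDiffAt_const.mul (hexp.contDiffAt.comp u
      (((Complex.contDiffAt_log hu).comp u hq.contDiffAt).div_const 2))
  have hq0 : q S.u = 1 := by
    simp only [q, disc, S.exp_u]
    rw [← S.rootDiff_sq, div_self hd0]
  have hq0' : q S.u ∈ Complex.slitPlane := by rw [hq0]; exact Complex.one_mem_slitPlane
  have hr0 : r S.u = S.rootDiff := by simp [r, hq0]
  have ev1 : ∀ᶠ u in 𝓝 S.u, q u ∈ Complex.slitPlane :=
    hq.continuous.continuousAt.eventually_mem (Complex.isOpen_slitPlane.mem_nhds hq0')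
  have ev2 : ∀ᶠ u in 𝓝 S.u, 0 < (r u).im := by
    have hc : ContinuousAt (fun u => (r u).im) S.u :=
      Complex.continuous_im.continuousAt.comp (hr S.u hq0').continuousAt
    refine hc.eventually_const_lt ?_
    simp only [hr0]
    exact S.rootDiff_im_pos
  have ev3 : ∀ᶠ u in 𝓝 S.u, Complex.exp u ≠ 1 :=
    Complex.continuous_exp.continuousAt.eventually_ne (by rw [S.exp_u]; exact hm)
  obtain ⟨V, hVsub, hV, huV⟩ := eventually_nhds_iff.1 (ev1.and (ev2.and ev3))
  refine ⟨V, hV, huV, fun u hu => (hVsub u hu).2.2,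
    fun u => (Complex.exp u ^ 2 - Complex.exp u + 1 + r u) / 2, ?_, ?_⟩
  · intro u hu
    refine ContDiffAt.contDiffWithinAt (ContDiffAt.restrict_scalars (𝕜' := ℂ) ℝ ?_)
    exact (((((hexp.pow 2).sub hexp).add contDiff_const).contDiffAt).add
      (hr u (hVsub u hu).1)).div_const 2
  · intro S' hS'
    have h1 : r S'.u ^ 2 = S'.rootDiff ^ 2 := by
      have hne : q S'.u ≠ 0 := Complex.slitPlane_ne_zero (hVsub _ hS').1
      have e : Complex.exp (Complex.log (q S'.u) / 2) ^ 2 = q S'.u := by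
        rw [← Complex.exp_nat_mul]
        have : ((2 : ℕ) : ℂ) * (Complex.log (q S'.u) / 2) = Complex.log (q S'.u) := by
          push_cast
          ring
        rw [this, Complex.exp_log hne]
      simp only [r]
      rw [mul_pow, e, S'.rootDiff_sq]
      simp only [q, disc, S'.exp_u]
      rw [mul_div_cancel₀ _ hd0]
    have h2 : r S'.u = S'.rootDiff := by
      rcases sq_eq_sq_iff_eq_or_eq_neg.1 h1 with h | h
      · exact h
      · have h3 := (hVsub _ hS').2.1
        have h4 := S'.rootDiff_im_pos
        rw [h, Complex.neg_im] at h3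
        linarith
    simp only [S'.exp_u, h2]
    exact S'.z₂_eq

end DehnPoint

end FigEight

end

noncomputable section

namespace FigEight

open Matrix Topology

/-! ### Normalized cocycles and slopes -/

namespace DehnPoint

variable (S : DehnPoint)

theorem mem_torusInv_of_fix {α : S.vu} (hx : S.vu.ρ x α = α) (hl : S.vu.ρ l α = α) :
    α ∈ S.torusInv := by
  rw [torusInv, Representation.mem_invariants]
  intro g
  have h := (IsCrossed.coboundary S.vu.ρ α).eq_zero_of_closure (s := {x, l}) (by
    rintro g (rfl | rfl)
    · exact sub_eq_zero.2 hx
    · exact sub_eq_zero.2 hl) g.2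
  exact sub_eq_zero.1 h

theorem fix_of_mem_torusInv {α : S.vu} (h : α ∈ S.torusInv) :
    S.vu.ρ x α = α ∧ S.vu.ρ l α = α := by
  rw [torusInv, Representation.mem_invariants] at h
  exact ⟨h ⟨x, Subgroup.subset_closure (by simp)⟩, h ⟨l, Subgroup.subset_closure (by simp)⟩⟩

theorem span_perInv {f : S.vu →ₗ[ℝ] ℝ} (h : Peripheral S.vu S.perInv f) :
    Submodule.span ℝ {S.perInv} = S.torusInv := by
  apply le_antisymm
  · rw [Submodule.span_singleton_le_iff_mem]
    exact S.mem_torusInv_of_fix h.fix_x h.fix_l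
  · intro b hb
    obtain ⟨μ, rfl⟩ := h.exists_smul_of_fix_x (S.fix_of_mem_torusInv hb).1
    exact Submodule.smul_mem _ _ (Submodule.mem_span_singleton_self _)

/-- Any basis of the peripheral invariants provides peripheral data. -/
theorem peripheral_of_span {α : S.vu} {f : S.vu →ₗ[ℝ] ℝ} (h : Peripheral S.vu S.perInv f)
    (hα : α ≠ 0) (hspan : Submodule.span ℝ {α} = S.torusInv) : Peripheral S.vu α f := by
  have hmem : α ∈ S.torusInv := by rw [← hspan]; exact Submodule.mem_span_singleton_self _
  obtain ⟨hx, hl⟩ := S.fix_of_mem_torusInv hmem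
  obtain ⟨μ, rfl⟩ := h.exists_smul_of_fix_x hx
  have hμ : μ ≠ 0 := fun h0 => hα (by rw [h0, zero_smul])
  exact
    { h with
      fix_x := hx
      fix_l := hl
      move_y := fun hy => h.move_y (by
        rw [map_smul] at hy
        exact smul_right_injective _ hμ hy)
      detect := by
        rw [map_smul, smul_eq_mul]
        exact mul_ne_zero hμ h.detect }

open groupCohomology in
theorem isSlope_inv {α : S.vu} {f : S.vu →ₗ[ℝ] ℝ} (h : Peripheral S.vu α f)
    {z : cocycles₁ S.vu} {t : ℝ} (hn : S.IsNormalized α z t) (ht : t ≠ 0) : S.IsSlope t⁻¹ := by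
  refine ⟨α, z, 1, t, hn.ne_zero, hn.basis, h.H1π_ne_zero hn.apply_x, ?_, ?_, ?_, one_ne_zero, ht,
    (one_div t).symm⟩
  · rw [Submodule.span_singleton_eq_top_iff]
    exact h.exists_smul_eq_H1 hn.apply_x
  · rw [hn.apply_x, one_smul, sub_self]
    exact Submodule.zero_mem _
  · rw [hn.apply_l, sub_self]
    exact Submodule.zero_mem _

open groupCohomology in
-- Applying f kills the images of 1 - x and 1 - l, leaving c₁κ = μ and c₂κ = μt, where α' = κα and μ
-- is the multiple of z in cohomology. The quotient does not depend on κ and μ.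
theorem IsSlope.eq_inv {S : DehnPoint} {α : S.vu} {f : S.vu →ₗ[ℝ] ℝ} (h : Peripheral S.vu α f)
    {z : cocycles₁ S.vu} {t : ℝ} (hn : S.IsNormalized α z t) {s : ℝ} (hs : S.IsSlope s) :
    s = t⁻¹ := by
  obtain ⟨α', z', c₁, c₂, hα', hspan, -, -, hx, hl, hc₁, hc₂, rfl⟩ := hs
  have hmem : α' ∈ S.torusInv := by rw [← hspan]; exact Submodule.mem_span_singleton_self _
  obtain ⟨κ, rfl⟩ := h.exists_smul_of_fix_x (S.fix_of_mem_torusInv hmem).1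
  have hκ : κ ≠ 0 := fun h0 => hα' (by rw [h0, zero_smul])
  obtain ⟨μ, b, hb⟩ :=
    h.eq_smul_add_coboundary (cocycle_isCrossed z) hn.apply_x (cocycle_isCrossed z')
  have ex : f (z' x - c₁ • κ • α) = 0 := by
    obtain ⟨e, he⟩ := hx
    rw [← he, LinearMap.sub_apply, Module.End.one_apply, map_sub, h.inv_x, sub_self]
  have el : f (z' l - c₂ • κ • α) = 0 := by
    obtain ⟨e, he⟩ := hl
    rw [← he, LinearMap.sub_apply, Module.End.one_apply, map_sub, h.inv_l, sub_self]
  rw [hb x, hn.apply_x, map_sub, map_add, h.functional_coboundary_x] at ex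
  rw [hb l, hn.apply_l, map_sub, map_add, h.functional_coboundary_l] at el
  simp only [map_smul, smul_eq_mul, add_zero] at ex el
  have hd := h.detect
  have e1 : μ = c₁ * κ := mul_right_cancel₀ hd (by linear_combination ex)
  have e2 : μ * t = c₂ * κ := mul_right_cancel₀ hd (by linear_combination el)
  have e3 : c₁ * t = c₂ := mul_right_cancel₀ hκ (by rw [← e2, e1]; ring)
  rw [← e3, div_mul_cancel_left₀ hc₁]

/-- The coefficient of the filling slope does not vanish unless the slope is `-q / p`. -/
theorem filling_coefficient_ne_zero {p q : ℤ} (hpq : IsCoprime p q) {t : ℝ} (ht : t ≠ 0)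
    (hs : t⁻¹ ≠ -(q : ℝ) / p) : (p : ℝ) + q * t ≠ 0 := by
  intro h
  -- If p = 0 the quotient is 0 by convention and the slope condition says nothing beyond t ≠ 0;
  -- coprimality gives the contradiction instead.
  by_cases hp : (p : ℝ) = 0
  · rw [hp, zero_add] at h
    have hq : (q : ℝ) = 0 := (mul_eq_zero.1 h).resolve_right ht
    rw [Int.cast_eq_zero.1 hp, Int.cast_eq_zero.1 hq] at hpq
    exact not_isCoprime_zero_zero hpq
  · apply hs
    rw [eq_div_iff hp]
    field_simp
    linear_combination h

theorem freeRho_eq (S : DehnPoint) : freeRho S.u S.z₂ = S.rho.comp proj := by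
  rw [freeRho, S.freeHol_eq]
  rfl

theorem freeAction_of (S : DehnPoint) (g : FreeGroup (Fin 2)) :
    freeAction S.u S.z₂ (MonoidAlgebra.of ℤ _ g) = S.vu.ρ (proj g) := by
  rw [freeAction, freeRho_eq, lorentzAction, groupRingAction, MonoidAlgebra.lift_of]
  rfl

theorem freeAction_fox (S : DehnPoint) (j : Fin 2) (g : FreeGroup (Fin 2)) :
    freeAction S.u S.z₂ (fox j g) = foxAction S.vu j g := by
  rw [freeAction, freeRho_eq]
  rfl

theorem contDiffOn_axisVec {V : Set ℂ} (hV : ∀ u ∈ V, Complex.exp u ≠ 1) (i j : Fin 4) :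
    ContDiffOn ℝ ∞ (fun u => (axisVec (2 / (Complex.exp u - 1))).1 i j) V := by
  have hk : ContDiffOn ℝ ∞ (fun u => 2 / (Complex.exp u - 1)) V := by
    have h : ContDiffOn ℂ ∞ (fun u => 2 / (Complex.exp u - 1)) V :=
      contDiffOn_const.div (Complex.contDiff_exp.contDiffOn.sub contDiffOn_const)
        fun u hu => sub_ne_zero.2 (hV u hu)
    exact h.restrict_scalars ℝ
  refine contDiffOn_kleinMat (G := fun u => halfTurn (2 / (Complex.exp u - 1))) ?_ ?_ i j
  · intro a b
    fin_cases a <;> fin_cases b <;> simp only [halfTurn_val]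
    · exact contDiffOn_const
    · exact hk
    · exact contDiffOn_const
    · exact contDiffOn_const
  · simp only [halfTurn_val, det_fin_two_of]
    simp only [mul_zero, sub_zero]
    exact contDiffOn_const

/-- Normalized cocycles can be chosen smoothly. -/
theorem exists_smooth_normalized (hm : S.m ≠ 1)
    (hx : Module.finrank ℝ (LinearMap.ker (S.vu.ρ x - 1)) = 1)
    (hker : Module.finrank ℝ (LinearMap.ker S.dwdy) = 1) :
    ∃ V : Set ℂ, IsOpen V ∧ S.u ∈ V ∧ ∃ α β : ℂ → vMod,
      (∀ i j, ContDiffOn ℝ ∞ (fun u => (α u).1 i j) V) ∧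
      (∀ i j, ContDiffOn ℝ ∞ (fun u => (β u).1 i j) V) ∧
      ∀ S' : DehnPoint, S'.u ∈ V →
        ∃ (z : groupCohomology.cocycles₁ S'.vu) (t : ℝ),
          S'.IsNormalized (α S'.u) z t ∧ z y = β S'.u := by
  obtain ⟨V, hV, huV, hexp, ζ, hζ, hroot⟩ := S.exists_smooth_shape hm
  let rx : MonoidAlgebra ℤ (FreeGroup (Fin 2)) := MonoidAlgebra.of ℤ _ wx - 1
  have hrx : ∀ S' : DehnPoint, S'.u ∈ V → freeAction S'.u (ζ S'.u) rx =
      (S'.vu.ρ x - 1 : Module.End ℝ S'.vu) := by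
    intro S' hS'
    rw [← hroot S' hS', map_sub, map_one, freeAction_of]
    rfl
  have hD : ∀ S' : DehnPoint, S'.u ∈ V → ∀ j,
      freeAction S'.u (ζ S'.u) (fox j relator) = foxAction S'.vu j relator := by
    intro S' hS' j
    rw [← hroot S' hS', freeAction_fox]
  obtain ⟨W₁, hW₁V, hW₁, huW₁, _, -, h₁⟩ :=
    exists_smooth_solution_vMod (T := fun u => freeAction u (ζ u) rx) hV
      (contDiffOn_freeAction_apply hζ rx) huV (by rw [hrx S huV]; exact hx)
  obtain ⟨W₂, hW₂V, hW₂, huW₂, R, hR, h₂⟩ :=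
    exists_smooth_solution_vMod (T := fun u => freeAction u (ζ u) (fox 1 relator)) hV
      (contDiffOn_freeAction_apply hζ _) huV (by rw [hD S huV]; exact hker)
  let α : ℂ → vMod := fun u => axisVec (2 / (Complex.exp u - 1))
  have hα : ∀ i j, ContDiffOn ℝ ∞ (fun u => (α u).1 i j) V := contDiffOn_axisVec hexp
  let γ : ℂ → vMod := fun u => -freeAction u (ζ u) (fox 0 relator) (α u)
  have hγ : ∀ i j, ContDiffOn ℝ ∞ (fun u => (γ u).1 i j) V := by
    intro i j
    exact (contDiffOn_apply_vMod (contDiffOn_freeAction_apply hζ _) hα i j).neg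
  refine ⟨W₁ ∩ W₂, hW₁.inter hW₂, ⟨huW₁, huW₂⟩, α, fun u => R u (γ u),
    fun i j => (hα i j).mono fun u hu => hW₁V hu.1,
    fun i j => (hR γ (fun i j => (hγ i j).mono hW₂V) i j).mono Set.inter_subset_right, ?_⟩
  rintro S' ⟨hS₁, hS₂⟩
  have hS := hW₁V hS₁
  have hm' : S'.m ≠ 1 := by rw [← S'.exp_u]; exact hexp _ hS
  have hαS : α S'.u = S'.perInv := by
    simp only [α, S'.exp_u]
    rfl
  have hfix := S'.perInv_fix hm' (g := x) rfl
  -- Kernel dimensions are at most one near the base point, and the explicit vectors α and ρ(y)α - α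
  -- keep them from dropping. The peripheral argument thus applies at every nearby point.
  have hx' : Module.finrank ℝ (LinearMap.ker (S'.vu.ρ x - 1)) = 1 := by
    apply le_antisymm
    · have := (h₁ _ hS₁).1
      rw [hrx S' hS] at this
      exact this
    · have : Nontrivial (LinearMap.ker (S'.vu.ρ x - 1)) :=
        ⟨⟨⟨S'.perInv, sub_eq_zero.2 hfix⟩, 0, fun h => S'.perInv_ne_zero (congrArg Subtype.val h)⟩⟩
      exact Module.finrank_pos
  have hκ : S'.dwdy (S'.vu.ρ y S'.perInv - S'.perInv) = 0 := by
    have := (IsCrossed.coboundary S'.vu.ρ S'.perInv).fox_relation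
    rw [hfix, sub_self, map_zero, zero_add] at this
    exact this
  have hκ0 : S'.vu.ρ y S'.perInv - S'.perInv ≠ 0 := sub_ne_zero.2 (S'.perInv_move_y hm')
  have hker' : Module.finrank ℝ (LinearMap.ker S'.dwdy) = 1 := by
    apply le_antisymm
    · have := (h₂ _ hS₂).1
      rw [hD S' hS] at this
      exact this
    · have : Nontrivial (LinearMap.ker S'.dwdy) :=
        ⟨⟨⟨_, hκ⟩, 0, fun h => hκ0 (congrArg Subtype.val h)⟩⟩
      exact Module.finrank_pos
  have hP := S'.peripheral hm' hx' hker'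
  obtain ⟨z₀, hz₀, hz₀x⟩ := hP.exists_crossed S'.perInv
  -- A cocycle with value α on x exists at each point separately, so the right side lies in the
  -- image of ∂w/∂y; the smooth operator R then supplies a solution depending smoothly on u.
  have hsol : foxAction S'.vu 1 relator (R S'.u (γ S'.u)) =
      -foxAction S'.vu 0 relator S'.perInv := by
    have e1 := hz₀.fox_relation
    rw [hz₀x] at e1
    have e2 : γ S'.u = foxAction S'.vu 1 relator (z₀ y) := by
      simp only [γ, hαS]
      rw [hD S' hS]
      exact neg_eq_of_add_eq_zero_right e1
    have e3 := (h₂ _ hS₂).2 ⟨(S'.vu.ρ y S'.perInv - S'.perInv : S'.vu), hκ0, by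
      rw [hD S' hS]
      exact hκ⟩ (z₀ y)
    rw [hD S' hS] at e3
    rw [e2]
    refine e3.trans ?_
    exact (neg_eq_of_add_eq_zero_right e1).symm
  obtain ⟨z, hz, hzx, hzy⟩ := exists_crossed_of_fox_relation (A := S'.vu) (c₀ := S'.perInv)
    (c₁ := R S'.u (γ S'.u)) (by rw [hsol, add_neg_cancel])
  obtain ⟨t, ht⟩ := hP.apply_l hz hzx
  refine ⟨hz.toCocycle, t, ?_, hzy⟩
  rw [hαS]
  exact ⟨S'.perInv_ne_zero, S'.span_perInv hP, hzx, ht⟩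

end DehnPoint

end FigEight

end

/-! ### The theorem for a point of Dehn filling space -/

theorem mainTheorem2 (S : FigEight.DehnPoint)
    (hker : Module.finrank ℝ (LinearMap.ker S.dwdy) = 1)
    (hx : Module.finrank ℝ
      (groupCohomology.H0 (FigEight.resRep S.vu FigEight.circleX)) = 1) :
    Module.finrank ℝ (groupCohomology.H1 S.vu) = 1 ∧
    Function.Bijective (FigEight.resH1 S.vu FigEight.circleX) ∧
    (∃ V : Set ℂ, IsOpen V ∧ S.u ∈ V ∧ ∃ α β : ℂ → FigEight.vMod,
      (∀ i j, ContDiffOn ℝ ∞ (fun u => (α u).1 i j) V) ∧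
      (∀ i j, ContDiffOn ℝ ∞ (fun u => (β u).1 i j) V) ∧
      ∀ S' : FigEight.DehnPoint, S'.u ∈ V →
        ∃ (z : groupCohomology.cocycles₁ S'.vu) (t : ℝ),
          S'.IsNormalized (α S'.u) z t ∧ z FigEight.y = β S'.u) ∧
    (∀ (α : S.vu) (z : groupCohomology.cocycles₁ S.vu) (t : ℝ),
      S.IsNormalized α z t → t ≠ 0 →
        Function.Injective (FigEight.resH1 S.vu FigEight.circleL) ∧
        (Module.finrank ℝ (groupCohomology.H0 (FigEight.resRep S.vu FigEight.circleL)) = 1 →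
          Function.Bijective (FigEight.resH1 S.vu FigEight.circleL)) ∧
        ∃ s : ℝ, S.IsSlope s ∧ (∀ s' : ℝ, S.IsSlope s' → s' = s) ∧ t = s⁻¹ ∧
          ∀ (p q : ℤ) (hpq : (p : ℂ) * S.u + q * S.v = 2 * Real.pi * Complex.I),
            IsCoprime p q → s ≠ -(q : ℝ) / p →
              FigEight.InfProjRigid (S.rhoFill p q hpq) ∧
              Subsingleton (groupCohomology.H1 (FigEight.vRep (S.rhoFill p q hpq)))) := by
  have hx' : Module.finrank ℝ (LinearMap.ker (S.vu.ρ FigEight.x - 1)) = 1 := by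
    rw [← FigEight.finrank_H0_zpowers]
    exact hx
  have hm := S.m_ne_one_of_finrank hx'
  have hP := S.peripheral hm hx' hker
  refine ⟨hP.finrank_H1, hP.bijective_resH1_x, S.exists_smooth_normalized hm hx' hker, ?_⟩
  intro α z t hn ht
  have hα := S.peripheral_of_span hP hn.ne_zero hn.basis
  refine ⟨hα.injective_resH1_l hn.apply_x hn.apply_l ht, fun hl => ?_, t⁻¹,
    S.isSlope_inv hα hn ht, fun s' hs' => hs'.eq_inv hα hn, (inv_inv t).symm, ?_⟩
  · refine hα.bijective_resH1_l hn.apply_x hn.apply_l ht ?_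
    rw [← FigEight.finrank_H0_zpowers]
    exact hl
  · intro p q h hpq hs
    have hv : ∀ z' : FigEight.Pi1 → S.vu, FigEight.IsCrossed S.vu.ρ z' →
        z' (FigEight.x ^ p * FigEight.l ^ q) = 0 → ∃ b : S.vu, ∀ g, z' g = S.vu.ρ g b - b :=
      fun z' hz' h0 => hα.coboundary_of_filling (FigEight.cocycle_isCrossed z) hn.apply_x
        hn.apply_l hz' (FigEight.DehnPoint.filling_coefficient_ne_zero hpq ht hs) h0
    exact ⟨S.infProjRigid_rhoFill hpq h hv, S.subsingleton_H1_vRep_rhoFill h hv⟩
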